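/- **Setting.** Let $\phi\in C^3((0,\infty))$ be convex on $(0,r_*)$ and concave on $(r_*,\infty)$ for some $r_*>0$, with $\phi'''$ bounded on $[\mu,\infty)$ for every $\mu>0$. Let $N\in\mathbb N$, $\varepsilon=1/N$, $F>0$. For a partition with nodes $(x_k)_{k\in\mathbb Z}$, "displacements" are the continuous, piecewise linear, $1$-periodic, mean-zero functions, and "deformations" are the functions $y(x)=Fx+u(x)$, $u$ a displacement. Let $\mathcal U,\mathcal Y$ be these sets for the lattice $\varepsilon\mathbb Z$, let $f\in\mathcal U$, and write $v_\ell=v(\ell\varepsilon)$, $v'_\ell=(v_\ell-v_{\ell-1})/\varepsilon$. *Atomistic problem.* $E_a(y)=\varepsilon\sum_{\ell=1}^N\big[\phi(\tfrac{y_\ell-y_{\ell-1}}{\varepsilon})+\phi(\tfrac{y_\ell-y_{\ell-2}}{\varepsilon})\big]-\varepsilon\sum_{\ell=1}^N f_\ell u_\ell$ for $y=Fx+u\in\mathcal Y$. *QC problem.* Let $\mathbb R=\Omega_a\cup\Omega_c$ be a $1$-periodic decomposition with $\Omega_a$ open, $\Omega_c=\mathbb R\setminus\Omega_a$ the closure of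 its interior, and $(0,\delta)\cup(1-\delta,1)\subset\Omega_c$ for some $\delta>2\varepsilon$. Let $(x_k)_{k\in\mathbb Z}$ be strictly increasing with $x_{k+K}=x_k+1$, the nodes in $(0,1]$ being $x_1,\dots,x_K$, and $T_k=[x_{k-1},x_k]$. Assume that $\partial\Omega_c$ consists of nodes, that the nodes in $\Omega_a$ are exactly the lattice sites in $\Omega_a$, that $|T_k|\ge2\varepsilon$ if $T_k\subset\Omega_c$, and that no interval $(i\varepsilon,(i+2)\varepsilon)$, $i\in\mathbb Z$, contains two points of $\partial\Omega_c$. Let $\mathcal Y_{qc}$ be the set of deformations for this partition and, for $y=Fx+u\in\mathcal Y_{qc}$, $$E_{qc}(y)=\sum_{i=0}^{N-1}\sum_{r=1}^2\Big[\tfrac{|b\cap\Omega_a|}{r}\,\phi\big(rD_{b\cap\Omega_a}y\big)+\tfrac1r\int_{b\cap\Omega_c}\phi(ry'(x))\,dx\Big]-\sum_{k=1}^K\tfrac12(x_{k+1}-x_{k-1})f(x_k)u(x_k),$$ where $b=(i\varepsilon,(i+r)\varepsilon)$ and $D_{(L,R)}y=\frac{y(R)-y(L)}{R-L}$ (the first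 term being $0$ if $b\cap\Omega_a=\emptyset$). A *solution* of the atomistic (QC) problem is a local minimizer of $E_a$ in $\mathcal Y$ (of $E_{qc}$ in $\mathcal Y_{qc}$) with $y'>0$. For $y=Fx+u\in\mathcal Y_{qc}$ let $Jy=Fx+I_\varepsilon u-\varepsilon\sum_{\ell=1}^N u(\ell\varepsilon)\in\mathcal Y$, where $I_\varepsilon$ is piecewise linear interpolation on $\varepsilon\mathbb Z$. For $y\in\mathcal Y$ let $A_*(y)=\min_{1\le\ell\le N}\big[\phi''(y'_\ell)+2\phi''(y'_{\ell-1}+y'_\ell)+2\phi''(y'_\ell+y'_{\ell+1})\big]$. *Estimators.* Let $\ell_k=\max\{\ell:\ell\varepsilon\le x_k\}$, $\theta_k=(x_k-\ell_k\varepsilon)/\varepsilon$, $\mathcal K_c=\{1\le k\le K:T_k\subset\Omega_c\}$. For $y\in\mathcal Y_{qc}$ and fixed $k$ write $p=\phi'$, $\theta=\theta_k$, $g_m=y'|_{T_m}$, $\lambda=(1-\theta)g_{k+1}+(1+\theta)g_k$, $\rho=(2-\theta)g_{k+1}+\theta g_k$, $\sigma=(1-\theta)p(g_{k+1})+\theta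 p(g_k)-p((1-\theta)g_{k+1}+\theta g_k)$. Define $J_{k,0},J_{k,1},J_{k,2}$ as follows. - If $T_k,T_{k+1}\subset\Omega_c$: $J_{k,0}=p(2g_k)-p(\lambda)$, $J_{k,1}=\sigma+2(1-\theta)p(2g_{k+1})+2\theta p(2g_k)-p(\rho)-p(\lambda)$, $J_{k,2}=p(2g_{k+1})-p(\rho)$. - If only $T_k\subset\Omega_c$: with $q=g_{k+2}+(1-\theta)g_{k+1}+\theta g_k$, $q_a=\frac{2}{2-\theta}g_{k+2}+\frac{2(1-\theta)}{2-\theta}g_{k+1}$, let $J_{k,0}=p(\lambda)-p(2g_k)$, $J_{k,1}=\sigma+[(1-\theta)p(q_a)+\theta p(2g_k)-p(q)]+[(1-\theta)p(2g_{k+1})+\theta p(2g_k)-p(\lambda)]$, $J_{k,2}=p(q_a)-p(q)$. - If only $T_{k+1}\subset\Omega_c$: with $g_-=y'_{\ell_k}$ (the gradient on the lattice cell $[(\ell_k-1)\varepsilon,\ell_k\varepsilon]$), $q=(1-\theta)g_{k+1}+\theta g_k+g_-$, $q_a=\frac{2\theta}{1+\theta}g_k+\frac{2}{1+\theta}g_-$,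 let $J_{k,0}=p(q)-p(q_a)$, $J_{k,1}=\sigma+[\theta p(q_a)+(1-\theta)p(2g_{k+1})-p(q)]+[(1-\theta)p(2g_{k+1})+\theta p(2g_k)-p(\rho)]$, $J_{k,2}=p(2g_{k+1})-p(\rho)$. Let $w_k=\frac12$ if $T_k,T_{k+1}\subset\Omega_c$ and $w_k=1$ at an interface node, and $$\mathscr E_{store}(y)=\Big\{\sum_{k\in\mathcal K_c}\varepsilon\Big(w_{k-1}\sum_{j=0}^2J_{k-1,j}^2+w_k\sum_{j=0}^2J_{k,j}^2\Big)\Big\}^{1/2}.$$ For $k\in\mathcal K_c$ let $x_{k-1}=p_0<p_1<\dots<p_L=x_k$ ($L=L_k$) be $x_{k-1}$, $x_k$ and the lattice sites strictly between them; $\varepsilon_i=p_i-p_{i-1}$, $\bar\varepsilon_i=\frac12(\varepsilon_i+\varepsilon_{i+1})$, $\mathsf f_i=f(p_i)$, $\mathsf f'_i=(\mathsf f_i-\mathsf f_{i-1})/\varepsilon_i$, $\mathsf f''_i=(\mathsf f'_{i+1}-\mathsf f'_i)/\bar\varepsilon_i$. Let $n$ be the number of elements of $\{\varepsilon,2\varepsilon,\dots,N\varepsilon\}\cup\{x_1,\dots,x_K\}$,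 $\tilde h_k=\frac12L\varepsilon$, $\hat h_k=\big[(L\varepsilon)((L+1)\varepsilon)^2/|T_k|\big]^{1/2}$, and $\mathscr E_{ext}(f)=\{\sum_{k\in\mathcal K_c}(\eta^f_k)^2\}^{1/2}$ with $$(\eta_k^f)^2=\tfrac1{128}\big[\varepsilon^3(f'_{\ell_{k-1}+1})^2+\varepsilon^3(f'_{\ell_k+1})^2\big]^2+\tilde h_k^2\sum_{i=1}^{L-1}\bar\varepsilon_i\mathsf f_i^2+\tfrac1{64}(n\varepsilon)^4\hat h_k^4\sum_{i=1}^{L-1}\bar\varepsilon_i(\mathsf f''_i)^2+\hat h_k^4\sum_{i=1}^{L}\varepsilon_i(\mathsf f'_i)^2 .$$ **Theorem.** For every $\alpha>0$ there is $\tau_0>0$, depending only on $\phi$, $r_*$ and $\alpha$, such that for all $N$, $F$, $f$, decompositions and meshes as above the following holds. Let $y_{qc}$ be a solution of the QC problem with $(Jy_{qc})'_\ell\ge r_*/2$ for all $\ell\in\mathbb Z$ and $A_*(Jy_{qc})\ge\alpha$, and let $y_a$ be a solution of the atomistic problem with $\|(y_a-Jy_{qc})'\|_{L^\infty[0,1]}\le\tau$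 for some $0<\tau\le\tau_0$. Then, with $e=y_a-Jy_{qc}$, $$\|e'\|_{L^2[0,1]}=\Big(\varepsilon\sum_{\ell=1}^N|e'_\ell|^2\Big)^{1/2}\le\frac{2}{A_*(Jy_{qc})}\big(\mathscr E_{store}(y_{qc})+\mathscr E_{ext}(f)\big),$$ and moreover $A_*(y_a)>0$ and the same bound holds with $A_*(y_a)$ in place of $A_*(Jy_{qc})$. -/

import Mathlib

open MeasureTheory Set

noncomputable section

namespace QC

/-! ### Meshes, piecewise linear functions, difference quotients -/

/-- The atomic sites `ℓ ε` of the reference lattice, with spacing `ε = 1 / N`. -/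
def latt (N : ℕ) (l : ℤ) : ℝ := (l : ℝ) / (N : ℝ)

/-- The lattice spacing `ε = 1 / N`. -/
def spacing (N : ℕ) : ℝ := 1 / (N : ℝ)

/-- The gradient of `g` on the element `T_k = [x_{k-1}, x_k]`: for a function that is linear on
`T_k` it is the slope there, in general it is the difference quotient `g'_k` of the nodal values. -/
def elemGrad (x : ℤ → ℝ) (g : ℝ → ℝ) (k : ℤ) : ℝ :=
  (g (x k) - g (x (k - 1))) / (x k - x (k - 1))

/-- `g` belongs to `P₁(T) ∩ C⁰(ℝ)` for the partition `T` with nodes `x_k`. -/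
def IsP1 (x : ℤ → ℝ) (g : ℝ → ℝ) : Prop :=
  Continuous g ∧ ∀ k : ℤ, ∃ a b : ℝ, ∀ t ∈ Icc (x (k - 1)) (x k), g t = a * t + b

/-- Displacements over the partition with nodes `x_k`: continuous, piecewise linear, 1-periodic,
of mean zero. -/
def Displacement (x : ℤ → ℝ) : Set (ℝ → ℝ) :=
  {u | IsP1 x u ∧ (∀ t, u (t + 1) = u t) ∧ ∫ t in (0 : ℝ)..1, u t = 0}

/-- The displacement `u(t) = y(t) - F t` of a deformation. -/
def displ (F : ℝ) (y : ℝ → ℝ) : ℝ → ℝ := fun t => y t - F * t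

/-- Admissible deformations `y(t) = F t + u(t)` with macroscopic gradient `F`. -/
def Deformation (x : ℤ → ℝ) (F : ℝ) : Set (ℝ → ℝ) := {y | displ F y ∈ Displacement x}

/-! ### The interaction potential -/

/-- A Lennard-Jones type potential on `(0, ∞)`: of class `C³`, convex on `(0, r_*)`, concave on
`(r_*, ∞)`, with third derivative bounded on each `[μ, ∞)`, `μ > 0`.
The values of `phi` on `(-∞, 0]` are irrelevant. -/
structure IsPotential (phi : ℝ → ℝ) (rstar : ℝ) : Prop where
  rstar_pos : 0 < rstar
  smooth : ContDiffOn ℝ 3 phi (Ioi 0)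
  convex : ConvexOn ℝ (Ioo 0 rstar) phi
  concave : ConcaveOn ℝ (Ioi rstar) phi
  third_bounded : ∀ μ : ℝ, 0 < μ → ∃ M : ℝ, ∀ r : ℝ, μ ≤ r → |iteratedDeriv 3 phi r| ≤ M

/-! ### The atomistic model -/

/-- The stored atomistic energy per period (nearest and next-nearest neighbours). -/
def atomStored (phi : ℝ → ℝ) (N : ℕ) (y : ℝ → ℝ) : ℝ :=
  spacing N * ∑ l ∈ Finset.Icc (1 : ℤ) N, phi ((y (latt N l) - y (latt N (l - 1))) / spacing N) +
  spacing N * ∑ l ∈ Finset.Icc (1 : ℤ) N, phi ((y (latt N l) - y (latt N (l - 2))) / spacing N)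

/-- The pairing `⟨f, u⟩_ε = ε ∑_{ℓ=1}^N f_ℓ u_ℓ`. -/
def atomPairing (N : ℕ) (f u : ℝ → ℝ) : ℝ :=
  ∑ l ∈ Finset.Icc (1 : ℤ) N, spacing N * f (latt N l) * u (latt N l)

/-- The total atomistic energy. -/
def atomEnergy (phi : ℝ → ℝ) (N : ℕ) (F : ℝ) (f y : ℝ → ℝ) : ℝ :=
  atomStored phi N y - atomPairing N f (displ F y)

/-- `y` is a solution of the minimization problem for the energy `E` over the deformations over the
partition with nodes `x_k`: it is admissible, its gradient is positive (the potential is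
defined for positive arguments only), and it is a local minimizer.  The deformations form a
finite-dimensional affine space, so that any norm, here the supremum norm, gives the same notion. -/
structure IsSolution (E : (ℝ → ℝ) → ℝ) (x : ℤ → ℝ) (F : ℝ) (y : ℝ → ℝ) : Prop where
  admissible : y ∈ Deformation x F
  grad_pos : ∀ k : ℤ, 0 < elemGrad x y k
  local_min : ∃ ρ : ℝ, 0 < ρ ∧ ∀ z ∈ Deformation x F, (∀ t : ℝ, |z t - y t| ≤ ρ) → E y ≤ E z

/-- `A_ℓ(y) = φ''(y'_ℓ) + 2 φ''(y'_{ℓ-1} + y'_ℓ) + 2 φ''(y'_ℓ + y'_{ℓ+1})`. -/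
def stabCoeff (phi : ℝ → ℝ) (N : ℕ) (y : ℝ → ℝ) (l : ℤ) : ℝ :=
  iteratedDeriv 2 phi (elemGrad (latt N) y l) +
  2 * iteratedDeriv 2 phi (elemGrad (latt N) y (l - 1) + elemGrad (latt N) y l) +
  2 * iteratedDeriv 2 phi (elemGrad (latt N) y l + elemGrad (latt N) y (l + 1))

/-- `A_*(y) = min_{ℓ = 1, …, N} A_ℓ(y)`. -/
def stabConst (phi : ℝ → ℝ) (N : ℕ) (y : ℝ → ℝ) : ℝ :=
  ⨅ l : Finset.Icc (1 : ℤ) N, stabCoeff phi N y l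

/-- The norm `‖e'‖_{ℓ²_ε} = (ε ∑_{ℓ=1}^N |e'_ℓ|²)^{1/2}`. -/
def gradNormTwo (N : ℕ) (e : ℝ → ℝ) : ℝ :=
  Real.sqrt (∑ l ∈ Finset.Icc (1 : ℤ) N, spacing N * (elemGrad (latt N) e l) ^ 2)

/-! ### The quasicontinuum model -/

/-- A 1-periodic decomposition `ℝ = Ω_a ∪ Ω_c`, `Ω_c = ℝ \ Ω_a`, into an atomistic and a continuum
region, with a mesh adapted to it.  The mesh is indexed so that `x_1, …, x_K` are the nodes in
`(0, 1]`; the element `T_k` is `[x_{k-1}, x_k]`. -/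
structure Mesh (N : ℕ) where
  /-- number of elements per period -/
  K : ℕ
  K_pos : 0 < K
  /-- the nodes -/
  x : ℤ → ℝ
  strictMono : StrictMono x
  x_add_K : ∀ k : ℤ, x (k + K) = x k + 1
  first_pos : 0 < x 1
  last_le : x K ≤ 1
  /-- the atomistic region -/
  Oa : Set ℝ
  isOpen_Oa : IsOpen Oa
  periodic_Oa : ∀ t : ℝ, t + 1 ∈ Oa ↔ t ∈ Oa
  /-- `Ω_c` is a union of nondegenerate closed intervals -/
  regular_Oc : closure (interior Oaᶜ) = Oaᶜ
  /-- the atomistic region stays away from the boundary of the period -/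
  buffer : ∃ δ : ℝ, 2 * spacing N < δ ∧ Ioo 0 δ ∪ Ioo (1 - δ) 1 ⊆ Oaᶜ
  /-- inside the atomistic region the nodes are the atoms -/
  node_of_atom : ∀ l : ℤ, latt N l ∈ Oa → ∃ k : ℤ, x k = latt N l
  atom_of_node : ∀ k : ℤ, x k ∈ Oa → ∃ l : ℤ, x k = latt N l
  /-- the interfaces are nodes -/
  interface_node : frontier Oaᶜ ⊆ range x
  /-- continuum elements have length at least `2 ε` -/
  continuum_size : ∀ k : ℤ, Icc (x (k - 1)) (x k) ⊆ Oaᶜ → 2 * spacing N ≤ x k - x (k - 1)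
  /-- no interaction bond crosses two interfaces -/
  bond_interface : ∀ i : ℤ, (frontier Oaᶜ ∩ Ioo (latt N i) (latt N (i + 2))).Subsingleton

/-- `D_ω y = (y(R_ω) - y(L_ω)) / |ω|` for an open interval `ω = (L_ω, R_ω)`. -/
def intervalQuot (ω : Set ℝ) (y : ℝ → ℝ) : ℝ :=
  (y (sSup ω) - y (sInf ω)) / volume.real ω

/-- The bond `(i ε, (i + r) ε)`. -/
def bond (N : ℕ) (i : ℤ) (r : ℕ) : Set ℝ := Ioo (latt N i) (latt N (i + r))

namespace Mesh

variable {N : ℕ} (m : Mesh N)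

/-- The atomistic contribution `a_b(y)` of the bond `b = (i ε, (i + r) ε)`
(zero if `b` does not meet `Ω_a`). -/
def bondAtom (phi y : ℝ → ℝ) (i : ℤ) (r : ℕ) : ℝ :=
  volume.real (bond N i r ∩ m.Oa) / r * phi (r * intervalQuot (bond N i r ∩ m.Oa) y)

/-- The continuum contribution `c_b(y)` of the bond `b = (i ε, (i + r) ε)`. -/
def bondCont (phi y : ℝ → ℝ) (i : ℤ) (r : ℕ) : ℝ :=
  1 / r * ∫ t in bond N i r ∩ m.Oaᶜ, phi (r * deriv y t)

/-- The stored QC energy per period. -/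
def qcStored (phi y : ℝ → ℝ) : ℝ :=
  ∑ i ∈ Finset.range N, ∑ r ∈ ({1, 2} : Finset ℕ), (m.bondAtom phi y i r + m.bondCont phi y i r)

/-- The pairing `⟨f, u⟩_h = ∑_{k=1}^K (x_{k+1} - x_{k-1}) f(x_k) u(x_k) / 2`. -/
def qcPairing (f u : ℝ → ℝ) : ℝ :=
  ∑ k ∈ Finset.Icc (1 : ℤ) m.K, 1 / 2 * (m.x (k + 1) - m.x (k - 1)) * f (m.x k) * u (m.x k)

/-- The total QC energy. -/
def qcEnergy (phi : ℝ → ℝ) (F : ℝ) (f y : ℝ → ℝ) : ℝ :=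
  m.qcStored phi y - m.qcPairing f (displ F y)

end Mesh

/-- Piecewise linear interpolation `I_ε` at the atomic sites. -/
def lattInterp (N : ℕ) (g : ℝ → ℝ) (t : ℝ) : ℝ :=
  g (latt N ⌊N * t⌋) + Int.fract (N * t) * (g (latt N (⌊N * t⌋ + 1)) - g (latt N ⌊N * t⌋))

/-- The projection `J y = F x + I_ε u - ε ∑_{ℓ=1}^N u(ℓ ε)`, `u = y - F x`, of a QC deformation to
an atomistic deformation. -/
def proj (N : ℕ) (F : ℝ) (y : ℝ → ℝ) (t : ℝ) : ℝ :=
  F * t + lattInterp N (displ F y) t -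
    spacing N * ∑ l ∈ Finset.Icc (1 : ℤ) N, displ F y (latt N l)

/-! ### The residual estimator for the stored energy -/

namespace Mesh

variable {N : ℕ} (m : Mesh N)

/-- `T_k ⊆ Ω_c`. -/
def IsCont (k : ℤ) : Prop := Icc (m.x (k - 1)) (m.x k) ⊆ m.Oaᶜ

/-- `ℓ_k`, the largest `ℓ` with `ℓ ε ≤ x_k`. -/
def site (k : ℤ) : ℤ := ⌊N * m.x k⌋

/-- `θ_k = (x_k - ℓ_k ε) / ε`. -/
def theta (k : ℤ) : ℝ := Int.fract (N * m.x k)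

/-- The three jump terms at a node `x_k` between two continuum elements. -/
def jumpInner (phi y : ℝ → ℝ) (k : ℤ) : Fin 3 → ℝ :=
  let p := deriv phi
  let θ := m.theta k
  let g := elemGrad m.x y
  ![p (2 * g k) - p ((1 - θ) * g (k + 1) + (1 + θ) * g k),
    ((1 - θ) * p (g (k + 1)) + θ * p (g k) - p ((1 - θ) * g (k + 1) + θ * g k)) +
      (2 * (1 - θ) * p (2 * g (k + 1)) + 2 * θ * p (2 * g k)
        - p ((2 - θ) * g (k + 1) + θ * g k) - p ((1 - θ) * g (k + 1) + (1 + θ) * g k)),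
    p (2 * g (k + 1)) - p ((2 - θ) * g (k + 1) + θ * g k)]

/-- The three jump terms at the left interface `x_k` of an atomistic region. -/
def jumpLeft (phi y : ℝ → ℝ) (k : ℤ) : Fin 3 → ℝ :=
  let p := deriv phi
  let θ := m.theta k
  let g := elemGrad m.x y
  -- `r_b D_b y` and `r_b D_{b ∩ Ω_a} y` for the bond `b = (ℓ_k ε, (ℓ_k + 2) ε)`
  let q := g (k + 2) + (1 - θ) * g (k + 1) + θ * g k
  let qa := 2 / (2 - θ) * g (k + 2) + 2 * (1 - θ) / (2 - θ) * g (k + 1)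
  ![p ((1 - θ) * g (k + 1) + (1 + θ) * g k) - p (2 * g k),
    ((1 - θ) * p (g (k + 1)) + θ * p (g k) - p ((1 - θ) * g (k + 1) + θ * g k)) +
      ((1 - θ) * p qa + θ * p (2 * g k) - p q) +
      ((1 - θ) * p (2 * g (k + 1)) + θ * p (2 * g k)
        - p ((1 - θ) * g (k + 1) + (1 + θ) * g k)),
    p qa - p q]

/-- The three jump terms at the right interface `x_k` of an atomistic region.  Here `gm` is the
gradient on the lattice cell `[(ℓ_k - 1) ε, ℓ_k ε]`, which is the element `T_{k-1}` if `x_k` is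
not an atomic site, and `T_k` if it is. -/
def jumpRight (phi y : ℝ → ℝ) (k : ℤ) : Fin 3 → ℝ :=
  let p := deriv phi
  let θ := m.theta k
  let g := elemGrad m.x y
  let gm := elemGrad (latt N) y (m.site k)
  -- `r_b D_b y` and `r_b D_{b ∩ Ω_a} y` for the bond `b = ((ℓ_k - 1) ε, (ℓ_k + 1) ε)`
  let q := (1 - θ) * g (k + 1) + θ * g k + gm
  let qa := 2 * θ / (1 + θ) * g k + 2 / (1 + θ) * gm
  ![p q - p qa,
    (θ * p (g k) + (1 - θ) * p (g (k + 1)) - p ((1 - θ) * g (k + 1) + θ * g k)) +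
      (θ * p qa + (1 - θ) * p (2 * g (k + 1)) - p q) +
      ((1 - θ) * p (2 * g (k + 1)) + θ * p (2 * g k) - p ((2 - θ) * g (k + 1) + θ * g k)),
    p (2 * g (k + 1)) - p ((2 - θ) * g (k + 1) + θ * g k)]

open Classical in
/-- `∑_{j=0}^2 [[φ']]²_{ℓ_k + j}` at the node `x_k`. -/
def jumpSq (phi y : ℝ → ℝ) (k : ℤ) : ℝ :=
  if m.IsCont k then
    if m.IsCont (k + 1) then ∑ j : Fin 3, (m.jumpInner phi y k j) ^ 2
    else ∑ j : Fin 3, (m.jumpLeft phi y k j) ^ 2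
  else
    if m.IsCont (k + 1) then ∑ j : Fin 3, (m.jumpRight phi y k j) ^ 2
    else 0

open Classical in
/-- The share of the jumps at `x_k` carried by an adjacent continuum element: one half if the
element on the other side of `x_k` is also a continuum element, everything at an interface. -/
def share (k : ℤ) : ℝ := if m.IsCont k ∧ m.IsCont (k + 1) then 1 / 2 else 1

/-- The squared indicator `(η_k^e)²` of a continuum element `T_k`. -/
def etaStoreSq (phi y : ℝ → ℝ) (k : ℤ) : ℝ :=
  spacing N * m.share (k - 1) * m.jumpSq phi y (k - 1) + spacing N * m.share k * m.jumpSq phi y k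

open Classical in
/-- The stored energy estimator `(∑_{k ∈ K_c} (η_k^e)²)^{1/2}`. -/
def estStore (phi y : ℝ → ℝ) : ℝ :=
  Real.sqrt (∑ k ∈ Finset.Icc (1 : ℤ) m.K, if m.IsCont k then m.etaStoreSq phi y k else 0)

/-! ### The residual estimator for the external force

The common refinement `T^r` has as nodes all atomic sites and all mesh nodes.  Within `T_k` its
nodes are `x_{k-1}`, the atomic sites strictly between `x_{k-1}` and `x_k`, and `x_k`. -/

/-- The number `j_k - j_{k-1}` of elements of `T^r` contained in `T_k`. -/
def numSub (k : ℤ) : ℕ := (⌈N * m.x k⌉ - ⌊N * m.x (k - 1)⌋).toNat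

/-- The node `x^r_{j_{k-1} + i}`, `0 ≤ i ≤ j_k - j_{k-1}`, of `T^r` in `T_k`. -/
def subNode (k : ℤ) (i : ℕ) : ℝ :=
  if i = 0 then m.x (k - 1) else if m.numSub k ≤ i then m.x k
  else latt N (⌊N * m.x (k - 1)⌋ + i)

/-- The length of the `i`-th element of `T^r` in `T_k`. -/
def subLen (k : ℤ) (i : ℕ) : ℝ := m.subNode k i - m.subNode k (i - 1)

/-- The average length of the elements of `T^r` adjacent to the `i`-th node. -/
def subLenAvg (k : ℤ) (i : ℕ) : ℝ := 1 / 2 * (m.subLen k i + m.subLen k (i + 1))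

/-- First difference quotient on `T^r`. -/
def subGrad (f : ℝ → ℝ) (k : ℤ) (i : ℕ) : ℝ :=
  (f (m.subNode k i) - f (m.subNode k (i - 1))) / m.subLen k i

/-- Second difference quotient on `T^r`. -/
def subGradTwo (f : ℝ → ℝ) (k : ℤ) (i : ℕ) : ℝ :=
  (m.subGrad f k (i + 1) - m.subGrad f k i) / m.subLenAvg k i

open Classical in
/-- The number `n` of nodes of `T^r` in a period `(0, 1]`. -/
def numNodes : ℕ :=
  ((Finset.Icc (1 : ℤ) N).image (latt N) ∪ (Finset.Icc (1 : ℤ) m.K).image m.x).card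

/-- `h̃_k = (j_k - j_{k-1}) ε / 2`. -/
def hTilde (k : ℤ) : ℝ := 1 / 2 * m.numSub k * spacing N

/-- `ĥ_k = (((j_k - j_{k-1}) ε) ((j_k - j_{k-1} + 1) ε)² / |T_k|)^{1/2}`. -/
def hHat (k : ℤ) : ℝ :=
  Real.sqrt ((m.numSub k * spacing N) * ((m.numSub k + 1) * spacing N) ^ 2 /
    (m.x k - m.x (k - 1)))

/-- The squared indicator `(η_k^f)²` of a continuum element `T_k`. -/
def etaExtSq (f : ℝ → ℝ) (k : ℤ) : ℝ :=
  1 / 128 * (spacing N ^ 3 * (elemGrad (latt N) f (m.site (k - 1) + 1)) ^ 2 +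
      spacing N ^ 3 * (elemGrad (latt N) f (m.site k + 1)) ^ 2) ^ 2 +
  m.hTilde k ^ 2 *
    ∑ i ∈ Finset.Ico 1 (m.numSub k), m.subLenAvg k i * (f (m.subNode k i)) ^ 2 +
  1 / 64 * (m.numNodes * spacing N) ^ 4 * m.hHat k ^ 4 *
    ∑ i ∈ Finset.Ico 1 (m.numSub k), m.subLenAvg k i * (m.subGradTwo f k i) ^ 2 +
  m.hHat k ^ 4 *
    ∑ i ∈ Finset.Icc 1 (m.numSub k), m.subLen k i * (m.subGrad f k i) ^ 2

open Classical in
/-- The external force estimator `(∑_{k ∈ K_c} (η_k^f)²)^{1/2}`. -/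
def estExt (f : ℝ → ℝ) : ℝ :=
  Real.sqrt (∑ k ∈ Finset.Icc (1 : ℤ) m.K, if m.IsCont k then m.etaExtSq f k else 0)

end Mesh

end QC

end

noncomputable section

namespace QC

/-! ### Sums over a period -/

/-! The estimate is "residual plus stability". Write z = J y_qc and e = y_a - z, and let v be e
shifted to mean zero, an admissible lattice direction.

Stability (`sum_stress_ge`). Since z'_ℓ ≥ r_*/2, second-neighbour stretches of z lie where φ'' ≤ 0,
so (e'_ℓ + e'_{ℓ-1})² ≤ 2(e'_ℓ² + e'_{ℓ-1}²) bounds their energy from below. Collecting the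
coefficient of e'_ℓ² produces exactly A_ℓ(z). The boundedness of φ''' costs a further 9Mτ, so
(A_*(z) - 9Mτ)‖e'‖² is at most the difference of the atomistic stresses of y_a and z, tested with v.

Residual (`residual_le`). The first variation at y_a equals the force pairing. The QC equation may
only be tested with mesh functions, but the formula `qcDeriv` sees its direction only through
differences of values at mesh nodes. The mesh interpolant W of v, shifted by a constant c to mean
zero, may therefore be replaced by v itself (`qcDeriv_congr`). As f has lattice mean zero, the
residual splits into a stored part, `qcDeriv` minus `atomDeriv` at y_qc, and the quadrature error
between the two pairings of f with v - c.

Stored part. Both derivatives are sums over bonds. A bond inside Ω_a or inside one continuum element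
contributes no difference, so only bonds crossing a node of the continuum region remain. The mesh
assumptions put at most one such node in a bond of length 2ε. The three bonds attached to a node
together give ε(J₀e₀ + J₁e₁ + J₂e₂) up to signs, with e₀, e₁, e₂ the gradients of v on three
consecutive lattice cells (`nodeDefect_le`). Summing loses a factor 3 in the square of ‖v'‖.

External part. The lattice pairing is the integral of fw + ε²f'w'/6, whereas the QC pairing is the
trapezoidal rule on each mesh element. On a continuum element, integration by parts against ψ(t) =
(t-a)(b-t)/2 represents the error by f, f' and the jumps of f' (`trapezoid_residual_le`). An
atomistic element contributes only if it is a truncated lattice cell; the cut-off piece then belongs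
to a neighbouring continuum element, whose indicator pays for it (`atom_defect_le`). The values of v
- c are controlled by ‖v'‖ because c lies within the range of v.

Each residual is first bounded with a free Young parameter λ, which is optimized afterwards by
`le_of_forall_amgm`. The constants √3 and √(7/2) are both below 19/10. For small τ the stability
constant loses at most the factor 19/20, and (19/10)/(19/20) = 2. -/

theorem sum_Icc_eq_sum_range (h : ℤ → ℝ) (n : ℕ) :
    ∑ k ∈ Finset.Icc (1 : ℤ) n, h k = ∑ i ∈ Finset.range n, h (i + 1) := by
  induction n with
  | zero => simp
  | succ n ih =>
    rw [Finset.sum_range_succ, ← ih]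
    have : Finset.Icc (1 : ℤ) ((n + 1 : ℕ) : ℤ) = insert ((n : ℤ) + 1) (Finset.Icc (1 : ℤ) n) := by
      ext k; simp only [Finset.mem_Icc, Finset.mem_insert]; push_cast; omega
    rw [this, Finset.sum_insert (by simp), add_comm]

theorem sum_Icc_shift (h : ℤ → ℝ) (n : ℕ) (hp : ∀ k, h (k + n) = h k) (s : ℤ) :
    ∑ k ∈ Finset.Icc (1 : ℤ) n, h (k + s) = ∑ k ∈ Finset.Icc (1 : ℤ) n, h k := by
  have step : ∀ s : ℤ, ∑ k ∈ Finset.Icc (1 : ℤ) n, h (k + (s + 1)) =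
      ∑ k ∈ Finset.Icc (1 : ℤ) n, h (k + s) := by
    intro s
    rw [sum_Icc_eq_sum_range (fun k => h (k + (s + 1))), sum_Icc_eq_sum_range (fun k => h (k + s))]
    have h1 := Finset.sum_range_succ (fun i : ℕ => h ((i : ℤ) + 1 + s)) n
    have h2 := Finset.sum_range_succ' (fun i : ℕ => h ((i : ℤ) + 1 + s)) n
    have h3 : h ((n : ℤ) + 1 + s) = h (((0 : ℕ) : ℤ) + 1 + s) := by
      rw [← hp (((0 : ℕ) : ℤ) + 1 + s)]; congr 1; push_cast; ring
    have h4 : ∑ i ∈ Finset.range n, h ((i : ℤ) + 1 + (s + 1)) =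
        ∑ i ∈ Finset.range n, h (((i + 1 : ℕ) : ℤ) + 1 + s) := by
      refine Finset.sum_congr rfl fun i _ => ?_
      congr 1; push_cast; ring
    rw [h4]; linarith
  induction s using Int.induction_on with
  | zero => simp
  | succ i ih => rw [step, ih]
  | pred i ih =>
    have := step (-(i : ℤ) - 1)
    rw [← ih, ← this]
    simp

theorem sum_Ico_window (h : ℤ → ℝ) (n : ℕ) (hp : ∀ k, h (k + n) = h k) (a : ℤ) :
    ∑ k ∈ Finset.Ico a (a + n), h k = ∑ k ∈ Finset.Icc (1 : ℤ) n, h k := by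
  rw [← sum_Icc_shift h n hp (a - 1)]
  symm
  refine Finset.sum_bij (fun k _ => k + (a - 1)) ?_ ?_ ?_ ?_
  · intro k hk; simp only [Finset.mem_Icc, Finset.mem_Ico] at *; omega
  · intro k _ l _ hkl; omega
  · intro k hk; refine ⟨k - (a - 1), ?_, by ring⟩
    simp only [Finset.mem_Icc, Finset.mem_Ico] at *; omega
  · intro k _; rfl

theorem sum_range_periodic (h : ℤ → ℝ) (n : ℕ) (hp : ∀ k, h (k + n) = h k) :
    ∑ i ∈ Finset.range n, h i = ∑ k ∈ Finset.Icc (1 : ℤ) n, h k := by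
  rw [← sum_Icc_shift h n hp (-1), sum_Icc_eq_sum_range (fun k => h (k + -1))]
  refine Finset.sum_congr rfl fun i _ => ?_
  congr 1; ring

/-! ### Periodic partitions -/

/-- The nodes `x_k` form a partition of `ℝ` of period `1`, with `K` elements per period. -/
structure IsPartition (x : ℤ → ℝ) (K : ℕ) : Prop where
  pos : 0 < K
  mono : StrictMono x
  add : ∀ k : ℤ, x (k + K) = x k + 1

theorem Mesh.isPartition {N : ℕ} (m : Mesh N) : IsPartition m.x m.K :=
  ⟨m.K_pos, m.strictMono, m.x_add_K⟩

theorem latt_isPartition {N : ℕ} (hN : 0 < N) : IsPartition (latt N) N := by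
  have h0 : (0 : ℝ) < N := by exact_mod_cast hN
  refine ⟨hN, fun a b hab => ?_, fun k => ?_⟩
  · have : (a : ℝ) < b := by exact_mod_cast hab
    unfold latt; gcongr
  · unfold latt; push_cast; field_simp

namespace IsPartition

variable {x : ℤ → ℝ} {K : ℕ}

theorem add_mul (hx : IsPartition x K) (k z : ℤ) : x (k + z * K) = x k + z := by
  induction z using Int.induction_on with
  | zero => simp
  | succ i ih =>
    have := hx.add (k + i * K)
    rw [ih] at this
    rw [show k + ((i : ℤ) + 1) * K = k + i * K + K by ring, this]; push_cast; ring
  | pred i ih =>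
    have := hx.add (k + (-(i : ℤ) - 1) * K)
    rw [show k + (-(i : ℤ) - 1) * K + K = k + (-(i : ℤ)) * K by ring, ih] at this
    push_cast at *; linarith

theorem lt_node (hx : IsPartition x K) (k : ℤ) : x (k - 1) < x k := hx.mono (by omega)

theorem exists_index (hx : IsPartition x K) (t : ℝ) : ∃ k : ℤ, x (k - 1) ≤ t ∧ t < x k := by
  have hub : ∃ k : ℤ, t < x k := by
    refine ⟨0 + (⌊t - x 0⌋ + 1) * K, ?_⟩
    rw [hx.add_mul]; push_cast
    have := Int.lt_floor_add_one (t - x 0); linarith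
  have hlb : ∀ k : ℤ, t < x k → (0 + (⌊t - x 0⌋) * K : ℤ) ≤ k := by
    intro k hk
    by_contra hlt
    push Not at hlt
    have h1 := hx.mono hlt
    rw [hx.add_mul] at h1
    have := Int.floor_le (t - x 0); linarith
  obtain ⟨k, hk, hmin⟩ := Int.exists_least_of_bdd ⟨_, hlb⟩ hub
  refine ⟨k, ?_, hk⟩
  by_contra hlt
  push Not at hlt
  have := hmin _ hlt
  omega

theorem exists_Ioo (hx : IsPartition x K) {t : ℝ} (ht : t ∉ range x) :
    ∃ k : ℤ, t ∈ Ioo (x (k - 1)) (x k) := by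
  obtain ⟨k, h1, h2⟩ := hx.exists_index t
  exact ⟨k, lt_of_le_of_ne h1 fun h => ht ⟨_, h⟩, h2⟩

theorem intervalIntegrable (hx : IsPartition x K) {H : ℝ → ℝ} (hp : Function.Periodic H 1)
    (hi : ∀ k, IntervalIntegrable H volume (x (k - 1)) (x k)) (a b : ℝ) :
    IntervalIntegrable H volume a b := by
  have h1 : IntervalIntegrable H volume (x ((0 : ℕ) : ℤ)) (x (K : ℤ)) :=
    IntervalIntegrable.trans_iterate (a := fun n : ℕ => x n) (n := K) fun i _ => by
      have := hi ((i : ℤ) + 1)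
      simpa using this
  have h2 : x (K : ℤ) = x ((0 : ℕ) : ℤ) + 1 := by
    have := hx.add 0
    simpa using this
  rw [h2] at h1
  exact hp.intervalIntegrable one_ne_zero h1 a b

theorem integral_eq_sum (hx : IsPartition x K) {H : ℝ → ℝ} (hp : Function.Periodic H 1)
    (hi : ∀ k, IntervalIntegrable H volume (x (k - 1)) (x k)) :
    ∫ t in (0 : ℝ)..1, H t = ∑ k ∈ Finset.Icc (1 : ℤ) K, ∫ t in x (k - 1)..x k, H t := by
  have h1 := intervalIntegral.sum_integral_adjacent_intervals (f := H) (μ := volume)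
    (a := fun n : ℕ => x n) (n := K) fun i _ => by
      have := hi ((i : ℤ) + 1)
      simpa using this
  have h2 : x (K : ℤ) = x ((0 : ℕ) : ℤ) + 1 := by
    have := hx.add 0
    simpa using this
  have h3 := hp.intervalIntegral_add_eq 0 (x ((0 : ℕ) : ℤ))
  rw [h2] at h1
  rw [zero_add] at h3
  rw [h3, ← h1, sum_Icc_eq_sum_range (fun k => ∫ t in x (k - 1)..x k, H t)]
  refine Finset.sum_congr rfl fun i _ => ?_
  simp

end IsPartition

theorem intervalIntegrable_of_eq_Ioo {H G : ℝ → ℝ} {a b : ℝ} (hab : a ≤ b)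
    (hG : IntervalIntegrable G volume a b) (h : ∀ t ∈ Ioo a b, H t = G t) :
    IntervalIntegrable H volume a b := by
  rw [intervalIntegrable_iff_integrableOn_Ioo_of_le hab] at *
  exact hG.congr_fun (fun t ht => (h t ht).symm) measurableSet_Ioo

theorem integral_congr_Ioo {H G : ℝ → ℝ} {a b : ℝ} (hab : a ≤ b)
    (h : ∀ t ∈ Ioo a b, H t = G t) : ∫ t in a..b, H t = ∫ t in a..b, G t := by
  rw [intervalIntegral.integral_of_le hab, intervalIntegral.integral_of_le hab,
    integral_Ioc_eq_integral_Ioo, integral_Ioc_eq_integral_Ioo]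
  exact setIntegral_congr_fun measurableSet_Ioo h

theorem integral_eq_const {H : ℝ → ℝ} {a b c : ℝ} (hab : a ≤ b)
    (h : ∀ t ∈ Ioo a b, H t = c) : ∫ t in a..b, H t = (b - a) * c := by
  rw [integral_congr_Ioo hab h, intervalIntegral.integral_const, smul_eq_mul]

/-! ### Piecewise linear functions -/

section PiecewiseLinear

variable {x : ℤ → ℝ} {K : ℕ} {g : ℝ → ℝ}

theorem IsP1.eq_on (hg : IsP1 x g) (hx : IsPartition x K) {k : ℤ} {t : ℝ}
    (ht : t ∈ Icc (x (k - 1)) (x k)) : g t = g (x k) + elemGrad x g k * (t - x k) := by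
  obtain ⟨a, b, h⟩ := hg.2 k
  have h0 := hx.lt_node k
  have h1 := h (x k) ⟨h0.le, le_rfl⟩
  have h2 := h (x (k - 1)) ⟨le_rfl, h0.le⟩
  have h3 : x k - x (k - 1) ≠ 0 := by linarith
  have : elemGrad x g k = a := by
    unfold elemGrad; rw [h1, h2]; field_simp; ring
  rw [this, h t ht, h1]; ring

theorem IsP1.eq_on' (hg : IsP1 x g) (hx : IsPartition x K) {k : ℤ} {t s : ℝ}
    (ht : t ∈ Icc (x (k - 1)) (x k)) (hs : s ∈ Icc (x (k - 1)) (x k)) :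
    g t - g s = elemGrad x g k * (t - s) := by
  rw [hg.eq_on hx ht, hg.eq_on hx hs]; ring

theorem elemGrad_mul (hx : IsPartition x K) (g : ℝ → ℝ) (k : ℤ) :
    elemGrad x g k * (x k - x (k - 1)) = g (x k) - g (x (k - 1)) := by
  have h0 := hx.lt_node k
  have h3 : x k - x (k - 1) ≠ 0 := by linarith
  unfold elemGrad; field_simp

theorem IsP1.hasDerivAt (hg : IsP1 x g) (hx : IsPartition x K) {k : ℤ} {t : ℝ}
    (ht : t ∈ Ioo (x (k - 1)) (x k)) : HasDerivAt g (elemGrad x g k) t := by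
  have h1 : HasDerivAt (fun t => g (x k) + elemGrad x g k * (t - x k)) (elemGrad x g k) t := by
    have := (((hasDerivAt_id t).sub_const (x k)).const_mul (elemGrad x g k)).const_add (g (x k))
    simpa using this
  refine h1.congr_of_eventuallyEq ?_
  filter_upwards [Ioo_mem_nhds ht.1 ht.2] with s hs
  exact hg.eq_on hx (Ioo_subset_Icc_self hs)

theorem IsP1.deriv_eq (hg : IsP1 x g) (hx : IsPartition x K) {k : ℤ} {t : ℝ}
    (ht : t ∈ Ioo (x (k - 1)) (x k)) : deriv g t = elemGrad x g k := (hg.hasDerivAt hx ht).deriv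

theorem deriv_periodic {F : ℝ} (h : ∀ t, g (t + 1) = g t + F) :
    Function.Periodic (deriv g) 1 := by
  intro t
  have h1 : (fun s => g (s + 1)) = fun s => g s + F := funext h
  rw [← deriv_comp_add_const, h1, deriv_add_const]

theorem IsP1.deriv_intervalIntegrable (hg : IsP1 x g) (hx : IsPartition x K) {F : ℝ}
    (h : ∀ t, g (t + 1) = g t + F) (a b : ℝ) : IntervalIntegrable (deriv g) volume a b :=
  hx.intervalIntegrable (deriv_periodic h) (fun k =>
    intervalIntegrable_of_eq_Ioo (hx.lt_node k).le (intervalIntegrable_const (c := elemGrad x g k))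
      fun _ ht => hg.deriv_eq hx ht) a b

theorem IsP1.integral_deriv (hg : IsP1 x g) (hx : IsPartition x K) {F : ℝ}
    (h : ∀ t, g (t + 1) = g t + F) (a b : ℝ) : ∫ t in a..b, deriv g t = g b - g a := by
  refine MeasureTheory.integral_eq_of_hasDerivAt_off_countable g (deriv g)
    (countable_range x) hg.1.continuousOn (fun t ht => ?_) (hg.deriv_intervalIntegrable hx h a b)
  obtain ⟨k, hk⟩ := hx.exists_Ioo ht.2
  rw [hg.deriv_eq hx hk]
  exact hg.hasDerivAt hx hk

theorem elemGrad_add_period (hx : IsPartition x K) {F : ℝ} (h : ∀ t, g (t + 1) = g t + F) (k : ℤ) :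
    elemGrad x g (k + K) = elemGrad x g k := by
  unfold elemGrad
  rw [show k + (K : ℤ) - 1 = k - 1 + K by ring, hx.add, hx.add, h, h]
  congr 1 <;> ring

theorem IsP1.const_add (hg : IsP1 x g) (c : ℝ) : IsP1 x (fun t => g t + c) :=
  ⟨hg.1.add continuous_const, fun k => by
    obtain ⟨a, b, h⟩ := hg.2 k
    exact ⟨a, b + c, fun t ht => by simp only [h t ht]; ring⟩⟩

theorem IsP1.add (hg : IsP1 x g) {w : ℝ → ℝ} (hw : IsP1 x w) : IsP1 x (fun t => g t + w t) :=
  ⟨hg.1.add hw.1, fun k => by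
    obtain ⟨a, b, h⟩ := hg.2 k
    obtain ⟨a', b', h'⟩ := hw.2 k
    exact ⟨a + a', b + b', fun t ht => by simp only [h t ht, h' t ht]; ring⟩⟩

theorem IsP1.const_mul (hg : IsP1 x g) (c : ℝ) : IsP1 x (fun t => c * g t) :=
  ⟨hg.1.const_mul c, fun k => by
    obtain ⟨a, b, h⟩ := hg.2 k
    exact ⟨c * a, c * b, fun t ht => by simp only [h t ht]; ring⟩⟩

theorem isP1_linear (x : ℤ → ℝ) (F : ℝ) : IsP1 x (fun t => F * t) :=
  ⟨by fun_prop, fun _ => ⟨F, 0, fun t _ => by ring⟩⟩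

/-- A periodic piecewise linear function varies by at most the total variation over a period. -/
theorem IsP1.abs_sub_le (hg : IsP1 x g) (hx : IsPartition x K) (h : ∀ t, g (t + 1) = g t)
    (s t : ℝ) : |g s - g t| ≤ ∫ r in (0 : ℝ)..1, |deriv g r| := by
  have h' : ∀ t, g (t + 1) = g t + 0 := by simpa using h
  have hper : Function.Periodic g 1 := h
  have key : ∀ s t : ℝ, s ∈ Icc (0 : ℝ) 1 → t ∈ Icc (0 : ℝ) 1 → s ≤ t →
      |g t - g s| ≤ ∫ r in (0 : ℝ)..1, |deriv g r| := by
    intro s t hs ht hst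
    rw [← hg.integral_deriv hx h']
    refine (intervalIntegral.abs_integral_le_integral_abs hst).trans ?_
    exact intervalIntegral.integral_mono_interval hs.1 hst ht.2
      (Filter.Eventually.of_forall fun _ => abs_nonneg _)
      (hg.deriv_intervalIntegrable hx h' 0 1).abs
  have hf : ∀ t, g t = g (Int.fract t) := by
    intro t
    have := hper.sub_zsmul_eq ⌊t⌋ (x := t)
    rw [← this]; congr 1; rw [Int.fract]; simp
  have hm : ∀ t : ℝ, Int.fract t ∈ Icc (0 : ℝ) 1 := fun t =>
    ⟨Int.fract_nonneg t, (Int.fract_lt_one t).le⟩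
  rw [hf s, hf t]
  rcases le_total (Int.fract s) (Int.fract t) with hst | hst
  · rw [abs_sub_comm]; exact key _ _ (hm s) (hm t) hst
  · exact key _ _ (hm t) (hm s) hst

theorem IsP1.integral_deriv_sq (hg : IsP1 x g) (hx : IsPartition x K) {F : ℝ}
    (h : ∀ t, g (t + 1) = g t + F) :
    ∫ t in (0 : ℝ)..1, deriv g t ^ 2 =
      ∑ k ∈ Finset.Icc (1 : ℤ) K, (x k - x (k - 1)) * elemGrad x g k ^ 2 := by
  have hp := deriv_periodic h
  rw [hx.integral_eq_sum (H := fun t => deriv g t ^ 2) (fun t => by simp only [hp t]) fun k =>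
    intervalIntegrable_of_eq_Ioo (hx.lt_node k).le (intervalIntegrable_const (c := elemGrad x g k ^ 2))
      fun t ht => by rw [hg.deriv_eq hx ht]]
  refine Finset.sum_congr rfl fun k _ => ?_
  exact integral_eq_const (hx.lt_node k).le fun t ht => by rw [hg.deriv_eq hx ht]

theorem IsP1.integral_abs_deriv (hg : IsP1 x g) (hx : IsPartition x K) {F : ℝ}
    (h : ∀ t, g (t + 1) = g t + F) :
    ∫ t in (0 : ℝ)..1, |deriv g t| =
      ∑ k ∈ Finset.Icc (1 : ℤ) K, (x k - x (k - 1)) * |elemGrad x g k| := by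
  have hp := deriv_periodic h
  rw [hx.integral_eq_sum (H := fun t => |deriv g t|) (fun t => by simp only [hp t]) fun k =>
    intervalIntegrable_of_eq_Ioo (hx.lt_node k).le (intervalIntegrable_const (c := |elemGrad x g k|))
      fun t ht => by rw [hg.deriv_eq hx ht]]
  refine Finset.sum_congr rfl fun k _ => ?_
  exact integral_eq_const (hx.lt_node k).le fun t ht => by rw [hg.deriv_eq hx ht]

theorem IsPartition.sum_length (hx : IsPartition x K) :
    ∑ k ∈ Finset.Icc (1 : ℤ) K, (x k - x (k - 1)) = 1 := by
  have := hx.integral_eq_sum (H := fun _ => (1 : ℝ)) (fun _ => rfl)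
    fun k => intervalIntegrable_const
  simpa using this.symm

/-- Cauchy–Schwarz on a period of length one: with S the total variation, expanding the nonnegative
sum of |T_k|(|g'_k| - S)² gives S² ≤ ∑ |T_k| g'_k². The oscillation is at most S. -/
theorem IsP1.osc_sq_le (hg : IsP1 x g) (hx : IsPartition x K) (h : ∀ t, g (t + 1) = g t)
    (s t : ℝ) : (g s - g t) ^ 2 ≤
      ∑ k ∈ Finset.Icc (1 : ℤ) K, (x k - x (k - 1)) * elemGrad x g k ^ 2 := by
  have h' : ∀ t, g (t + 1) = g t + 0 := by simpa using h
  have h1 := hg.abs_sub_le hx h s t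
  rw [hg.integral_abs_deriv hx h'] at h1
  set S := ∑ k ∈ Finset.Icc (1 : ℤ) K, (x k - x (k - 1)) * |elemGrad x g k|
  set Q := ∑ k ∈ Finset.Icc (1 : ℤ) K, (x k - x (k - 1)) * elemGrad x g k ^ 2 with hQ
  have h2 : 0 ≤ ∑ k ∈ Finset.Icc (1 : ℤ) K, (x k - x (k - 1)) * (|elemGrad x g k| - S) ^ 2 :=
    Finset.sum_nonneg fun k _ => mul_nonneg (by have := hx.lt_node k; linarith) (sq_nonneg _)
  have h3 : ∑ k ∈ Finset.Icc (1 : ℤ) K, (x k - x (k - 1)) * (|elemGrad x g k| - S) ^ 2 =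
      Q - 2 * S * S + S ^ 2 * ∑ k ∈ Finset.Icc (1 : ℤ) K, (x k - x (k - 1)) := by
    calc _ = ∑ k ∈ Finset.Icc (1 : ℤ) K, ((x k - x (k - 1)) * elemGrad x g k ^ 2 -
          2 * S * ((x k - x (k - 1)) * |elemGrad x g k|) + S ^ 2 * (x k - x (k - 1))) :=
        Finset.sum_congr rfl fun k _ => by rw [← sq_abs (elemGrad x g k)]; ring
      _ = _ := by
        rw [Finset.sum_add_distrib, Finset.sum_sub_distrib, ← Finset.mul_sum, ← Finset.mul_sum]
  rw [hx.sum_length] at h3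
  have h4 : (g s - g t) ^ 2 ≤ S ^ 2 := by
    rw [← sq_abs]; gcongr
  nlinarith

end PiecewiseLinear

/-! ### The lattice -/

theorem spacing_pos {N : ℕ} (hN : 0 < N) : 0 < spacing N := by
  unfold spacing; positivity

theorem latt_add (N : ℕ) (l j : ℤ) : latt N (l + j) = latt N l + j * spacing N := by
  unfold latt spacing; push_cast; ring

theorem latt_add_one (N : ℕ) (l : ℤ) : latt N (l + 1) = latt N l + spacing N := by
  rw [latt_add]; simp

theorem latt_add_two (N : ℕ) (l : ℤ) : latt N (l + 2) = latt N l + 2 * spacing N := by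
  rw [latt_add]; norm_num

theorem latt_sub_one (N : ℕ) (l : ℤ) : latt N (l - 1) = latt N l - spacing N := by
  rw [sub_eq_add_neg, latt_add]; push_cast; ring

theorem latt_lt_latt {N : ℕ} (hN : 0 < N) {i j : ℤ} : latt N i < latt N j ↔ i < j :=
  (latt_isPartition hN).mono.lt_iff_lt

theorem latt_le_latt {N : ℕ} (hN : 0 < N) {i j : ℤ} : latt N i ≤ latt N j ↔ i ≤ j :=
  (latt_isPartition hN).mono.le_iff_le

theorem latt_floor_le {N : ℕ} (hN : 0 < N) (t : ℝ) : latt N ⌊N * t⌋ ≤ t := by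
  have h0 : (0 : ℝ) < N := by exact_mod_cast hN
  unfold latt; rw [div_le_iff₀ h0]; linarith [Int.floor_le (N * t)]

theorem lt_latt_floor {N : ℕ} (hN : 0 < N) (t : ℝ) : t < latt N (⌊N * t⌋ + 1) := by
  have h0 : (0 : ℝ) < N := by exact_mod_cast hN
  unfold latt; rw [lt_div_iff₀ h0]; push_cast; linarith [Int.lt_floor_add_one (N * t)]

theorem floor_eq_of_mem {N : ℕ} (hN : 0 < N) {t : ℝ} {c : ℤ} (h1 : latt N c ≤ t)
    (h2 : t < latt N (c + 1)) : ⌊N * t⌋ = c := by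
  have h3 := latt_floor_le hN t
  have h4 := lt_latt_floor hN t
  have h5 := (latt_lt_latt hN).1 (h1.trans_lt h4)
  have h6 := (latt_lt_latt hN).1 (h3.trans_lt h2)
  omega

namespace Mesh

variable {N : ℕ} (m : Mesh N)

theorem latt_site_le (hN : 0 < N) (k : ℤ) : latt N (m.site k) ≤ m.x k := latt_floor_le hN _

theorem lt_latt_site (hN : 0 < N) (k : ℤ) : m.x k < latt N (m.site k + 1) := lt_latt_floor hN _

theorem node_eq (hN : 0 < N) (k : ℤ) : m.x k = latt N (m.site k) + m.theta k * spacing N := by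
  have h0 : (0 : ℝ) < N := by exact_mod_cast hN
  unfold latt site theta spacing
  rw [Int.fract]; field_simp; ring

theorem theta_nonneg (k : ℤ) : 0 ≤ m.theta k := Int.fract_nonneg _

theorem theta_lt_one (k : ℤ) : m.theta k < 1 := Int.fract_lt_one _

theorem latt_site_lt (hN : 0 < N) {k : ℤ} (h : m.theta k ≠ 0) : latt N (m.site k) < m.x k := by
  rw [m.node_eq hN]
  have := (m.theta_nonneg k).lt_of_ne' h
  have := mul_pos this (spacing_pos hN)
  linarith

/-! ### Geometry of the decomposition -/

theorem isClosed_compl : IsClosed m.Oaᶜ := m.isOpen_Oa.isClosed_compl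

theorem mem_frontier {t : ℝ} : t ∈ frontier m.Oaᶜ ↔ t ∉ m.Oa ∧ t ∉ interior m.Oaᶜ := by
  rw [m.isClosed_compl.frontier_eq]; rfl

theorem Ioo_subset_or {a b : ℝ} (h : ∀ t ∈ Ioo a b, t ∉ frontier m.Oaᶜ) :
    Ioo a b ⊆ m.Oa ∨ Ioo a b ⊆ interior m.Oaᶜ := by
  refine isPreconnected_Ioo.subset_or_subset m.isOpen_Oa isOpen_interior ?_ ?_
  · rw [Set.disjoint_left]
    exact fun t h1 h2 => interior_subset h2 h1
  · intro t ht
    by_contra hc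
    rw [mem_union, not_or] at hc
    exact h t ht (m.mem_frontier.2 hc)

theorem Icc_subset {a b : ℝ} (hab : a < b) (h : Ioo a b ⊆ m.Oaᶜ) : Icc a b ⊆ m.Oaᶜ := by
  rw [← closure_Ioo hab.ne]
  exact m.isClosed_compl.closure_subset_iff.2 h

theorem lt_node (k : ℤ) : m.x (k - 1) < m.x k := m.isPartition.lt_node k

theorem lt_node_add (k : ℤ) : m.x k < m.x (k + 1) := m.strictMono (by omega)

theorem node_notMem_Ioo (j k : ℤ) : m.x j ∉ Ioo (m.x (k - 1)) (m.x k) := by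
  rintro ⟨h1, h2⟩
  have := m.strictMono.lt_iff_lt.1 h1
  have := m.strictMono.lt_iff_lt.1 h2
  omega

/-- Interfaces are nodes and an open element contains no node, so connectedness puts the element
entirely on one side. -/
theorem isCont_or (k : ℤ) : m.IsCont k ∨ Ioo (m.x (k - 1)) (m.x k) ⊆ m.Oa := by
  rcases m.Ioo_subset_or (a := m.x (k - 1)) (b := m.x k) (fun t ht hf => by
    obtain ⟨j, rfl⟩ := m.interface_node hf
    exact m.node_notMem_Ioo j k ht) with h | h
  · exact Or.inr h
  · exact Or.inl (m.Icc_subset (m.lt_node k) (h.trans interior_subset))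

theorem Ioo_subset_of_not_isCont {k : ℤ} (h : ¬ m.IsCont k) :
    Ioo (m.x (k - 1)) (m.x k) ⊆ m.Oa := (m.isCont_or k).resolve_left h

/-- A node of the continuum region. -/
def IsContNode (k : ℤ) : Prop := m.IsCont k ∨ m.IsCont (k + 1)

theorem node_mem_of_isCont {k : ℤ} (h : m.IsCont k) : m.x k ∉ m.Oa :=
  h ⟨(m.lt_node k).le, le_rfl⟩

theorem node_mem_of_isCont_succ {k : ℤ} (h : m.IsCont (k + 1)) : m.x k ∉ m.Oa :=
  h (by rw [add_sub_cancel_right]; exact ⟨le_rfl, (m.lt_node_add k).le⟩)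

theorem left_mem_frontier {k : ℤ} (h : m.IsCont k) (h' : ¬ m.IsCont (k + 1)) :
    m.x k ∈ frontier m.Oaᶜ := by
  rw [m.mem_frontier]
  refine ⟨m.node_mem_of_isCont h, fun hi => ?_⟩
  have h1 := m.Ioo_subset_of_not_isCont h'
  rw [add_sub_cancel_right] at h1
  have h2 : m.x k ∈ closure (Ioo (m.x k) (m.x (k + 1))) := by
    rw [closure_Ioo (m.lt_node_add k).ne]; exact ⟨le_rfl, (m.lt_node_add k).le⟩
  obtain ⟨t, ht, ht'⟩ := mem_closure_iff.1 h2 _ isOpen_interior hi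
  exact interior_subset ht (h1 ht')

theorem right_mem_frontier {k : ℤ} (h : ¬ m.IsCont k) (h' : m.IsCont (k + 1)) :
    m.x k ∈ frontier m.Oaᶜ := by
  rw [m.mem_frontier]
  refine ⟨m.node_mem_of_isCont_succ h', fun hi => ?_⟩
  have h1 := m.Ioo_subset_of_not_isCont h
  have h2 : m.x k ∈ closure (Ioo (m.x (k - 1)) (m.x k)) := by
    rw [closure_Ioo (m.lt_node k).ne]; exact ⟨(m.lt_node k).le, le_rfl⟩
  obtain ⟨t, ht, ht'⟩ := mem_closure_iff.1 h2 _ isOpen_interior hi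
  exact interior_subset ht (h1 ht')

/-- Two such nodes in one bond are less than 2ε apart. A continuum element between them would be too
long; without one, the left node ends a continuum element and the right node starts one, so both are
interfaces, which the bond condition forbids. -/
theorem contNode_unique {i j k : ℤ} (hj : m.IsContNode j) (hk : m.IsContNode k)
    (hj' : m.x j ∈ Ioo (latt N i) (latt N (i + 2)))
    (hk' : m.x k ∈ Ioo (latt N i) (latt N (i + 2))) : j = k := by
  wlog hjk : j < k generalizing j k
  · rcases lt_trichotomy j k with h | h | h
    · exact absurd h hjk
    · exact h
    · exact (this hk hj hk' hj' h).symm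
  exfalso
  have h2 := latt_add_two N i
  have hlen : m.x k - m.x j < 2 * spacing N := by linarith [hj'.1, hk'.2]
  by_cases h1 : m.IsCont (j + 1)
  · have := m.continuum_size _ h1
    rw [add_sub_cancel_right] at this
    have h3 : m.x (j + 1) ≤ m.x k := m.strictMono.monotone (by omega)
    linarith
  by_cases h3 : m.IsCont k
  · have := m.continuum_size _ h3
    have h3 : m.x j ≤ m.x (k - 1) := m.strictMono.monotone (by omega)
    linarith
  have h4 := m.left_mem_frontier (hj.resolve_right h1) h1
  have h5 := m.right_mem_frontier h3 (hk.resolve_left h3)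
  have := m.bond_interface i ⟨h4, hj'⟩ ⟨h5, hk'⟩
  exact hjk.ne (m.strictMono.injective this)

/-- An interface is a node of the continuum region. -/
theorem exists_contNode_of_frontier {t : ℝ} (ht : t ∈ frontier m.Oaᶜ) :
    ∃ k, m.x k = t ∧ m.IsContNode k := by
  obtain ⟨k, rfl⟩ := m.interface_node ht
  refine ⟨k, rfl, ?_⟩
  by_contra hc
  unfold IsContNode at hc
  rw [not_or] at hc
  have h1 := m.Ioo_subset_of_not_isCont hc.1
  have h2 := m.Ioo_subset_of_not_isCont hc.2
  rw [add_sub_cancel_right] at h2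
  -- Regularity of Ω_c rules out an isolated point of Ω_c between two atomistic elements.
  have h3 : m.x k ∈ closure (interior m.Oaᶜ) := by
    rw [m.regular_Oc]; exact (m.mem_frontier.1 ht).1
  obtain ⟨s, hs, hs'⟩ := mem_closure_iff.1 h3 (Ioo (m.x (k - 1)) (m.x (k + 1))) isOpen_Ioo
    ⟨m.lt_node k, m.lt_node_add k⟩
  have hs'' := interior_subset hs'
  rcases lt_trichotomy s (m.x k) with h | h | h
  · exact hs'' (h1 ⟨hs.1, h⟩)
  · rw [h] at hs'
    exact (m.mem_frontier.1 ht).2 hs'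
  · exact hs'' (h2 ⟨h, hs.2⟩)

/-- An open interval without nodes of the continuum region lies in the atomistic region or in a
single continuum element. -/
theorem subset_or_of_no_contNode {a b : ℝ} (hab : a < b)
    (h : ∀ k, m.IsContNode k → m.x k ∉ Ioo a b) :
    Ioo a b ⊆ m.Oa ∨ (Ioo a b ⊆ m.Oaᶜ ∧
      ∃ k, m.IsCont k ∧ Icc a b ⊆ Icc (m.x (k - 1)) (m.x k)) := by
  rcases m.Ioo_subset_or (a := a) (b := b) (fun t ht hf => by
    obtain ⟨k, rfl, hk⟩ := m.exists_contNode_of_frontier hf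
    exact h k hk ht) with h1 | h1
  · exact Or.inl h1
  refine Or.inr ⟨h1.trans interior_subset, ?_⟩
  obtain ⟨k, hk1, hk2⟩ := m.isPartition.exists_index a
  have hcont : m.IsCont k := by
    by_contra hc
    have h2 := m.Ioo_subset_of_not_isCont hc
    obtain ⟨t, ht1, ht2⟩ := exists_between (lt_min hab hk2)
    exact interior_subset (h1 ⟨ht1, ht2.trans_le (min_le_left _ _)⟩)
      (h2 ⟨hk1.trans_lt ht1, ht2.trans_le (min_le_right _ _)⟩)
  refine ⟨k, hcont, Icc_subset_Icc hk1 ?_⟩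
  by_contra hc
  push Not at hc
  exact h k (Or.inl hcont) ⟨hk2, hc⟩

/-- A site inside Ω_a is a node by assumption; a site of the closed interval outside Ω_a lies on the
interface and is a node for that reason. -/
theorem node_of_mem_closure {a b : ℝ} (h : Ioo a b ⊆ m.Oa) {l : ℤ}
    (hab : a < b) (hl : latt N l ∈ Icc a b) : ∃ k, m.x k = latt N l := by
  by_cases h1 : latt N l ∈ m.Oa
  · exact m.node_of_atom l h1
  have h2 : latt N l ∈ frontier m.Oaᶜ := by
    rw [m.mem_frontier]
    refine ⟨h1, fun hi => ?_⟩
    rw [← closure_Ioo hab.ne] at hl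
    obtain ⟨t, ht, ht'⟩ := mem_closure_iff.1 hl _ isOpen_interior hi
    exact interior_subset ht (h ht')
  exact m.interface_node h2

/-- The bond already contains the interface x_k, so it has no room for a second one and the region
cannot change again to the right of x_k. -/
theorem atom_Ioo_right (hN : 0 < N) {k : ℤ} (h : m.IsCont k) (h' : ¬ m.IsCont (k + 1)) {i j : ℤ}
    (hij : j ≤ i + 2) (hx : m.x k ∈ Ioo (latt N i) (latt N j)) :
    Ioo (m.x k) (latt N j) ⊆ m.Oa := by
  have hf := m.left_mem_frontier h h'
  have h2 := (latt_le_latt hN).2 hij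
  rcases m.Ioo_subset_or (a := m.x k) (b := latt N j) (fun t ht hft => by
    have := m.bond_interface i ⟨hf, hx.1, hx.2.trans_le h2⟩
      ⟨hft, hx.1.trans ht.1, ht.2.trans_le h2⟩
    exact ht.1.ne this) with h1 | h1
  · exact h1
  · exfalso
    have h3 := m.Ioo_subset_of_not_isCont h'
    rw [add_sub_cancel_right] at h3
    obtain ⟨t, ht1, ht2⟩ := exists_between (lt_min hx.2 (m.lt_node_add k))
    exact interior_subset (h1 ⟨ht1, ht2.trans_le (min_le_left _ _)⟩)
      (h3 ⟨ht1, ht2.trans_le (min_le_right _ _)⟩)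

theorem atom_Ioo_left (hN : 0 < N) {k : ℤ} (h : ¬ m.IsCont k) (h' : m.IsCont (k + 1)) {i j : ℤ}
    (hij : j ≤ i + 2) (hx : m.x k ∈ Ioo (latt N i) (latt N j)) :
    Ioo (latt N i) (m.x k) ⊆ m.Oa := by
  have hf := m.right_mem_frontier h h'
  have h2 := (latt_le_latt hN).2 hij
  rcases m.Ioo_subset_or (a := latt N i) (b := m.x k) (fun t ht hft => by
    have := m.bond_interface i ⟨hf, hx.1, hx.2.trans_le h2⟩
      ⟨hft, ht.1, (ht.2.trans hx.2).trans_le h2⟩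
    exact ht.2.ne this.symm) with h1 | h1
  · exact h1
  · exfalso
    have h3 := m.Ioo_subset_of_not_isCont h
    obtain ⟨t, ht1, ht2⟩ := exists_between (max_lt hx.1 (m.lt_node k))
    exact interior_subset (h1 ⟨(le_max_left _ _).trans_lt ht1, ht2⟩)
      (h3 ⟨(le_max_right _ _).trans_lt ht1, ht2⟩)

/-- If the atomistic region contains `(x_k, (l + 1) ε)` without further sites, the next node is
`(l + 1) ε`. -/
theorem next_node (hN : 0 < N) {k l : ℤ} (h : Ioo (m.x k) (latt N (l + 1)) ⊆ m.Oa)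
    (h1 : latt N l ≤ m.x k) (h2 : m.x k < latt N (l + 1)) : m.x (k + 1) = latt N (l + 1) := by
  obtain ⟨j, hj⟩ := m.node_of_mem_closure h h2 (l := l + 1) ⟨h2.le, le_rfl⟩
  have h3 : k < j := by rw [← m.strictMono.lt_iff_lt, hj]; exact h2
  have h4 : m.x (k + 1) ≤ latt N (l + 1) := hj ▸ m.strictMono.monotone (by omega)
  refine h4.antisymm (not_lt.1 fun h5 => ?_)
  obtain ⟨i, hi⟩ := m.atom_of_node (k + 1) (h ⟨m.lt_node_add k, h5⟩)
  have h6 := m.lt_node_add k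
  rw [hi] at h5 h6
  have := (latt_lt_latt hN).1 h5
  have := (latt_lt_latt hN).1 (h1.trans_lt h6)
  omega

theorem prev_node (hN : 0 < N) {k l : ℤ} (h : Ioo (latt N l) (m.x k) ⊆ m.Oa)
    (h1 : latt N l < m.x k) (h2 : m.x k ≤ latt N (l + 1)) : m.x (k - 1) = latt N l := by
  obtain ⟨j, hj⟩ := m.node_of_mem_closure h h1 (l := l) ⟨le_rfl, h1.le⟩
  have h3 : j < k := by rw [← m.strictMono.lt_iff_lt, hj]; exact h1
  have h4 : latt N l ≤ m.x (k - 1) := hj ▸ m.strictMono.monotone (by omega)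
  refine (not_lt.1 fun h5 => ?_ : m.x (k - 1) ≤ latt N l).antisymm h4
  obtain ⟨i, hi⟩ := m.atom_of_node (k - 1) (h ⟨h5, m.lt_node k⟩)
  have h6 := m.lt_node k
  rw [hi] at h5 h6
  have := (latt_lt_latt hN).1 h5
  have := (latt_lt_latt hN).1 (h6.trans_le h2)
  omega

theorem left_next (hN : 0 < N) {k : ℤ} (h : m.IsCont k) (h' : ¬ m.IsCont (k + 1)) :
    m.x (k + 1) = latt N (m.site k + 1) := by
  refine m.next_node hN ?_ (m.latt_site_le hN k) (m.lt_latt_site hN k)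
  -- The bond starts one site to the left so that x_k is an interior point of it even when x_k is
  -- itself a lattice site.
  refine m.atom_Ioo_right hN h h' (i := m.site k - 1) (by omega) ⟨?_, m.lt_latt_site hN k⟩
  exact ((latt_lt_latt hN).2 (by omega)).trans_le (m.latt_site_le hN k)

/-- For θ_k = 0 the node is an endpoint of the bond (ℓ_k ε, (ℓ_k + 2)ε), so the bond condition would
not prevent another interface inside it. -/
theorem left_next_two (hN : 0 < N) {k : ℤ} (h : m.IsCont k) (h' : ¬ m.IsCont (k + 1))
    (hθ : m.theta k ≠ 0) : m.x (k + 2) = latt N (m.site k + 2) := by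
  have h1 := m.left_next hN h h'
  have h2 : Ioo (m.x k) (latt N (m.site k + 2)) ⊆ m.Oa :=
    m.atom_Ioo_right hN h h' (i := m.site k) le_rfl ⟨m.latt_site_lt hN hθ,
      (m.lt_latt_site hN k).trans ((latt_lt_latt hN).2 (by omega))⟩
  have := m.next_node hN (k := k + 1) (l := m.site k + 1)
    ((Ioo_subset_Ioo_left (m.lt_node_add k).le).trans (by rwa [add_assoc])) h1.ge
    (by rw [h1, latt_lt_latt hN]; omega)
  rwa [add_assoc, add_assoc] at this

theorem right_prev (hN : 0 < N) {k : ℤ} (h : ¬ m.IsCont k) (h' : m.IsCont (k + 1))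
    (hθ : m.theta k ≠ 0) : m.x (k - 1) = latt N (m.site k) :=
  m.prev_node hN (m.atom_Ioo_left hN h h' (j := m.site k + 1) (by omega)
    ⟨m.latt_site_lt hN hθ, m.lt_latt_site hN k⟩) (m.latt_site_lt hN hθ) (m.lt_latt_site hN k).le

/-- An element of the atomistic region is contained in a lattice cell. -/
theorem le_latt_of_not_isCont (hN : 0 < N) {k : ℤ} (h : ¬ m.IsCont k) :
    m.x k ≤ latt N (m.site (k - 1) + 1) := by
  by_contra hc
  push Not at hc
  have h1 : latt N (m.site (k - 1) + 1) ∈ Ioo (m.x (k - 1)) (m.x k) :=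
    ⟨m.lt_latt_site hN (k - 1), hc⟩
  obtain ⟨j, hj⟩ := m.node_of_atom _ (m.Ioo_subset_of_not_isCont h h1)
  rw [← hj] at h1
  exact m.node_notMem_Ioo j k h1

/-! ### Periodicity -/

theorem isCont_add (k : ℤ) : m.IsCont (k + m.K) ↔ m.IsCont k := by
  unfold IsCont
  rw [show k + (m.K : ℤ) - 1 = k - 1 + m.K by ring, m.x_add_K, m.x_add_K]
  constructor
  · intro h t ht
    have := h (a := t + 1) ⟨by linarith [ht.1], by linarith [ht.2]⟩
    exact fun h' => this ((m.periodic_Oa t).2 h')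
  · intro h t ht
    have := h (a := t - 1) ⟨by linarith [ht.1], by linarith [ht.2]⟩
    refine fun h' => this ((m.periodic_Oa (t - 1)).1 (by simpa using h'))

theorem isContNode_add (k : ℤ) : m.IsContNode (k + m.K) ↔ m.IsContNode k := by
  unfold IsContNode
  rw [m.isCont_add, show k + (m.K : ℤ) + 1 = k + 1 + m.K by ring, m.isCont_add]

theorem site_add (k : ℤ) : m.site (k + m.K) = m.site k + N := by
  unfold site
  rw [m.x_add_K, mul_add, mul_one, ← Int.cast_natCast, Int.floor_add_intCast]

theorem theta_add (k : ℤ) : m.theta (k + m.K) = m.theta k := by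
  unfold theta
  rw [m.x_add_K, mul_add, mul_one, ← Int.cast_natCast, Int.fract_add_intCast]

theorem share_add (k : ℤ) : m.share (k + m.K) = m.share k := by
  unfold share
  rw [m.isCont_add, show k + (m.K : ℤ) + 1 = k + 1 + m.K by ring, m.isCont_add]

variable {phi y : ℝ → ℝ} {F : ℝ}

theorem jumpSq_add (hN : 0 < N) (hy : ∀ t, y (t + 1) = y t + F) (k : ℤ) :
    m.jumpSq phi y (k + m.K) = m.jumpSq phi y k := by
  have e1 : k + (m.K : ℤ) + 1 = k + 1 + m.K := by ring
  have e2 : k + (m.K : ℤ) + 2 = k + 2 + m.K := by ring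
  have g := elemGrad_add_period m.isPartition hy
  have g' := elemGrad_add_period (latt_isPartition hN) hy
  have h1 : m.jumpInner phi y (k + m.K) = m.jumpInner phi y k := by
    simp only [jumpInner, e1, m.theta_add, g]
  have h2 : m.jumpLeft phi y (k + m.K) = m.jumpLeft phi y k := by
    simp only [jumpLeft, e1, e2, m.theta_add, g]
  have h3 : m.jumpRight phi y (k + m.K) = m.jumpRight phi y k := by
    simp only [jumpRight, e1, m.theta_add, m.site_add, g, g']
  have a1 := m.isCont_add k
  have a2 := m.isCont_add (k + 1)
  rw [← e1] at a2
  unfold jumpSq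
  rw [h1, h2, h3]
  by_cases ha : m.IsCont k <;> by_cases hb : m.IsCont (k + 1) <;>
    simp only [a1, a2, ha, hb, if_true, if_false]

theorem jumpSq_nonneg (k : ℤ) : 0 ≤ m.jumpSq phi y k := by
  unfold jumpSq
  split_ifs <;> first | exact Finset.sum_nonneg fun _ _ => sq_nonneg _ | exact le_rfl

-- The weights in `share` make every node count once: a node between two continuum elements is seen
-- from both sides with weight 1/2, an interface from one side with weight 1. Moving the left-hand
-- shares by one index uses periodicity.
open Classical in
theorem sum_etaStoreSq (hN : 0 < N) (hy : ∀ t, y (t + 1) = y t + F) :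
    ∑ k ∈ Finset.Icc (1 : ℤ) m.K, (if m.IsCont k then m.etaStoreSq phi y k else 0) =
      ∑ k ∈ Finset.Icc (1 : ℤ) m.K, spacing N * m.jumpSq phi y k := by
  have h1 := sum_Icc_shift (fun k => if m.IsCont (k + 1) then
    spacing N * m.share k * m.jumpSq phi y k else 0) m.K (fun k => by
      rw [show k + (m.K : ℤ) + 1 = k + 1 + m.K by ring]
      simp only [m.isCont_add, m.share_add, m.jumpSq_add hN hy]) (-1)
  have h2 : ∀ k, (if m.IsCont k then m.etaStoreSq phi y k else 0) =
      (if m.IsCont (k + -1 + 1) then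
        spacing N * m.share (k + -1) * m.jumpSq phi y (k + -1) else 0) +
      (if m.IsCont k then spacing N * m.share k * m.jumpSq phi y k else 0) := by
    intro k
    rw [neg_add_cancel_right]
    split_ifs with h
    · unfold etaStoreSq; rfl
    · simp
  simp only [h2]
  rw [Finset.sum_add_distrib, h1, ← Finset.sum_add_distrib]
  refine Finset.sum_congr rfl fun k _ => ?_
  by_cases ha : m.IsCont k <;> by_cases hb : m.IsCont (k + 1)
  · simp only [share, ha, hb, if_true, and_self]; ring
  · simp [share, ha, hb]
  · simp [share, ha, hb]
  · simp [jumpSq, ha, hb]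

end Mesh

/-! ### The potential -/

namespace IsPotential

variable {phi : ℝ → ℝ} {rstar : ℝ}

theorem contDiffOn_deriv (h : IsPotential phi rstar) : ContDiffOn ℝ 2 (deriv phi) (Ioi 0) :=
  h.smooth.deriv_of_isOpen isOpen_Ioi (by norm_num)

theorem contDiffOn_deriv_two (h : IsPotential phi rstar) :
    ContDiffOn ℝ 1 (iteratedDeriv 2 phi) (Ioi 0) := by
  have := h.contDiffOn_deriv.deriv_of_isOpen (m := 1) isOpen_Ioi (by norm_num)
  rw [iteratedDeriv_succ, iteratedDeriv_one]
  exact this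

theorem hasDerivAt (h : IsPotential phi rstar) {r : ℝ} (hr : 0 < r) :
    HasDerivAt phi (deriv phi r) r :=
  ((h.smooth.differentiableOn (by norm_num)).differentiableAt (Ioi_mem_nhds hr)).hasDerivAt

theorem hasDerivAt_deriv (h : IsPotential phi rstar) {r : ℝ} (hr : 0 < r) :
    HasDerivAt (deriv phi) (iteratedDeriv 2 phi r) r := by
  rw [iteratedDeriv_succ, iteratedDeriv_one]
  exact ((h.contDiffOn_deriv.differentiableOn (by norm_num)).differentiableAt
    (Ioi_mem_nhds hr)).hasDerivAt

theorem hasDerivAt_deriv_two (h : IsPotential phi rstar) {r : ℝ} (hr : 0 < r) :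
    HasDerivAt (iteratedDeriv 2 phi) (iteratedDeriv 3 phi r) r := by
  rw [iteratedDeriv_succ (n := 2)]
  exact ((h.contDiffOn_deriv_two.differentiableOn (by norm_num)).differentiableAt
    (Ioi_mem_nhds hr)).hasDerivAt

theorem deriv_two_nonpos (h : IsPotential phi rstar) {r : ℝ} (hr : rstar ≤ r) :
    iteratedDeriv 2 phi r ≤ 0 := by
  have key : ∀ s, rstar < s → iteratedDeriv 2 phi s ≤ 0 := by
    intro s hs
    have h1 : AntitoneOn (deriv phi) (Ioi rstar) := h.concave.antitoneOn_deriv fun t ht =>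
      (h.hasDerivAt (h.rstar_pos.trans ht)).differentiableAt
    have h2 := h1.derivWithin_nonpos (x := s)
    rwa [derivWithin_of_isOpen isOpen_Ioi hs, (h.hasDerivAt_deriv (h.rstar_pos.trans hs)).deriv]
      at h2
  rcases hr.lt_or_eq with hlt | rfl
  · exact key r hlt
  have hc := (h.hasDerivAt_deriv_two h.rstar_pos).continuousAt.continuousWithinAt (s := Ioi rstar)
  exact le_of_tendsto hc (by filter_upwards [self_mem_nhdsWithin] with s hs using key s hs)

variable {μ M : ℝ}

theorem deriv_two_lipschitz (h : IsPotential phi rstar) (hμ : 0 < μ)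
    (hM : ∀ r, μ ≤ r → |iteratedDeriv 3 phi r| ≤ M) {a b : ℝ} (ha : μ ≤ a) (hb : μ ≤ b) :
    |iteratedDeriv 2 phi b - iteratedDeriv 2 phi a| ≤ M * |b - a| :=
  (convex_Ici μ).norm_image_sub_le_of_norm_hasDerivWithin_le (f := iteratedDeriv 2 phi)
    (fun _ hr => (h.hasDerivAt_deriv_two (hμ.trans_le hr)).hasDerivWithinAt)
    (fun _ hr => hM _ hr) ha hb

/-- By the mean value theorem the increment of φ' is φ''(ξ)(b - a) with ξ between a and b; replacing
ξ by a costs at most Mσ because φ'' is M-Lipschitz on [μ, ∞). -/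
theorem deriv_sub_mul_ge (h : IsPotential phi rstar) (hμ : 0 < μ)
    (hM : ∀ r, μ ≤ r → |iteratedDeriv 3 phi r| ≤ M) {a b σ : ℝ} (ha : μ ≤ a) (hb : μ ≤ b)
    (hσ : |b - a| ≤ σ) :
    iteratedDeriv 2 phi a * (b - a) ^ 2 - M * σ * (b - a) ^ 2 ≤
      (deriv phi b - deriv phi a) * (b - a) := by
  have hM0 : 0 ≤ M := (abs_nonneg _).trans (hM μ le_rfl)
  have key : ∀ u v : ℝ, μ ≤ u → μ ≤ v → u < v → ∃ ξ, μ ≤ ξ ∧ |ξ - a| ≤ max |u - a| |v - a| ∧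
      deriv phi v - deriv phi u = iteratedDeriv 2 phi ξ * (v - u) := by
    intro u v hu hv huv
    obtain ⟨ξ, hξ, hd⟩ := exists_hasDerivAt_eq_slope (deriv phi) (iteratedDeriv 2 phi) huv
      (fun r hr => (h.hasDerivAt_deriv (hμ.trans_le (hu.trans hr.1))).continuousAt.continuousWithinAt)
      (fun r hr => h.hasDerivAt_deriv (hμ.trans_le (hu.trans hr.1.le)))
    refine ⟨ξ, hu.trans hξ.1.le, ?_, ?_⟩
    · exact abs_le_max_abs_abs (by linarith [hξ.1]) (by linarith [hξ.2])
    · rw [hd]; field_simp [(sub_pos.2 huv).ne']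
  have main : ∃ ξ, μ ≤ ξ ∧ |ξ - a| ≤ |b - a| ∧
      deriv phi b - deriv phi a = iteratedDeriv 2 phi ξ * (b - a) := by
    rcases lt_trichotomy a b with hab | hab | hab
    · obtain ⟨ξ, h1, h2, h3⟩ := key a b ha hb hab
      exact ⟨ξ, h1, by simpa using h2, h3⟩
    · exact ⟨a, ha, by simp, by simp [hab]⟩
    · obtain ⟨ξ, h1, h2, h3⟩ := key b a hb ha hab
      exact ⟨ξ, h1, by simpa using h2, by linarith⟩
  obtain ⟨ξ, h1, h2, h3⟩ := main
  have h4 := h.deriv_two_lipschitz hμ hM ha h1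
  have h5 : M * |ξ - a| ≤ M * σ := mul_le_mul_of_nonneg_left (h2.trans hσ) hM0
  have h6 := (abs_le.1 (h4.trans h5)).1
  rw [h3]
  nlinarith [sq_nonneg (b - a)]

/-- Stability of the atomistic model: monotonicity of the stress near a stable state. -/
theorem sum_stress_ge (h : IsPotential phi rstar) {τ A : ℝ} {n : ℕ} {z e : ℤ → ℝ}
    (hM : ∀ r, rstar / 4 ≤ r → |iteratedDeriv 3 phi r| ≤ M)
    (hzp : ∀ l, z (l + n) = z l) (hep : ∀ l, e (l + n) = e l)
    (hz : ∀ l, rstar / 2 ≤ z l) (he : ∀ l, |e l| ≤ τ) (hτ : τ ≤ rstar / 4)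
    (hA : ∀ l, A ≤ iteratedDeriv 2 phi (z l) + 2 * iteratedDeriv 2 phi (z (l - 1) + z l) +
      2 * iteratedDeriv 2 phi (z l + z (l + 1))) :
    (A - 9 * M * τ) * ∑ l ∈ Finset.Icc (1 : ℤ) n, e l ^ 2 ≤
      ∑ l ∈ Finset.Icc (1 : ℤ) n, ((deriv phi (z l + e l) - deriv phi (z l)) * e l +
        (deriv phi ((z l + e l) + (z (l - 1) + e (l - 1))) - deriv phi (z l + z (l - 1))) *
          (e l + e (l - 1))) := by
  have hr := h.rstar_pos
  have hM0 : 0 ≤ M := (abs_nonneg _).trans (hM (rstar / 4) le_rfl)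
  have hτ0 : 0 ≤ τ := (abs_nonneg _).trans (he 0)
  -- The bond joining cells l - 1 and l charges both squared gradients. The share of cell l - 1 is
  -- W(l - 1), which is moved to index l by periodicity. The error is 9Mτ = Mτ + 4Mτ + 4Mτ: one
  -- nearest-neighbour term and two second-neighbour shares.
  set W : ℤ → ℝ := fun l => (2 * iteratedDeriv 2 phi (z l + z (l + 1)) - 4 * M * τ) * e l ^ 2
    with hW
  have hWs : ∑ l ∈ Finset.Icc (1 : ℤ) n, W (l + -1) = ∑ l ∈ Finset.Icc (1 : ℤ) n, W l :=
    sum_Icc_shift W n (fun k => by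
      simp only [hW, show k + (n : ℤ) + 1 = k + 1 + n by ring, hzp, hep]) (-1)
  have h1 : ∀ l, (iteratedDeriv 2 phi (z l) + 2 * iteratedDeriv 2 phi (z (l - 1) + z l) -
      5 * M * τ) * e l ^ 2 + W (l + -1) ≤
      (deriv phi (z l + e l) - deriv phi (z l)) * e l +
        (deriv phi ((z l + e l) + (z (l - 1) + e (l - 1))) - deriv phi (z l + z (l - 1))) *
          (e l + e (l - 1)) := by
    intro l
    have e1 := abs_le.1 (he l)
    have e2 := abs_le.1 (he (l - 1))
    have z1 := hz l
    have z2 := hz (l - 1)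
    have b1 := h.deriv_sub_mul_ge (by linarith) hM (a := z l) (b := z l + e l) (σ := τ)
      (by linarith) (by linarith) (by simpa using he l)
    have b2 := h.deriv_sub_mul_ge (by linarith) hM (a := z l + z (l - 1))
      (b := (z l + e l) + (z (l - 1) + e (l - 1))) (σ := 2 * τ)
      (by linarith) (by linarith) (by rw [abs_le]; constructor <;> linarith)
    -- The sum of two stretches of at least r_*/2 lies in the concave range; this sign is what
    -- allows the square of the sum to be replaced by its upper bound.
    have n1 : iteratedDeriv 2 phi (z l + z (l - 1)) ≤ 0 := h.deriv_two_nonpos (by linarith)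
    rw [show z l + e l - z l = e l by ring] at b1
    rw [show z l + e l + (z (l - 1) + e (l - 1)) - (z l + z (l - 1)) = e l + e (l - 1) by ring]
      at b2
    have q : (e l + e (l - 1)) ^ 2 ≤ 2 * (e l ^ 2 + e (l - 1) ^ 2) := by
      nlinarith [sq_nonneg (e l - e (l - 1))]
    have q1 := mul_le_mul_of_nonpos_left q n1
    have q2 := mul_le_mul_of_nonneg_left q (mul_nonneg hM0 hτ0)
    simp only [hW, ← sub_eq_add_neg, sub_add_cancel]
    rw [add_comm (z (l - 1)) (z l)]
    nlinarith
  refine le_trans ?_ (Finset.sum_le_sum fun l _ => h1 l)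
  rw [Finset.sum_add_distrib, hWs, ← Finset.sum_add_distrib, Finset.mul_sum]
  refine Finset.sum_le_sum fun l _ => ?_
  have := mul_le_mul_of_nonneg_right (hA l) (sq_nonneg (e l))
  simp only [hW]
  nlinarith

end IsPotential

/-! ### First order conditions -/

section Stationary

variable {x : ℤ → ℝ} {K : ℕ} {F : ℝ} {y v : ℝ → ℝ}

theorem Displacement.isP1 (hv : v ∈ Displacement x) : IsP1 x v := hv.1

theorem Displacement.periodic (hv : v ∈ Displacement x) (t : ℝ) : v (t + 1) = v t := hv.2.1 t

theorem Displacement.integral_eq_zero (hv : v ∈ Displacement x) :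
    ∫ t in (0 : ℝ)..1, v t = 0 := hv.2.2

theorem Deformation.isP1 (hy : y ∈ Deformation x F) : IsP1 x y := by
  have h := (Displacement.isP1 hy).add (isP1_linear x F)
  have : (fun t => displ F y t + F * t) = y := by funext t; unfold displ; ring
  rwa [this] at h

theorem Deformation.periodic (hy : y ∈ Deformation x F) (t : ℝ) : y (t + 1) = y t + F := by
  have := Displacement.periodic hy t
  unfold displ at this
  linarith

theorem Displacement.bounded (hv : v ∈ Displacement x) (hx : IsPartition x K) :
    ∃ C, 0 < C ∧ ∀ t, |v t| ≤ C := by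
  refine ⟨(∫ r in (0 : ℝ)..1, |deriv v r|) + |v 0| + 1, ?_, fun t => ?_⟩
  · have : 0 ≤ ∫ r in (0 : ℝ)..1, |deriv v r| :=
      intervalIntegral.integral_nonneg zero_le_one fun _ _ => abs_nonneg _
    positivity
  · have h1 := (Displacement.isP1 hv).abs_sub_le hx (Displacement.periodic hv) t 0
    have h2 := abs_sub_abs_le_abs_sub (v t) (v 0)
    linarith

theorem Deformation.add_mul (hy : y ∈ Deformation x F) (hv : v ∈ Displacement x) (t : ℝ) :
    (fun s => y s + t * v s) ∈ Deformation x F := by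
  have he : displ F (fun s => y s + t * v s) = fun s => displ F y s + t * v s := by
    funext s; unfold displ; ring
  have h1 := Displacement.isP1 hy
  have h2 := Displacement.isP1 hv
  refine ⟨?_, ?_, ?_⟩
  · rw [he]; exact h1.add (h2.const_mul t)
  · intro s
    rw [he]
    simp only [Displacement.periodic hy s, Displacement.periodic hv s]
  · rw [he, intervalIntegral.integral_add (h1.1.intervalIntegrable _ _)
      ((h2.1.const_mul t).intervalIntegrable _ _), intervalIntegral.integral_const_mul,
      Displacement.integral_eq_zero hv, Displacement.integral_eq_zero hy]
    simp

/-- Displacements are bounded, so y + tv stays in the ρ-ball of the supremum norm for small t, and t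
= 0 is a local minimum of a real function. -/
theorem IsSolution.deriv_eq_zero {E : (ℝ → ℝ) → ℝ} (h : IsSolution E x F y)
    (hx : IsPartition x K) (hv : v ∈ Displacement x) {E' : ℝ}
    (hE : HasDerivAt (fun t : ℝ => E (fun s => y s + t * v s)) E' 0) : E' = 0 := by
  obtain ⟨ρ, hρ, hmin⟩ := h.local_min
  obtain ⟨C, hC, hvC⟩ := Displacement.bounded hv hx
  refine IsLocalMin.hasDerivAt_eq_zero ?_ hE
  have h0 : 0 < ρ / C := div_pos hρ hC
  filter_upwards [Ioo_mem_nhds (neg_lt_zero.2 h0) h0] with t ht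
  have h1 : (fun s => y s + 0 * v s) = y := by funext s; ring
  simp only [h1]
  refine hmin _ (Deformation.add_mul h.admissible hv t) fun s => ?_
  rw [add_sub_cancel_left, abs_mul]
  have ht' : |t| ≤ ρ / C := (abs_lt.2 ht).le
  calc |t| * |v s| ≤ ρ / C * C := by gcongr; exact hvC s
    _ = ρ := by field_simp

end Stationary

/-! ### The atomistic model -/

section Atomistic

variable {N : ℕ} {phi y v : ℝ → ℝ} {rstar : ℝ}

/-- The derivative of the stored atomistic energy at `y` in direction `v`. -/
def atomDeriv (phi : ℝ → ℝ) (N : ℕ) (y v : ℝ → ℝ) : ℝ :=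
  ∑ l ∈ Finset.Icc (1 : ℤ) N,
      deriv phi ((y (latt N l) - y (latt N (l - 1))) / spacing N) *
        (v (latt N l) - v (latt N (l - 1))) +
  ∑ l ∈ Finset.Icc (1 : ℤ) N,
      deriv phi ((y (latt N l) - y (latt N (l - 2))) / spacing N) *
        (v (latt N l) - v (latt N (l - 2)))

theorem elemGrad_latt (N : ℕ) (g : ℝ → ℝ) (l : ℤ) :
    elemGrad (latt N) g l = (g (latt N l) - g (latt N (l - 1))) / spacing N := by
  unfold elemGrad; rw [latt_sub_one, sub_sub_cancel]

theorem sub_latt_one (hN : 0 < N) (g : ℝ → ℝ) (l : ℤ) :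
    g (latt N l) - g (latt N (l - 1)) = spacing N * elemGrad (latt N) g l := by
  have := (spacing_pos hN).ne'
  rw [elemGrad_latt]; field_simp

theorem sub_latt_two (hN : 0 < N) (g : ℝ → ℝ) (l : ℤ) :
    g (latt N l) - g (latt N (l - 2)) =
      spacing N * (elemGrad (latt N) g l + elemGrad (latt N) g (l - 1)) := by
  have h1 := sub_latt_one hN g l
  have h2 := sub_latt_one hN g (l - 1)
  rw [show l - 1 - 1 = l - 2 by ring] at h2
  linarith

theorem atomDeriv_eq (hN : 0 < N) (phi y v : ℝ → ℝ) :
    atomDeriv phi N y v = ∑ l ∈ Finset.Icc (1 : ℤ) N, spacing N *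
      (deriv phi (elemGrad (latt N) y l) * elemGrad (latt N) v l +
        deriv phi (elemGrad (latt N) y l + elemGrad (latt N) y (l - 1)) *
          (elemGrad (latt N) v l + elemGrad (latt N) v (l - 1))) := by
  have h0 := (spacing_pos hN).ne'
  unfold atomDeriv
  rw [← Finset.sum_add_distrib]
  refine Finset.sum_congr rfl fun l _ => ?_
  rw [sub_latt_one hN, sub_latt_one hN, sub_latt_two hN, sub_latt_two hN,
    mul_div_cancel_left₀ _ h0, mul_div_cancel_left₀ _ h0]
  ring

theorem IsPotential.hasDerivAt_comp_affine (h : IsPotential phi rstar) {a b : ℝ} (ha : 0 < a) :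
    HasDerivAt (fun t : ℝ => phi (a + t * b)) (deriv phi a * b) 0 := by
  have h1 : HasDerivAt (fun t : ℝ => a + t * b) b 0 := by
    simpa using ((hasDerivAt_id (0 : ℝ)).mul_const b).const_add a
  have h2 : HasDerivAt phi (deriv phi a) (a + 0 * b) := by
    rw [zero_mul, add_zero]; exact h.hasDerivAt ha
  exact h2.comp 0 h1

theorem hasDerivAt_atomStored (hN : 0 < N) (h : IsPotential phi rstar)
    (hy : ∀ l, 0 < elemGrad (latt N) y l) :
    HasDerivAt (fun t : ℝ => atomStored phi N (fun s => y s + t * v s))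
      (atomDeriv phi N y v) 0 := by
  have h0 := spacing_pos hN
  have key : ∀ a b c d : ℝ, 0 < (a - b) / spacing N →
      HasDerivAt (fun t : ℝ => phi ((a + t * c - (b + t * d)) / spacing N))
        (deriv phi ((a - b) / spacing N) * ((c - d) / spacing N)) 0 := by
    intro a b c d hab
    have := h.hasDerivAt_comp_affine (b := (c - d) / spacing N) hab
    refine this.congr_of_eventuallyEq (Filter.Eventually.of_forall fun t => ?_)
    simp only
    congr 1; ring
  unfold atomStored atomDeriv
  refine HasDerivAt.add ?_ ?_
  · have := (HasDerivAt.fun_sum (u := Finset.Icc (1 : ℤ) N) fun l _ =>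
      key (y (latt N l)) (y (latt N (l - 1))) (v (latt N l)) (v (latt N (l - 1)))
        (by rw [← elemGrad_latt]; exact hy l)).const_mul (spacing N)
    refine this.congr_deriv ?_
    rw [Finset.mul_sum]
    exact Finset.sum_congr rfl fun l _ => by field_simp
  · have := (HasDerivAt.fun_sum (u := Finset.Icc (1 : ℤ) N) fun l _ =>
      key (y (latt N l)) (y (latt N (l - 2))) (v (latt N l)) (v (latt N (l - 2)))
        (by rw [sub_latt_two hN, mul_div_cancel_left₀ _ h0.ne']
            exact add_pos (hy l) (hy (l - 1)))).const_mul (spacing N)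
    refine this.congr_deriv ?_
    rw [Finset.mul_sum]
    exact Finset.sum_congr rfl fun l _ => by field_simp

theorem atomDeriv_eq_pairing (hN : 0 < N) (h : IsPotential phi rstar) {F : ℝ} {f : ℝ → ℝ}
    (hy : IsSolution (atomEnergy phi N F f) (latt N) F y) (hv : v ∈ Displacement (latt N)) :
    atomDeriv phi N y v = atomPairing N f v := by
  have h1 := hasDerivAt_atomStored (v := v) hN h hy.grad_pos
  have h2 : HasDerivAt (fun t : ℝ => atomPairing N f (displ F (fun s => y s + t * v s)))
      (atomPairing N f v) 0 := by
    have : ∀ t : ℝ, atomPairing N f (displ F (fun s => y s + t * v s)) =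
        atomPairing N f (displ F y) + t * atomPairing N f v := by
      intro t
      unfold atomPairing displ
      rw [Finset.mul_sum, ← Finset.sum_add_distrib]
      exact Finset.sum_congr rfl fun l _ => by ring
    simp only [this]
    simpa using ((hasDerivAt_id (0 : ℝ)).mul_const (atomPairing N f v)).const_add
      (atomPairing N f (displ F y))
  have := hy.deriv_eq_zero (latt_isPartition hN) hv (h1.sub h2)
  linarith

end Atomistic

/-! ### Interpolation on a partition -/

section Interpolation

variable {x : ℤ → ℝ} {K : ℕ}

/-- The piecewise linear interpolant of a periodic function. -/
theorem IsPartition.exists_interp (hx : IsPartition x K) {v : ℝ → ℝ} (hv : ∀ t, v (t + 1) = v t) :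
    ∃ W : ℝ → ℝ, IsP1 x W ∧ (∀ t, W (t + 1) = W t) ∧ ∀ k, W (x k) = v (x k) := by
  choose idx hidx using hx.exists_index
  set G : ℝ → ℝ := fun t => elemGrad x v (idx t) with hG
  have hidx_eq : ∀ k t, x (k - 1) ≤ t → t < x k → idx t = k := by
    intro k t h1 h2
    have h3 := hx.mono.lt_iff_lt.1 ((hidx t).1.trans_lt h2)
    have h4 := hx.mono.lt_iff_lt.1 (h1.trans_lt (hidx t).2)
    omega
  have hGk : ∀ k, ∀ t ∈ Ioo (x (k - 1)) (x k), G t = elemGrad x v k := fun k t ht => by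
    simp only [hG, hidx_eq k t ht.1.le ht.2]
  have hGp : Function.Periodic G 1 := by
    intro t
    have h1 : idx (t + 1) = idx t + K := by
      apply hidx_eq
      · rw [show idx t + (K : ℤ) - 1 = idx t - 1 + K by ring, hx.add]; linarith [(hidx t).1]
      · rw [hx.add]; linarith [(hidx t).2]
    simp only [hG, h1]
    exact elemGrad_add_period (F := 0) hx (by simpa using hv) _
  have hGi : ∀ a b, IntervalIntegrable G volume a b :=
    hx.intervalIntegrable hGp fun k => intervalIntegrable_of_eq_Ioo (hx.lt_node k).le
      (intervalIntegrable_const (c := elemGrad x v k)) (hGk k)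
  have hsub : ∀ k, ∀ t ∈ Icc (x (k - 1)) (x k),
      ∫ s in x (k - 1)..t, G s = (t - x (k - 1)) * elemGrad x v k := fun k t ht =>
    integral_eq_const ht.1 fun s hs => hGk k s ⟨hs.1, hs.2.trans_le ht.2⟩
  -- Taking a primitive of the piecewise constant gradient gives continuity at once; periodicity
  -- follows because the increment over a period is the same everywhere and vanishes between x_0 and
  -- x_0 + 1.
  set W : ℝ → ℝ := fun t => v (x 0) + ∫ s in x 0..t, G s with hW
  have hWsub : ∀ a b, W b - W a = ∫ s in a..b, G s := by
    intro a b
    have := intervalIntegral.integral_add_adjacent_intervals (hGi (x 0) a) (hGi a b)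
    simp only [hW]; linarith
  have hstep : ∀ k, W (x k) - W (x (k - 1)) = v (x k) - v (x (k - 1)) := by
    intro k
    rw [hWsub, hsub k _ ⟨(hx.lt_node k).le, le_rfl⟩, ← elemGrad_mul hx]; ring
  have hnode : ∀ k, W (x k) = v (x k) := by
    intro k
    induction k using Int.induction_on with
    | zero => simp [hW]
    | succ i ih => have := hstep (i + 1); rw [add_sub_cancel_right] at this; linarith
    | pred i ih => have := hstep (-i); linarith
  refine ⟨W, ⟨?_, fun k => ?_⟩, fun t => ?_, hnode⟩
  · exact continuous_const.add (intervalIntegral.continuous_primitive hGi _)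
  · refine ⟨elemGrad x v k, W (x (k - 1)) - x (k - 1) * elemGrad x v k, fun t ht => ?_⟩
    have h1 := hWsub (x (k - 1)) t
    rw [hsub k t ht] at h1
    linarith
  · have h1 := hWsub t (t + 1)
    have h2 := hWsub (x 0) (x 0 + 1)
    rw [hGp.intervalIntegral_add_eq t (x 0), ← h2] at h1
    have h3 : x 0 + 1 = x (0 + K) := (hx.add 0).symm
    have h4 : W (x 0 + 1) = W (x 0) := by
      rw [h3, hnode, ← h3, hv, hnode]
    linarith

/-- The interpolant of a periodic function, shifted to mean zero. -/
theorem IsPartition.exists_displacement (hx : IsPartition x K) {v : ℝ → ℝ}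
    (hv : ∀ t, v (t + 1) = v t) :
    ∃ (c : ℝ) (W : ℝ → ℝ), W ∈ Displacement x ∧ (∀ k, W (x k) = v (x k) - c) ∧
      ∀ B : ℝ, (∀ s t, |v s - v t| ≤ B) → ∀ t, |v t - c| ≤ B := by
  obtain ⟨W, hW, hWp, hWx⟩ := hx.exists_interp hv
  refine ⟨∫ t in (0 : ℝ)..1, W t, fun t => W t + -(∫ t in (0 : ℝ)..1, W t),
    ⟨hW.const_add _, fun t => by simp only [hWp t], ?_⟩,
    fun k => by simp only [hWx]; ring, fun B hB t => ?_⟩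
  · rw [intervalIntegral.integral_add (hW.1.intervalIntegrable _ _) intervalIntegrable_const]
    simp
  -- The constant c is the mean of W, and each W s is a convex combination of two nodal values of v.
  -- Hence v t - c is an average of differences of values of v.
  · have h1 : v t - ∫ s in (0 : ℝ)..1, W s = ∫ s in (0 : ℝ)..1, (v t - W s) := by
      rw [intervalIntegral.integral_sub intervalIntegrable_const (hW.1.intervalIntegrable _ _)]
      simp
    rw [h1]
    have h2 := intervalIntegral.norm_integral_le_of_norm_le_const (a := (0 : ℝ)) (b := 1) (C := B)
      (f := fun s => v t - W s) fun s _ => ?_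
    · simpa using h2
    obtain ⟨k, hk1, hk2⟩ := hx.exists_index s
    have hlen := hx.lt_node k
    have e1 := hW.eq_on hx ⟨hk1, hk2.le⟩
    have e2 := elemGrad_mul hx W k
    rw [hWx, hWx] at e2
    have b1 := abs_le.1 (hB t (x k))
    have b2 := abs_le.1 (hB t (x (k - 1)))
    set θ := (x k - s) / (x k - x (k - 1)) with hθ
    have hθ0 : 0 ≤ θ := div_nonneg (by linarith) (by linarith)
    have hθ1 : θ ≤ 1 := by rw [hθ, div_le_one (by linarith)]; linarith
    have e3 : W s = v (x k) - θ * (v (x k) - v (x (k - 1))) := by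
      rw [e1, hWx, ← e2, hθ]
      have : x k - x (k - 1) ≠ 0 := by linarith
      field_simp; ring
    rw [Real.norm_eq_abs, e3, abs_le]
    constructor <;> nlinarith

/-- A piecewise linear function with positive gradients is strictly increasing. -/
theorem IsP1.strictMono {y : ℝ → ℝ} (hy : IsP1 x y) (hx : IsPartition x K)
    (hpos : ∀ k, 0 < elemGrad x y k) : StrictMono y := by
  have hn : StrictMono fun k => y (x k) := by
    refine strictMono_int_of_lt_succ fun k => ?_
    have h1 := elemGrad_mul hx y (k + 1)
    rw [add_sub_cancel_right] at h1
    have h2 : x k < x (k + 1) := hx.mono (by omega)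
    have := mul_pos (hpos (k + 1)) (sub_pos.2 h2)
    linarith
  intro a b hab
  obtain ⟨k, hk1, hk2⟩ := hx.exists_index a
  obtain ⟨j, hj1, hj2⟩ := hx.exists_index b
  have loc : ∀ k s t, s ∈ Icc (x (k - 1)) (x k) → t ∈ Icc (x (k - 1)) (x k) → s ≤ t →
      y s ≤ y t := by
    intro k s t hs ht hst
    have := hy.eq_on' hx ht hs
    have := mul_nonneg (hpos k).le (sub_nonneg.2 hst)
    linarith
  by_cases hb : b ≤ x k
  · have := hy.eq_on' hx (k := k) (t := b) (s := a) ⟨hk1.trans hab.le, hb⟩ ⟨hk1, hk2.le⟩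
    have := mul_pos (hpos k) (sub_pos.2 hab)
    linarith
  · push Not at hb
    have h1 : y a < y (x k) := by
      have := hy.eq_on' hx (k := k) (t := x k) (s := a) ⟨(hx.lt_node k).le, le_rfl⟩ ⟨hk1, hk2.le⟩
      have := mul_pos (hpos k) (sub_pos.2 hk2)
      linarith
    have h2 : k ≤ j - 1 := by
      have := hx.mono.lt_iff_lt.1 (hb.trans hj2)
      omega
    have h3 : y (x k) ≤ y (x (j - 1)) := hn.monotone h2
    have h4 := loc j (x (j - 1)) b ⟨le_rfl, (hx.lt_node j).le⟩ ⟨hj1, hj2.le⟩ hj1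
    linarith

end Interpolation

/-! ### The QC energy -/

theorem sum_bond_integral_one {N : ℕ} (hN : 0 < N) {H : ℝ → ℝ} (hp : Function.Periodic H 1)
    (hi : ∀ a b, IntervalIntegrable H volume a b) :
    ∑ i ∈ Finset.range N, ∫ t in latt N i..latt N (i + 1), H t = ∫ t in (0 : ℝ)..1, H t := by
  rw [(latt_isPartition hN).integral_eq_sum hp fun k => hi _ _,
    sum_Icc_eq_sum_range (fun k => ∫ t in latt N (k - 1)..latt N k, H t)]
  refine Finset.sum_congr rfl fun i _ => ?_
  rw [add_sub_cancel_right]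

/-- Each bond of length 2ε consists of two lattice cells, so over a period every point is covered
twice. -/
theorem sum_bond_integral_two {N : ℕ} (hN : 0 < N) {H : ℝ → ℝ} (hp : Function.Periodic H 1)
    (hi : ∀ a b, IntervalIntegrable H volume a b) :
    ∑ i ∈ Finset.range N, ∫ t in latt N i..latt N (i + 2), H t =
      2 * ∫ t in (0 : ℝ)..1, H t := by
  have h1 : ∀ i : ℕ, ∫ t in latt N i..latt N (i + 2), H t =
      (∫ t in latt N i..latt N (i + 1), H t) + ∫ t in latt N (i + 1)..latt N (i + 2), H t :=
    fun i => (intervalIntegral.integral_add_adjacent_intervals (hi _ _) (hi _ _)).symm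
  simp only [h1]
  rw [Finset.sum_add_distrib, sum_bond_integral_one hN hp hi, two_mul]
  congr 1
  have h2 : ∀ k : ℤ, ∫ t in latt N (k + N)..latt N (k + N + 1), H t =
      ∫ t in latt N k..latt N (k + 1), H t := by
    intro k
    rw [show k + (N : ℤ) + 1 = k + 1 + N by ring, (latt_isPartition hN).add,
      (latt_isPartition hN).add, ← intervalIntegral.integral_comp_add_right]
    simp only [hp _]
  rw [← sum_bond_integral_one hN hp hi,
    sum_range_periodic (fun k => ∫ t in latt N k..latt N (k + 1), H t) N h2,
    ← sum_Icc_shift (fun k => ∫ t in latt N k..latt N (k + 1), H t) N h2 1,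
    ← sum_range_periodic (fun k => ∫ t in latt N (k + 1)..latt N (k + 1 + 1), H t) N]
  · refine Finset.sum_congr rfl fun i _ => ?_
    rw [add_assoc]; rfl
  · intro k
    have := h2 (k + 1)
    rwa [show k + 1 + (N : ℤ) = k + N + 1 by ring] at this

namespace Mesh

variable {N : ℕ} (m : Mesh N) {phi y v W : ℝ → ℝ} {F rstar : ℝ}

theorem indicator_periodic {G : ℝ → ℝ} (hG : Function.Periodic G 1) :
    Function.Periodic (m.Oaᶜ.indicator G) 1 := by
  intro t
  by_cases h : t ∈ m.Oa
  · rw [indicator_of_notMem (by simpa using (m.periodic_Oa t).2 h),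
      indicator_of_notMem (by simpa using h)]
  · have h' : t + 1 ∈ m.Oaᶜ := fun h' => h ((m.periodic_Oa t).1 h')
    rw [indicator_of_mem h', indicator_of_mem h, hG t]

theorem indicator_cont {G : ℝ → ℝ} {k : ℤ} (h : m.IsCont k) {t : ℝ}
    (ht : t ∈ Ioo (m.x (k - 1)) (m.x k)) : m.Oaᶜ.indicator G t = G t :=
  indicator_of_mem (h (Ioo_subset_Icc_self ht)) _

theorem indicator_atom {G : ℝ → ℝ} {k : ℤ} (h : ¬ m.IsCont k) {t : ℝ}
    (ht : t ∈ Ioo (m.x (k - 1)) (m.x k)) : m.Oaᶜ.indicator G t = 0 :=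
  indicator_of_notMem (by simpa using m.Ioo_subset_of_not_isCont h ht) _

theorem indicator_intervalIntegrable {G : ℝ → ℝ} (hG : Function.Periodic G 1)
    (hi : ∀ k, IntervalIntegrable G volume (m.x (k - 1)) (m.x k)) (a b : ℝ) :
    IntervalIntegrable (m.Oaᶜ.indicator G) volume a b := by
  refine m.isPartition.intervalIntegrable (m.indicator_periodic hG) (fun k => ?_) a b
  by_cases h : m.IsCont k
  · exact intervalIntegrable_of_eq_Ioo (m.lt_node k).le (hi k) fun t ht => m.indicator_cont h ht
  · exact intervalIntegrable_of_eq_Ioo (m.lt_node k).le (intervalIntegrable_const (c := (0 : ℝ)))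
      fun t ht => m.indicator_atom h ht

open Classical in
theorem integral_indicator {G : ℝ → ℝ} (hG : Function.Periodic G 1)
    (hi : ∀ k, IntervalIntegrable G volume (m.x (k - 1)) (m.x k)) :
    ∫ t in (0 : ℝ)..1, m.Oaᶜ.indicator G t = ∑ k ∈ Finset.Icc (1 : ℤ) m.K,
      if m.IsCont k then ∫ t in m.x (k - 1)..m.x k, G t else 0 := by
  rw [m.isPartition.integral_eq_sum (m.indicator_periodic hG)
    fun k => m.indicator_intervalIntegrable hG hi _ _]
  refine Finset.sum_congr rfl fun k _ => ?_
  split_ifs with h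
  · exact integral_congr_Ioo (m.lt_node k).le fun t ht => m.indicator_cont h ht
  · rw [integral_eq_const (m.lt_node k).le fun t ht => m.indicator_atom h ht, mul_zero]

theorem setIntegral_bond (hN : 0 < N) (G : ℝ → ℝ) (i : ℤ) (r : ℕ) :
    ∫ t in bond N i r ∩ m.Oaᶜ, G t = ∫ t in latt N i..latt N (i + r), m.Oaᶜ.indicator G t := by
  rw [intervalIntegral.integral_of_le ((latt_le_latt hN).2 (by omega)),
    integral_Ioc_eq_integral_Ioo, setIntegral_indicator m.isClosed_compl.measurableSet]
  rfl

open Classical in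
/-- The stored QC energy as a sum over atomistic bond contributions and continuum elements. -/
theorem qcStored_eq (hN : 0 < N) (phi : ℝ → ℝ) (hy : IsP1 m.x y) (hp : ∀ t, y (t + 1) = y t + F) :
    m.qcStored phi y =
      ∑ i ∈ Finset.range N, (m.bondAtom phi y i 1 + m.bondAtom phi y i 2) +
      ∑ k ∈ Finset.Icc (1 : ℤ) m.K, if m.IsCont k then
        (m.x k - m.x (k - 1)) * (phi (elemGrad m.x y k) + phi (2 * elemGrad m.x y k)) else 0 := by
  have key : ∀ r : ℝ, Function.Periodic (fun t => phi (r * deriv y t)) 1 ∧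
      (∀ k, IntervalIntegrable (fun t => phi (r * deriv y t)) volume (m.x (k - 1)) (m.x k)) ∧
      (∀ k, ∫ t in m.x (k - 1)..m.x k, phi (r * deriv y t) =
        (m.x k - m.x (k - 1)) * phi (r * elemGrad m.x y k)) := by
    intro r
    have h1 : ∀ k, ∀ t ∈ Ioo (m.x (k - 1)) (m.x k),
        phi (r * deriv y t) = phi (r * elemGrad m.x y k) := fun k t ht => by
      rw [hy.deriv_eq m.isPartition ht]
    exact ⟨fun t => by simp only [deriv_periodic hp t],
      fun k => intervalIntegrable_of_eq_Ioo (m.lt_node k).le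
        (intervalIntegrable_const (c := phi (r * elemGrad m.x y k))) (h1 k),
      fun k => integral_eq_const (m.lt_node k).le (h1 k)⟩
  unfold qcStored bondCont
  simp only [Finset.sum_pair (show (1 : ℕ) ≠ 2 by norm_num), m.setIntegral_bond hN,
    Nat.cast_one, Nat.cast_ofNat]
  -- The weight 1/r compensates the r-fold covering by bonds of range r, which turns the continuum
  -- contributions into the Cauchy–Born density φ(y') + φ(2y').
  have h1 := sum_bond_integral_one hN (m.indicator_periodic (key 1).1)
    (m.indicator_intervalIntegrable (key 1).1 (key 1).2.1)
  have h2 := sum_bond_integral_two hN (m.indicator_periodic (key 2).1)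
    (m.indicator_intervalIntegrable (key 2).1 (key 2).2.1)
  rw [m.integral_indicator (key 1).1 (key 1).2.1] at h1
  rw [m.integral_indicator (key 2).1 (key 2).2.1] at h2
  simp only [(key 1).2.2] at h1
  simp only [(key 2).2.2] at h2
  rw [Finset.sum_add_distrib, Finset.sum_add_distrib, Finset.sum_add_distrib,
    Finset.sum_add_distrib, ← Finset.mul_sum, ← Finset.mul_sum]
  simp only [one_mul, div_one] at h1 h2 ⊢
  rw [h1, h2]
  have h3 : ∀ k, (if m.IsCont k then (m.x k - m.x (k - 1)) *
      (phi (elemGrad m.x y k) + phi (2 * elemGrad m.x y k)) else 0) =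
      (if m.IsCont k then (m.x k - m.x (k - 1)) * phi (elemGrad m.x y k) else 0) +
      (if m.IsCont k then (m.x k - m.x (k - 1)) * phi (2 * elemGrad m.x y k) else 0) := by
    intro k; split_ifs <;> ring
  simp only [h3]
  rw [Finset.sum_add_distrib]
  ring

/-- The derivative of the atomistic contribution of a bond. -/
def bondAtomDeriv (phi y v : ℝ → ℝ) (i : ℤ) (r : ℕ) : ℝ :=
  volume.real (bond N i r ∩ m.Oa) * deriv phi (r * intervalQuot (bond N i r ∩ m.Oa) y) *
    intervalQuot (bond N i r ∩ m.Oa) v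

/-- The intersection need not be an interval, but positive measure forces its infimum and supremum
to differ, which is enough for increasing y. -/
theorem intervalQuot_pos (hy : StrictMono y) {i : ℤ} {r : ℕ}
    (h : volume.real (bond N i r ∩ m.Oa) ≠ 0) :
    0 < intervalQuot (bond N i r ∩ m.Oa) y := by
  set ω := bond N i r ∩ m.Oa with hω
  have hlt : sInf ω < sSup ω := by
    by_contra hc
    have hb : BddBelow ω := ⟨latt N i, fun t ht => ht.1.1.le⟩
    have ha : BddAbove ω := ⟨latt N (i + r), fun t ht => ht.1.2.le⟩
    have hs : ω.Subsingleton := by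
      intro s hs t ht
      have := csInf_le hb hs
      have := csInf_le hb ht
      have := le_csSup ha hs
      have := le_csSup ha ht
      linarith
    exact h (by rw [measureReal_def, hs.measure_zero]; rfl)
  unfold intervalQuot
  exact div_pos (sub_pos.2 (hy hlt)) (lt_of_le_of_ne measureReal_nonneg h.symm)

theorem hasDerivAt_bondAtom (h : IsPotential phi rstar) (hy : StrictMono y) (i : ℤ) {r : ℕ}
    (hr : 0 < r) : HasDerivAt (fun t : ℝ => m.bondAtom phi (fun s => y s + t * v s) i r)
      (m.bondAtomDeriv phi y v i r) 0 := by
  have hr' : (0 : ℝ) < r := by exact_mod_cast hr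
  unfold bondAtom bondAtomDeriv
  by_cases h0 : volume.real (bond N i r ∩ m.Oa) = 0
  · simp only [h0, zero_div, zero_mul]
    exact hasDerivAt_const _ _
  have h1 := m.intervalQuot_pos hy h0
  have h2 := (h.hasDerivAt_comp_affine (b := r * intervalQuot (bond N i r ∩ m.Oa) v)
    (mul_pos hr' h1)).const_mul (volume.real (bond N i r ∩ m.Oa) / r)
  refine (h2.congr_of_eventuallyEq (Filter.Eventually.of_forall fun t => ?_)).congr_deriv ?_
  · simp only
    congr 2
    unfold intervalQuot; ring
  · field_simp

open Classical in
/-- The derivative of the stored QC energy at `y` in direction `v`. -/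
def qcDeriv (phi y v : ℝ → ℝ) : ℝ :=
  ∑ i ∈ Finset.range N, (m.bondAtomDeriv phi y v i 1 + m.bondAtomDeriv phi y v i 2) +
  ∑ k ∈ Finset.Icc (1 : ℤ) m.K, if m.IsCont k then
    (deriv phi (elemGrad m.x y k) + 2 * deriv phi (2 * elemGrad m.x y k)) *
      (v (m.x k) - v (m.x (k - 1))) else 0

theorem hasDerivAt_qcStored (hN : 0 < N) (h : IsPotential phi rstar) (hy : y ∈ Deformation m.x F)
    (hpos : ∀ k, 0 < elemGrad m.x y k) (hv : v ∈ Displacement m.x) :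
    HasDerivAt (fun t : ℝ => m.qcStored phi (fun s => y s + t * v s)) (m.qcDeriv phi y v) 0 := by
  have hmono := (Deformation.isP1 hy).strictMono m.isPartition hpos
  have e1 : ∀ t : ℝ, m.qcStored phi (fun s => y s + t * v s) = _ := fun t =>
    m.qcStored_eq hN phi (Deformation.isP1 (Deformation.add_mul hy hv t))
      (Deformation.periodic (Deformation.add_mul hy hv t))
  simp only [e1]
  unfold qcDeriv
  refine HasDerivAt.add ?_ ?_
  · exact HasDerivAt.fun_sum fun i _ => (m.hasDerivAt_bondAtom h hmono i one_pos).add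
      (m.hasDerivAt_bondAtom h hmono i two_pos)
  · refine HasDerivAt.fun_sum fun k _ => ?_
    split_ifs with hc
    · have e2 : ∀ t : ℝ, elemGrad m.x (fun s => y s + t * v s) k =
          elemGrad m.x y k + t * elemGrad m.x v k := fun t => by unfold elemGrad; ring
      have e3 : ∀ t : ℝ, 2 * elemGrad m.x (fun s => y s + t * v s) k =
          2 * elemGrad m.x y k + t * (2 * elemGrad m.x v k) := fun t => by rw [e2]; ring
      simp only [e3]
      simp only [e2]
      have d1 := h.hasDerivAt_comp_affine (b := elemGrad m.x v k) (hpos k)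
      have d2 := h.hasDerivAt_comp_affine (b := 2 * elemGrad m.x v k)
        (mul_pos two_pos (hpos k))
      refine ((d1.add d2).const_mul (m.x k - m.x (k - 1))).congr_deriv ?_
      rw [← elemGrad_mul m.isPartition]; ring
    · exact hasDerivAt_const _ _

theorem qcDeriv_eq_pairing (hN : 0 < N) (h : IsPotential phi rstar) {f : ℝ → ℝ}
    (hy : IsSolution (m.qcEnergy phi F f) m.x F y) (hv : v ∈ Displacement m.x) :
    m.qcDeriv phi y v = m.qcPairing f v := by
  have h1 := m.hasDerivAt_qcStored hN h hy.admissible hy.grad_pos hv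
  have h2 : HasDerivAt (fun t : ℝ => m.qcPairing f (displ F (fun s => y s + t * v s)))
      (m.qcPairing f v) 0 := by
    have : ∀ t : ℝ, m.qcPairing f (displ F (fun s => y s + t * v s)) =
        m.qcPairing f (displ F y) + t * m.qcPairing f v := by
      intro t
      unfold qcPairing displ
      rw [Finset.mul_sum, ← Finset.sum_add_distrib]
      exact Finset.sum_congr rfl fun l _ => by ring
    simp only [this]
    simpa using ((hasDerivAt_id (0 : ℝ)).mul_const (m.qcPairing f v)).const_add
      (m.qcPairing f (displ F y))
  have := hy.deriv_eq_zero m.isPartition hv (h1.sub h2)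
  linarith

/-- The derivative of the contribution of a bond in direction of a lattice displacement. -/
def bondDeriv (phi y v : ℝ → ℝ) (i : ℤ) (r : ℕ) : ℝ :=
  m.bondAtomDeriv phi y v i r +
    ∫ t in latt N i..latt N (i + r),
      m.Oaᶜ.indicator (fun t => deriv phi (r * deriv y t) * deriv v t) t

theorem stress_integrable (hN : 0 < N) (hy : IsP1 m.x y) (hv : IsP1 (latt N) v)
    (hvp : ∀ t, v (t + 1) = v t) (r : ℝ) (k : ℤ) :
    IntervalIntegrable (fun t => deriv phi (r * deriv y t) * deriv v t) volume
      (m.x (k - 1)) (m.x k) :=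
  intervalIntegrable_of_eq_Ioo (m.lt_node k).le
    ((hv.deriv_intervalIntegrable (F := 0) (latt_isPartition hN) (by simpa using hvp) _ _).const_mul
      (deriv phi (r * elemGrad m.x y k))) fun t ht => by rw [hy.deriv_eq m.isPartition ht]

/-- Here v is affine on lattice cells, not on mesh elements. Since y' is constant on each element, ∫
φ'(ry')v' over it depends only on the nodal values of v, as the formula for `qcDeriv` does. -/
theorem qcDeriv_eq_sum_bondDeriv (hN : 0 < N) (hy : IsP1 m.x y) (hyp : ∀ t, y (t + 1) = y t + F)
    (hv : IsP1 (latt N) v) (hvp : ∀ t, v (t + 1) = v t) :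
    m.qcDeriv phi y v = ∑ i ∈ Finset.range N,
      (m.bondDeriv phi y v i 1 + m.bondDeriv phi y v i 2) := by
  have hvp' : ∀ t, v (t + 1) = v t + 0 := by simpa using hvp
  have hper : ∀ r : ℝ, Function.Periodic (fun t => deriv phi (r * deriv y t) * deriv v t) 1 :=
    fun r t => by simp only [deriv_periodic hyp t, deriv_periodic hvp' t]
  have hint := fun r : ℝ => m.stress_integrable (phi := phi) hN hy hv hvp r
  have hval : ∀ (r : ℝ) k, ∫ t in m.x (k - 1)..m.x k, deriv phi (r * deriv y t) * deriv v t =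
      deriv phi (r * elemGrad m.x y k) * (v (m.x k) - v (m.x (k - 1))) := by
    intro r k
    rw [integral_congr_Ioo (m.lt_node k).le (G := fun t => deriv phi (r * elemGrad m.x y k) *
      deriv v t) fun t ht => by rw [hy.deriv_eq m.isPartition ht],
      intervalIntegral.integral_const_mul, hv.integral_deriv (latt_isPartition hN) hvp']
  have h1 := sum_bond_integral_one hN (m.indicator_periodic (hper 1))
    (m.indicator_intervalIntegrable (hper 1) (hint 1))
  have h2 := sum_bond_integral_two hN (m.indicator_periodic (hper 2))
    (m.indicator_intervalIntegrable (hper 2) (hint 2))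
  rw [m.integral_indicator (hper 1) (hint 1)] at h1
  rw [m.integral_indicator (hper 2) (hint 2)] at h2
  simp only [hval] at h1 h2
  simp only [one_mul] at h1
  unfold qcDeriv bondDeriv
  simp only [Nat.cast_one, Nat.cast_ofNat, one_mul]
  rw [Finset.sum_add_distrib, Finset.sum_add_distrib, Finset.sum_add_distrib,
    Finset.sum_add_distrib, h1, h2, Finset.mul_sum]
  have h3 : ∀ a b c d e : ℝ, e = c + d → a + b + e = a + c + (b + d) := by intros; linarith
  apply h3
  rw [← Finset.sum_add_distrib]
  refine Finset.sum_congr rfl fun k _ => ?_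
  split_ifs <;> ring

end Mesh

/-! ### Defects of individual bonds -/

theorem intervalQuot_Ioo {a b : ℝ} (hab : a < b) (y : ℝ → ℝ) :
    intervalQuot (Ioo a b) y = (y b - y a) / (b - a) := by
  unfold intervalQuot
  rw [csSup_Ioo hab, csInf_Ioo hab, Real.volume_real_Ioo_of_le hab.le]

/-- The difference between the stress acting on the bond `(L, R)` if its two parts separated by `s`
are stretched independently, and the stress of the atomistic bond. -/
def nodeDefect (p y v : ℝ → ℝ) (ε r L s R : ℝ) : ℝ :=
  p (r * ((y s - y L) / (s - L))) * (v s - v L) +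
    p (r * ((y R - y s) / (R - s))) * (v R - v s) - p ((y R - y L) / ε) * (v R - v L)

namespace Mesh

variable {N : ℕ} (m : Mesh N) {phi y v W : ℝ → ℝ} {F : ℝ}

/-- The difference of the QC and the atomistic stress acting on a bond. -/
def bondDefect (phi y v : ℝ → ℝ) (i : ℤ) (r : ℕ) : ℝ :=
  m.bondDeriv phi y v i r - deriv phi ((y (latt N (i + r)) - y (latt N i)) / spacing N) *
    (v (latt N (i + r)) - v (latt N i))

theorem bond_cases (hN : 0 < N) {i : ℤ} {r : ℕ} (hr : 0 < r) :
    bond N i r ⊆ m.Oa ∨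
    (bond N i r ⊆ m.Oaᶜ ∧ ∃ k, m.IsCont k ∧
      Icc (latt N i) (latt N (i + r)) ⊆ Icc (m.x (k - 1)) (m.x k)) ∨
    ∃ k, m.IsContNode k ∧ m.x k ∈ bond N i r := by
  by_cases h : ∃ k, m.IsContNode k ∧ m.x k ∈ bond N i r
  · exact Or.inr (Or.inr h)
  push Not at h
  rcases m.subset_or_of_no_contNode ((latt_lt_latt hN).2 (by omega)) h with h1 | h1
  · exact Or.inl h1
  · exact Or.inr (Or.inl h1)

theorem Icc_subset_left (hN : 0 < N) {k i : ℤ} {r : ℕ} (hr : r ≤ 2) (hc : m.IsCont k)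
    (hk : m.x k ∈ bond N i r) : Icc (latt N i) (m.x k) ⊆ Icc (m.x (k - 1)) (m.x k) := by
  refine Icc_subset_Icc_left ?_
  have h1 := m.continuum_size k hc
  have h2 := latt_add_two N i
  have h3 : latt N (i + r) ≤ latt N (i + 2) := (latt_le_latt hN).2 (by omega)
  linarith [hk.2]

theorem Icc_subset_right (hN : 0 < N) {k i : ℤ} {r : ℕ} (hr : r ≤ 2) (hc : m.IsCont (k + 1))
    (hk : m.x k ∈ bond N i r) :
    Icc (m.x k) (latt N (i + r)) ⊆ Icc (m.x (k + 1 - 1)) (m.x (k + 1)) := by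
  rw [add_sub_cancel_right]
  refine Icc_subset_Icc_right ?_
  have h1 := m.continuum_size (k + 1) hc
  rw [add_sub_cancel_right] at h1
  have h2 := latt_add_two N i
  have h3 : latt N (i + r) ≤ latt N (i + 2) := (latt_le_latt hN).2 (by omega)
  linarith [hk.1]

/-- The part of a bond around a node of the continuum region that lies in the atomistic region. -/
theorem bond_inter_of_contNode (hN : 0 < N) {k i : ℤ} {r : ℕ} (hr : r ≤ 2)
    (hk : m.x k ∈ bond N i r) :
    (m.IsCont k → m.IsCont (k + 1) → bond N i r ∩ m.Oa = ∅) ∧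
    (m.IsCont k → ¬ m.IsCont (k + 1) → bond N i r ∩ m.Oa = Ioo (m.x k) (latt N (i + r))) ∧
    (¬ m.IsCont k → m.IsCont (k + 1) → bond N i r ∩ m.Oa = Ioo (latt N i) (m.x k)) := by
  have hl : m.IsCont k → ∀ t ∈ bond N i r, t ≤ m.x k → t ∉ m.Oa := fun hc t ht h =>
    hc (m.Icc_subset_left hN hr hc hk ⟨ht.1.le, h⟩)
  have hrt : m.IsCont (k + 1) → ∀ t ∈ bond N i r, m.x k ≤ t → t ∉ m.Oa := fun hc t ht h =>
    hc (m.Icc_subset_right hN hr hc hk ⟨h, ht.2.le⟩)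
  refine ⟨fun h h' => ?_, fun h h' => ?_, fun h h' => ?_⟩
  · refine Set.eq_empty_of_forall_notMem fun t ht => ?_
    rcases le_total t (m.x k) with hle | hle
    · exact hl h t ht.1 hle ht.2
    · exact hrt h' t ht.1 hle ht.2
  · refine Subset.antisymm (fun t ht => ⟨?_, ht.1.2⟩) fun t ht => ⟨⟨hk.1.trans ht.1, ht.2⟩, ?_⟩
    · by_contra hc
      exact hl h t ht.1 (not_lt.1 hc) ht.2
    · exact m.atom_Ioo_right hN h h' (i := i) (by omega) hk ht
  · refine Subset.antisymm (fun t ht => ⟨ht.1.1, ?_⟩) fun t ht => ⟨⟨ht.1, ht.2.trans hk.2⟩, ?_⟩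
    · by_contra hc
      exact hrt h' t ht.1 (not_lt.1 hc) ht.2
    · exact m.atom_Ioo_left hN h h' (j := i + r) (by omega) hk ht

theorem bondAtomDeriv_of_eq_Ioo {i : ℤ} {r : ℕ} {a b : ℝ} (hab : a < b)
    (h : bond N i r ∩ m.Oa = Ioo a b) : m.bondAtomDeriv phi y v i r =
      deriv phi (r * ((y b - y a) / (b - a))) * (v b - v a) := by
  have : b - a ≠ 0 := by linarith
  unfold bondAtomDeriv
  rw [h, intervalQuot_Ioo hab, intervalQuot_Ioo hab, Real.volume_real_Ioo_of_le hab.le]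
  field_simp

theorem bondAtomDeriv_of_eq_empty {i : ℤ} {r : ℕ} (h : bond N i r ∩ m.Oa = ∅) :
    m.bondAtomDeriv phi y v i r = 0 := by
  unfold bondAtomDeriv
  rw [h]; simp

/-- Only the endpoints of the bond's part in Ω_a enter. They are sites in the closure of an
atomistic interval or continuum nodes, hence mesh nodes, and the constant c drops out of the
differences. -/
theorem bondAtomDeriv_congr (hN : 0 < N) {c : ℝ} (hW : ∀ k, W (m.x k) = v (m.x k) - c) (i : ℤ)
    {r : ℕ} (hr : 0 < r) (hr2 : r ≤ 2) :
    m.bondAtomDeriv phi y W i r = m.bondAtomDeriv phi y v i r := by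
  have hlt : latt N i < latt N (i + r) := (latt_lt_latt hN).2 (by omega)
  have node : ∀ {a b : ℝ}, a < b → Ioo a b ⊆ m.Oa → ∀ l : ℤ, latt N l ∈ Icc a b →
      W (latt N l) = v (latt N l) - c := fun hab h l hl => by
    obtain ⟨k, hk⟩ := m.node_of_mem_closure h hab hl
    rw [← hk, hW]
  rcases m.bond_cases hN hr with h | ⟨h, -⟩ | ⟨k, hc, hk⟩
  · have h1 : bond N i r ∩ m.Oa = Ioo (latt N i) (latt N (i + r)) := inter_eq_left.2 h
    rw [m.bondAtomDeriv_of_eq_Ioo hlt h1, m.bondAtomDeriv_of_eq_Ioo hlt h1,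
      node hlt h _ ⟨le_rfl, hlt.le⟩, node hlt h _ ⟨hlt.le, le_rfl⟩]
    congr 1; ring
  · have h1 : bond N i r ∩ m.Oa = ∅ := by
      rw [← disjoint_iff_inter_eq_empty]; exact disjoint_left.2 h
    rw [m.bondAtomDeriv_of_eq_empty h1, m.bondAtomDeriv_of_eq_empty h1]
  · obtain ⟨h1, h2, h3⟩ := m.bond_inter_of_contNode hN hr2 hk
    by_cases ha : m.IsCont k <;> by_cases hb : m.IsCont (k + 1)
    · rw [m.bondAtomDeriv_of_eq_empty (h1 ha hb), m.bondAtomDeriv_of_eq_empty (h1 ha hb)]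
    · have h4 := h2 ha hb
      rw [m.bondAtomDeriv_of_eq_Ioo hk.2 h4, m.bondAtomDeriv_of_eq_Ioo hk.2 h4, hW,
        node hk.2 (h4 ▸ inter_subset_right) _ ⟨hk.2.le, le_rfl⟩]
      congr 1; ring
    · have h4 := h3 ha hb
      rw [m.bondAtomDeriv_of_eq_Ioo hk.1 h4, m.bondAtomDeriv_of_eq_Ioo hk.1 h4, hW,
        node hk.1 (h4 ▸ inter_subset_right) _ ⟨le_rfl, hk.1.le⟩]
      congr 1; ring
    · exact absurd hc (by unfold IsContNode; tauto)

/-- This transfers the QC equation, valid for mesh directions W, to the lattice direction v. -/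
theorem qcDeriv_congr (hN : 0 < N) {c : ℝ} (hW : ∀ k, W (m.x k) = v (m.x k) - c) :
    m.qcDeriv phi y W = m.qcDeriv phi y v := by
  unfold qcDeriv
  congr 1
  · exact Finset.sum_congr rfl fun i _ => by
      rw [m.bondAtomDeriv_congr hN hW _ one_pos one_le_two,
        m.bondAtomDeriv_congr hN hW _ two_pos le_rfl]
  · exact Finset.sum_congr rfl fun k _ => by rw [hW, hW, sub_sub_sub_cancel_right]

theorem integral_stress_cont (hN : 0 < N) (hy : IsP1 m.x y) (hv : IsP1 (latt N) v)
    (hvp : ∀ t, v (t + 1) = v t) {k : ℤ} (hc : m.IsCont k) {a b : ℝ} (hab : a < b)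
    (h : Icc a b ⊆ Icc (m.x (k - 1)) (m.x k)) (r : ℝ) :
    ∫ t in a..b, m.Oaᶜ.indicator (fun t => deriv phi (r * deriv y t) * deriv v t) t =
      deriv phi (r * ((y b - y a) / (b - a))) * (v b - v a) := by
  have h0 : b - a ≠ 0 := by linarith
  have h1 : (y b - y a) / (b - a) = elemGrad m.x y k := by
    rw [hy.eq_on' m.isPartition (h ⟨hab.le, le_rfl⟩) (h ⟨le_rfl, hab.le⟩)]; field_simp
  have h2 : Ioo a b ⊆ Ioo (m.x (k - 1)) (m.x k) := by
    have ha := h ⟨le_rfl, hab.le⟩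
    have hb := h ⟨hab.le, le_rfl⟩
    exact Ioo_subset_Ioo ha.1 hb.2
  rw [h1, integral_congr_Ioo hab.le
    (G := fun t => deriv phi (r * elemGrad m.x y k) * deriv v t) fun t ht => by
      rw [m.indicator_cont hc (h2 ht), hy.deriv_eq m.isPartition (h2 ht)],
    intervalIntegral.integral_const_mul,
    hv.integral_deriv (F := 0) (latt_isPartition hN) (by simpa using hvp)]

theorem integral_stress_atom {a b : ℝ} (hab : a ≤ b) (h : Ioo a b ⊆ m.Oa) (G : ℝ → ℝ) :
    ∫ t in a..b, m.Oaᶜ.indicator G t = 0 := by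
  rw [integral_eq_const (c := 0) hab fun t ht => indicator_of_notMem (by simpa using h ht) _,
    mul_zero]

theorem latt_add_nat (N : ℕ) (i : ℤ) (r : ℕ) :
    latt N (i + r) - latt N i = r * spacing N := by
  rw [latt_add]; push_cast; ring

/-- Bonds that do not contain a node of the continuum region do not contribute to the residual. -/
theorem bondDefect_eq_zero (hN : 0 < N) (hy : IsP1 m.x y) (hv : IsP1 (latt N) v)
    (hvp : ∀ t, v (t + 1) = v t) {i : ℤ} {r : ℕ} (hr : 0 < r)
    (h : ∀ k, m.IsContNode k → m.x k ∉ bond N i r) : m.bondDefect phi y v i r = 0 := by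
  have hlt : latt N i < latt N (i + r) := (latt_lt_latt hN).2 (by omega)
  have hs := (spacing_pos hN).ne'
  have hr' : (r : ℝ) ≠ 0 := by exact_mod_cast hr.ne'
  have e : ∀ t : ℝ, r * (t / (r * spacing N)) = t / spacing N := fun t => by field_simp
  unfold bondDefect bondDeriv
  -- In Ω_a the QC bond is the atomistic bond. In a single continuum element y is affine, and the
  -- Cauchy–Born stress of an affine function is the exact bond stress.
  rcases m.bond_cases hN hr with h1 | ⟨h1, k, hc, hk⟩ | ⟨k, hc, hk⟩
  · rw [m.bondAtomDeriv_of_eq_Ioo hlt (inter_eq_left.2 h1), m.integral_stress_atom hlt.le h1,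
      latt_add_nat, e]
    ring
  · have h2 : bond N i r ∩ m.Oa = ∅ := by
      rw [← disjoint_iff_inter_eq_empty]; exact disjoint_left.2 h1
    rw [m.bondAtomDeriv_of_eq_empty h2, m.integral_stress_cont hN hy hv hvp hc hlt hk,
      latt_add_nat, e]
    ring
  · exact absurd hk (h k hc)

/-- The contribution to the residual of a bond around a node of the continuum region. -/
theorem bondDefect_eq_nodeDefect (hN : 0 < N) (hy : IsP1 m.x y) (hyp : ∀ t, y (t + 1) = y t + F)
    (hv : IsP1 (latt N) v) (hvp : ∀ t, v (t + 1) = v t) {i k : ℤ} {r : ℕ} (hr : r ≤ 2)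
    (hc : m.IsContNode k) (hk : m.x k ∈ bond N i r) :
    m.bondDefect phi y v i r =
      nodeDefect (deriv phi) y v (spacing N) r (latt N i) (m.x k) (latt N (i + r)) := by
  have hvp' : ∀ t, v (t + 1) = v t + 0 := by simpa using hvp
  have hint := m.indicator_intervalIntegrable (G := fun t => deriv phi (r * deriv y t) * deriv v t)
    (fun t => by simp only [deriv_periodic hyp t, deriv_periodic hvp' t])
    (m.stress_integrable hN hy hv hvp r)
  have hadd := intervalIntegral.integral_add_adjacent_intervals
    (hint (latt N i) (m.x k)) (hint (m.x k) (latt N (i + r)))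
  unfold bondDefect bondDeriv nodeDefect
  rw [← hadd]
  obtain ⟨h1, h2, h3⟩ := m.bond_inter_of_contNode hN hr hk
  by_cases ha : m.IsCont k <;> by_cases hb : m.IsCont (k + 1)
  · rw [m.bondAtomDeriv_of_eq_empty (h1 ha hb),
      m.integral_stress_cont hN hy hv hvp ha hk.1 (m.Icc_subset_left hN hr ha hk),
      m.integral_stress_cont hN hy hv hvp hb hk.2 (m.Icc_subset_right hN hr hb hk)]
    ring
  · have h4 := h2 ha hb
    rw [m.bondAtomDeriv_of_eq_Ioo hk.2 h4,
      m.integral_stress_cont hN hy hv hvp ha hk.1 (m.Icc_subset_left hN hr ha hk),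
      m.integral_stress_atom hk.2.le (h4 ▸ inter_subset_right)]
    ring
  · have h4 := h3 ha hb
    rw [m.bondAtomDeriv_of_eq_Ioo hk.1 h4,
      m.integral_stress_atom hk.1.le (h4 ▸ inter_subset_right),
      m.integral_stress_cont hN hy hv hvp hb hk.2 (m.Icc_subset_right hN hr hb hk)]
    ring
  · exact absurd hc (by unfold IsContNode; tauto)

end Mesh

/-! ### The residual at a node -/

/-- The defects of the three bonds around a node, in terms of gradients. -/
theorem nodeDefect_sum {p y v : ℝ → ℝ} {ε θ L₀ L₁ s L₂ L₃ G₀ g g' G₂ e₀ e₁ e₂ : ℝ} (hε : 0 < ε)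
    (hθ : 0 ≤ θ) (hθ1 : θ < 1)
    (l0 : L₁ - L₀ = ε) (l1 : s - L₁ = θ * ε) (l2 : L₂ - s = (1 - θ) * ε) (l3 : L₃ - L₂ = ε)
    (y0 : y L₁ - y L₀ = ε * G₀) (y1 : y s - y L₁ = θ * ε * g) (y2 : y L₂ - y s = (1 - θ) * ε * g')
    (y3 : y L₃ - y L₂ = ε * G₂)
    (v0 : v L₁ - v L₀ = ε * e₀) (v1 : v s - v L₁ = θ * ε * e₁)
    (v2 : v L₂ - v s = (1 - θ) * ε * e₁) (v3 : v L₃ - v L₂ = ε * e₂) :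
    nodeDefect p y v ε 1 L₁ s L₂ + nodeDefect p y v ε 2 L₀ s L₂ + nodeDefect p y v ε 2 L₁ s L₃ =
      ε * ((p (2 * ((G₀ + θ * g) / (1 + θ))) - p (G₀ + θ * g + (1 - θ) * g')) * e₀ +
        ((θ * p g + (1 - θ) * p g' - p (θ * g + (1 - θ) * g')) +
          (θ * p (2 * ((G₀ + θ * g) / (1 + θ))) + (1 - θ) * p (2 * g') -
            p (G₀ + θ * g + (1 - θ) * g')) +
          (θ * p (2 * g) + (1 - θ) * p (2 * (((1 - θ) * g' + G₂) / (2 - θ))) -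
            p (θ * g + (1 - θ) * g' + G₂))) * e₁ +
        (p (2 * (((1 - θ) * g' + G₂) / (2 - θ))) - p (θ * g + (1 - θ) * g' + G₂)) * e₂) := by
  have n1 : 1 - θ ≠ 0 := by linarith
  have n2 : 2 - θ ≠ 0 := by linarith
  have n3 : 1 + θ ≠ 0 := by linarith
  have n4 := hε.ne'
  -- For θ = 0 the left part of the bond is empty: the stress is evaluated at the default quotient
  -- by zero, but it multiplies a vanishing increment of v.
  have q1 : ∀ r : ℝ, p (r * ((y s - y L₁) / (s - L₁))) * (v s - v L₁) =
      θ * ε * p (r * g) * e₁ := by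
    intro r
    by_cases h0 : θ = 0
    · rw [v1, h0]; ring
    · rw [y1, l1, v1, mul_div_cancel_left₀ _ (mul_ne_zero h0 n4)]; ring
  have q2 : ∀ r : ℝ, p (r * ((y L₂ - y s) / (L₂ - s))) = p (r * g') := by
    intro r
    rw [y2, l2, mul_div_cancel_left₀ _ (mul_ne_zero n1 n4)]
  have q3 : (y s - y L₀) / (s - L₀) = (G₀ + θ * g) / (1 + θ) := by
    rw [show y s - y L₀ = ε * (G₀ + θ * g) by linarith, show s - L₀ = ε * (1 + θ) by linarith,
      mul_div_mul_left _ _ n4]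
  have q4 : (y L₃ - y s) / (L₃ - s) = ((1 - θ) * g' + G₂) / (2 - θ) := by
    rw [show y L₃ - y s = ε * ((1 - θ) * g' + G₂) by linarith,
      show L₃ - s = ε * (2 - θ) by linarith, mul_div_mul_left _ _ n4]
  have q5 : (y L₂ - y L₁) / ε = θ * g + (1 - θ) * g' := by
    rw [show y L₂ - y L₁ = ε * (θ * g + (1 - θ) * g') by linarith, mul_div_cancel_left₀ _ n4]
  have q6 : (y L₂ - y L₀) / ε = G₀ + θ * g + (1 - θ) * g' := by
    rw [show y L₂ - y L₀ = ε * (G₀ + θ * g + (1 - θ) * g') by linarith, mul_div_cancel_left₀ _ n4]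
  have q7 : (y L₃ - y L₁) / ε = θ * g + (1 - θ) * g' + G₂ := by
    rw [show y L₃ - y L₁ = ε * (θ * g + (1 - θ) * g' + G₂) by linarith, mul_div_cancel_left₀ _ n4]
  unfold nodeDefect
  rw [q1, q1, q2, q2, q3, q4, q5, q6, q7, v2, show v L₂ - v L₁ = ε * e₁ by linarith,
    show v s - v L₀ = ε * (e₀ + θ * e₁) by linarith, show v L₂ - v L₀ = ε * (e₀ + e₁) by linarith,
    show v L₃ - v s = ε * ((1 - θ) * e₁ + e₂) by linarith,
    show v L₃ - v L₁ = ε * (e₁ + e₂) by linarith, one_mul, one_mul]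
  ring

theorem mul_le_amgm {a b lam : ℝ} (hl : 0 < lam) : a * b ≤ lam / 2 * a ^ 2 + b ^ 2 / (2 * lam) := by
  have h := sq_nonneg (lam * a - b)
  rw [← sub_nonneg]
  have : lam / 2 * a ^ 2 + b ^ 2 / (2 * lam) - a * b = (lam * a - b) ^ 2 / (2 * lam) := by
    field_simp; ring
  rw [this]; positivity

namespace Mesh

variable {N : ℕ} (m : Mesh N) {phi y v : ℝ → ℝ}

/-- In all three configurations the coefficients produced by `nodeDefect_sum` are the jump terms up
to sign, which squaring removes. The configurations differ in where the gradients next to the node's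
cell come from: long continuum elements, the next atomistic elements, or a lattice cell. -/
theorem nodeDefect_le (hN : 0 < N) (hy : IsP1 m.x y) (hv : IsP1 (latt N) v) {k : ℤ}
    (hc : m.IsContNode k) {lam : ℝ} (hl : 0 < lam) :
    nodeDefect (deriv phi) y v (spacing N) 1 (latt N (m.site k)) (m.x k) (latt N (m.site k + 1)) +
      nodeDefect (deriv phi) y v (spacing N) 2 (latt N (m.site k - 1)) (m.x k)
        (latt N (m.site k + 1)) +
      nodeDefect (deriv phi) y v (spacing N) 2 (latt N (m.site k)) (m.x k)
        (latt N (m.site k + 2)) ≤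
      spacing N * (lam / 2 * m.jumpSq phi y k + (elemGrad (latt N) v (m.site k) ^ 2 +
        elemGrad (latt N) v (m.site k + 1) ^ 2 + elemGrad (latt N) v (m.site k + 2) ^ 2) /
          (2 * lam)) := by
  have hε := spacing_pos hN
  set ε := spacing N with hεdef
  set c := m.site k with hcdef
  set θ := m.theta k with hθ
  have hθ0 : 0 ≤ θ := m.theta_nonneg k
  have hθ1 : θ < 1 := m.theta_lt_one k
  have hnode : m.x k = latt N c + θ * ε := m.node_eq hN k
  have hL2 : latt N (c + 1) = latt N c + ε := latt_add_one N c
  have hL3 : latt N (c + 2) = latt N c + 2 * ε := latt_add_two N c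
  have hL0 : latt N (c - 1) = latt N c - ε := latt_sub_one N c
  have hθε : θ * ε < ε := by nlinarith
  have hθε0 : 0 ≤ θ * ε := by positivity
  have v0 := sub_latt_one hN v c
  have v3 := sub_latt_one hN v (c + 2)
  rw [show c + 2 - 1 = c + 1 by ring] at v3
  have v1 := hv.eq_on' (latt_isPartition hN) (k := c + 1) (t := m.x k) (s := latt N c)
    (by rw [add_sub_cancel_right, hL2, hnode]; constructor <;> linarith)
    (by rw [add_sub_cancel_right, hL2]; constructor <;> linarith)
  have v2 := hv.eq_on' (latt_isPartition hN) (k := c + 1) (t := latt N (c + 1)) (s := m.x k)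
    (by rw [add_sub_cancel_right, hL2]; constructor <;> linarith)
    (by rw [add_sub_cancel_right, hL2, hnode]; constructor <;> linarith)
  have y1c : m.IsCont k → y (m.x k) - y (latt N c) = θ * ε * elemGrad m.x y k ∧
      y (latt N c) - y (latt N (c - 1)) = ε * elemGrad m.x y k := by
    intro h
    have hs := m.continuum_size k h
    have a1 := hy.eq_on' m.isPartition (k := k) (t := m.x k) (s := latt N c)
      ⟨by linarith, le_rfl⟩ ⟨by linarith, by linarith⟩
    have a2 := hy.eq_on' m.isPartition (k := k) (t := latt N c) (s := latt N (c - 1))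
      ⟨by linarith, by linarith⟩ ⟨by linarith, by linarith⟩
    rw [a1, a2, hL0, hnode]
    constructor <;> ring
  have y2c : m.IsCont (k + 1) →
      y (latt N (c + 1)) - y (m.x k) = (1 - θ) * ε * elemGrad m.x y (k + 1) ∧
      y (latt N (c + 2)) - y (latt N (c + 1)) = ε * elemGrad m.x y (k + 1) := by
    intro h
    have hs := m.continuum_size (k + 1) h
    rw [add_sub_cancel_right] at hs
    have a1 := hy.eq_on' m.isPartition (k := k + 1) (t := latt N (c + 1)) (s := m.x k)
      (by rw [add_sub_cancel_right]; constructor <;> linarith)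
      (by rw [add_sub_cancel_right]; constructor <;> linarith)
    have a2 := hy.eq_on' m.isPartition (k := k + 1) (t := latt N (c + 2)) (s := latt N (c + 1))
      (by rw [add_sub_cancel_right]; constructor <;> linarith)
      (by rw [add_sub_cancel_right]; constructor <;> linarith)
    rw [a1, a2, hL2, hL3, hnode]
    constructor <;> ring
  -- When the left element is atomistic and x_k is off the lattice, that element starts exactly at
  -- site ℓ_k; when x_k is a site, both sides vanish.
  have y1 : y (m.x k) - y (latt N c) = θ * ε * elemGrad m.x y k := by
    by_cases h : m.IsCont k
    · exact (y1c h).1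
    by_cases h0 : θ = 0
    · rw [hnode, h0]; simp
    · have h1 := m.right_prev hN h (hc.resolve_left h) h0
      have h2 := elemGrad_mul m.isPartition y k
      rw [h1, ← hcdef] at h2
      rw [← h2, hnode]; ring
  have y2 : y (latt N (c + 1)) - y (m.x k) = (1 - θ) * ε * elemGrad m.x y (k + 1) := by
    by_cases h : m.IsCont (k + 1)
    · exact (y2c h).1
    · have h1 := m.left_next hN (hc.resolve_right h) h
      have h2 := elemGrad_mul m.isPartition y (k + 1)
      rw [add_sub_cancel_right, h1, ← hcdef] at h2
      rw [← h2, hnode, hL2]; ring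
  have key := fun G₀ G₂ h0 h3 => nodeDefect_sum (p := deriv phi) (y := y) (v := v) (G₀ := G₀)
    (G₂ := G₂) hε hθ0 hθ1 (L₀ := latt N (c - 1)) (L₁ := latt N c) (s := m.x k)
    (L₂ := latt N (c + 1)) (L₃ := latt N (c + 2)) (by linarith) (by linarith) (by linarith)
    (by linarith) h0 y1 y2 h3 v0 (by rw [v1, hnode]; ring) (by rw [v2, hnode, hL2]; ring) v3
  have fin : ∀ A₀ A₁ A₂ e₀ e₁ e₂ : ℝ, ε * (A₀ * e₀ + A₁ * e₁ + A₂ * e₂) ≤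
      ε * (lam / 2 * (A₀ ^ 2 + A₁ ^ 2 + A₂ ^ 2) + (e₀ ^ 2 + e₁ ^ 2 + e₂ ^ 2) / (2 * lam)) := by
    intro A₀ A₁ A₂ e₀ e₁ e₂
    refine mul_le_mul_of_nonneg_left ?_ hε.le
    have := mul_le_amgm (a := A₀) (b := e₀) hl
    have := mul_le_amgm (a := A₁) (b := e₁) hl
    have := mul_le_amgm (a := A₂) (b := e₂) hl
    rw [add_div, add_div]
    linarith
  have n2 : 2 - θ ≠ 0 := by linarith
  have n3 : 1 + θ ≠ 0 := by linarith
  have r1 : ∀ g : ℝ, 2 * ((g + θ * g) / (1 + θ)) = 2 * g := fun g => by field_simp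
  have r2 : ∀ g : ℝ, 2 * (((1 - θ) * g + g) / (2 - θ)) = 2 * g := fun g => by
    field_simp; ring
  by_cases ha : m.IsCont k <;> by_cases hb : m.IsCont (k + 1)
  · rw [key _ _ (y1c ha).2 (y2c hb).2]
    refine (fin _ _ _ _ _ _).trans (le_of_eq ?_)
    rw [jumpSq, if_pos ha, if_pos hb, Fin.sum_univ_three]
    simp only [jumpInner, Matrix.cons_val_zero, Matrix.cons_val_one, Matrix.cons_val_two,
      Matrix.head_cons, Matrix.tail_cons, ← hθ]
    generalize elemGrad m.x y k = g
    generalize elemGrad m.x y (k + 1) = g'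
    rw [r1, r2, show (1 - θ) * g' + (1 + θ) * g = g + θ * g + (1 - θ) * g' by ring,
      show (2 - θ) * g' + θ * g = θ * g + (1 - θ) * g' + g' by ring,
      show (1 - θ) * g' + θ * g = θ * g + (1 - θ) * g' by ring]
    ring
  -- For θ = 0 the element T_{k+2} need not fill the next lattice cell, so its gradient may be the
  -- wrong one. This is harmless: the bond starting at x_k then has two equal stresses, and G₂
  -- cancels from every jump term.
  · have hY2 : ∃ G₂, y (latt N (c + 2)) - y (latt N (c + 1)) = ε * G₂ ∧
        (θ ≠ 0 → G₂ = elemGrad m.x y (k + 2)) := by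
      by_cases h0 : θ = 0
      · exact ⟨elemGrad (latt N) y (c + 2), by
          rw [← sub_latt_one hN, show c + 2 - 1 = c + 1 by ring], fun h => absurd h0 h⟩
      · refine ⟨elemGrad m.x y (k + 2), ?_, fun _ => rfl⟩
        have h1 := m.left_next hN ha hb
        have h2 := m.left_next_two hN ha hb h0
        have h3 := elemGrad_mul m.isPartition y (k + 2)
        rw [show k + 2 - 1 = k + 1 by ring, h1, h2, ← hcdef] at h3
        rw [← h3, hL2, hL3]; ring
    obtain ⟨G₂, hG₂, hG₂'⟩ := hY2
    rw [key _ _ (y1c ha).2 hG₂]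
    refine (fin _ _ _ _ _ _).trans (le_of_eq ?_)
    rw [jumpSq, if_pos ha, if_neg hb, Fin.sum_univ_three]
    simp only [jumpLeft, Matrix.cons_val_zero, Matrix.cons_val_one, Matrix.cons_val_two,
      Matrix.head_cons, Matrix.tail_cons, ← hθ]
    by_cases h0 : θ = 0
    · rw [h0]
      generalize elemGrad m.x y k = g
      generalize elemGrad m.x y (k + 1) = g'
      generalize elemGrad m.x y (k + 2) = g''
      have s1 : 2 * (((1 - 0) * g' + G₂) / (2 - 0)) = 0 * g + (1 - 0) * g' + G₂ := by ring
      have s2 : 2 / (2 - 0) * g'' + 2 * (1 - 0) / (2 - 0) * g' =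
        g'' + (1 - 0) * g' + 0 * g := by ring
      have s3 : 2 * ((g + 0 * g) / (1 + 0)) = 2 * g := by ring
      rw [s1, s2, s3, show (1 - 0) * g' + (1 + 0) * g = g + 0 * g + (1 - 0) * g' by ring,
        show (1 - 0) * g' + 0 * g = 0 * g + (1 - 0) * g' by ring]
      ring
    · rw [hG₂' h0]
      generalize elemGrad m.x y k = g
      generalize elemGrad m.x y (k + 1) = g'
      generalize elemGrad m.x y (k + 2) = g''
      rw [r1, show (1 - θ) * g' + (1 + θ) * g = g + θ * g + (1 - θ) * g' by ring,
        show (1 - θ) * g' + θ * g = θ * g + (1 - θ) * g' by ring,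
        show g'' + (1 - θ) * g' + θ * g = θ * g + (1 - θ) * g' + g'' by ring,
        show 2 / (2 - θ) * g'' + 2 * (1 - θ) / (2 - θ) * g' =
          2 * (((1 - θ) * g' + g'') / (2 - θ)) by field_simp; ring]
      ring
  · rw [key _ _ (sub_latt_one hN y c) (y2c hb).2]
    refine (fin _ _ _ _ _ _).trans (le_of_eq ?_)
    rw [jumpSq, if_neg ha, if_pos hb, Fin.sum_univ_three]
    simp only [jumpRight, Matrix.cons_val_zero, Matrix.cons_val_one, Matrix.cons_val_two,
      Matrix.head_cons, Matrix.tail_cons, ← hθ, ← hcdef]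
    generalize elemGrad m.x y k = g
    generalize elemGrad m.x y (k + 1) = g'
    generalize elemGrad (latt N) y c = gm
    rw [r2, show (2 - θ) * g' + θ * g = θ * g + (1 - θ) * g' + g' by ring,
      show (1 - θ) * g' + θ * g + gm = gm + θ * g + (1 - θ) * g' by ring,
      show (1 - θ) * g' + θ * g = θ * g + (1 - θ) * g' by ring,
      show 2 * θ / (1 + θ) * g + 2 / (1 + θ) * gm = 2 * ((gm + θ * g) / (1 + θ)) by
        field_simp; ring]
    ring
  · exact absurd hc (by unfold IsContNode; tauto)

end Mesh

/-! ### Summation of the bond defects over a period -/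

theorem atomDeriv_eq_sum_range {N : ℕ} (hN : 0 < N) {phi y v : ℝ → ℝ} {F : ℝ}
    (hyp : ∀ t, y (t + 1) = y t + F) (hvp : ∀ t, v (t + 1) = v t) :
    atomDeriv phi N y v = ∑ i ∈ Finset.range N,
      (deriv phi ((y (latt N (i + 1)) - y (latt N i)) / spacing N) *
        (v (latt N (i + 1)) - v (latt N i)) +
      deriv phi ((y (latt N (i + 2)) - y (latt N i)) / spacing N) *
        (v (latt N (i + 2)) - v (latt N i))) := by
  have hadd := (latt_isPartition hN).add
  unfold atomDeriv
  rw [Finset.sum_add_distrib]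
  congr 1
  · rw [sum_Icc_eq_sum_range (fun l => deriv phi ((y (latt N l) - y (latt N (l - 1))) / spacing N) *
        (v (latt N l) - v (latt N (l - 1))))]
    simp only [add_sub_cancel_right]
  · let G : ℤ → ℝ := fun l => deriv phi ((y (latt N (l + 2)) - y (latt N l)) / spacing N) *
        (v (latt N (l + 2)) - v (latt N l))
    have hper : ∀ l : ℤ, G (l + N) = G l := by
      intro l
      simp only [G, show l + (N : ℤ) + 2 = l + 2 + N by ring, hadd, hyp, hvp,
        add_sub_add_right_eq_sub]
    change _ = ∑ i ∈ Finset.range N, G i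
    rw [sum_range_periodic G N hper, ← sum_Icc_shift G N hper (-2)]
    refine Finset.sum_congr rfl fun l _ => ?_
    simp only [G, ← sub_eq_add_neg, sub_add_cancel]

theorem nodeDefect_add_one {p y v : ℝ → ℝ} {F : ℝ} (hyp : ∀ t, y (t + 1) = y t + F)
    (hvp : ∀ t, v (t + 1) = v t) (ε r L s R : ℝ) :
    nodeDefect p y v ε r (L + 1) (s + 1) (R + 1) = nodeDefect p y v ε r L s R := by
  unfold nodeDefect
  simp only [hyp, hvp, add_sub_add_right_eq_sub]

namespace Mesh

variable {N : ℕ} (m : Mesh N) {phi y v : ℝ → ℝ} {F : ℝ}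

theorem qcDeriv_sub_atomDeriv (hN : 0 < N) (hy : IsP1 m.x y) (hyp : ∀ t, y (t + 1) = y t + F)
    (hv : IsP1 (latt N) v) (hvp : ∀ t, v (t + 1) = v t) :
    m.qcDeriv phi y v - atomDeriv phi N y v =
      ∑ i ∈ Finset.range N, (m.bondDefect phi y v i 1 + m.bondDefect phi y v i 2) := by
  rw [m.qcDeriv_eq_sum_bondDeriv hN hy hyp hv hvp, atomDeriv_eq_sum_range hN hyp hvp,
    ← Finset.sum_sub_distrib]
  refine Finset.sum_congr rfl fun i _ => ?_
  unfold bondDefect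
  simp only [Nat.cast_one, Nat.cast_ofNat]
  ring

/-- The lattice cell `[c ε, (c + 1) ε)` contains a node of the continuum region. -/
def CellNode (c : ℤ) : Prop := ∃ k, m.IsContNode k ∧ m.site k = c

open Classical in
/-- The node of the continuum region in the lattice cell `[c ε, (c + 1) ε)`. -/
def cellNode (c : ℤ) : ℤ := if h : m.CellNode c then h.choose else 0

variable {m}

theorem CellNode.isContNode {c : ℤ} (h : m.CellNode c) : m.IsContNode (m.cellNode c) := by
  unfold cellNode; rw [dif_pos h]; exact h.choose_spec.1

theorem CellNode.site_eq {c : ℤ} (h : m.CellNode c) : m.site (m.cellNode c) = c := by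
  unfold cellNode; rw [dif_pos h]; exact h.choose_spec.2

theorem CellNode.le {c : ℤ} (hN : 0 < N) (h : m.CellNode c) : latt N c ≤ m.x (m.cellNode c) := by
  have := m.latt_site_le hN (m.cellNode c)
  rwa [h.site_eq] at this

theorem CellNode.lt {c : ℤ} (hN : 0 < N) (h : m.CellNode c) :
    m.x (m.cellNode c) < latt N (c + 1) := by
  have := m.lt_latt_site hN (m.cellNode c)
  rwa [h.site_eq] at this

theorem cellNode_site (hN : 0 < N) {k : ℤ} (h : m.IsContNode k) : m.cellNode (m.site k) = k := by
  have hc : m.CellNode (m.site k) := ⟨k, h, rfl⟩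
  refine m.contNode_unique (i := m.site k - 1) hc.isContNode h ⟨?_, ?_⟩ ⟨?_, ?_⟩
  · exact ((latt_lt_latt hN).2 (by omega)).trans_le (hc.le hN)
  · exact (hc.lt hN).trans_le ((latt_le_latt hN).2 (by omega))
  · exact ((latt_lt_latt hN).2 (by omega)).trans_le (m.latt_site_le hN k)
  · exact (m.lt_latt_site hN k).trans_le ((latt_le_latt hN).2 (by omega))

variable (m)

theorem cellNode_add_iff (c : ℤ) : m.CellNode (c + N) ↔ m.CellNode c := by
  constructor
  · rintro ⟨k, hk, hs⟩
    have e : k = k - m.K + m.K := by ring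
    refine ⟨k - m.K, ?_, ?_⟩
    · rwa [e, m.isContNode_add] at hk
    · rw [e, m.site_add] at hs; omega
  · rintro ⟨k, hk, hs⟩
    exact ⟨k + m.K, (m.isContNode_add k).2 hk, by rw [m.site_add, hs]⟩

theorem cellNode_add (hN : 0 < N) {c : ℤ} (h : m.CellNode c) :
    m.cellNode (c + N) = m.cellNode c + m.K := by
  have := cellNode_site hN ((m.isContNode_add _).2 h.isContNode)
  rwa [m.site_add, h.site_eq] at this

theorem bondDefect_one (hN : 0 < N) (hy : IsP1 m.x y) (hyp : ∀ t, y (t + 1) = y t + F)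
    (hv : IsP1 (latt N) v) (hvp : ∀ t, v (t + 1) = v t) (i : ℤ) :
    (m.CellNode i → m.bondDefect phi y v i 1 = nodeDefect (deriv phi) y v (spacing N) 1
      (latt N i) (m.x (m.cellNode i)) (latt N (i + 1))) ∧
    (¬ m.CellNode i → m.bondDefect phi y v i 1 = 0) := by
  refine ⟨fun h => ?_, fun h => ?_⟩
  -- A node exactly on site i is not interior to the bond. Then both sides vanish, so the formula
  -- indexed by half-open cells remains valid.
  · rcases (h.le hN).eq_or_lt with h1 | h1
    · rw [m.bondDefect_eq_zero hN hy hv hvp one_pos]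
      · unfold nodeDefect
        rw [← h1, latt_add_one, add_sub_cancel_left, one_mul, one_mul]
        ring
      · intro k hk hk'
        have hs : m.site k = i := floor_eq_of_mem hN hk'.1.le hk'.2
        rw [← hs, cellNode_site hN hk, hs] at h1
        exact hk'.1.ne h1
    · rw [m.bondDefect_eq_nodeDefect hN hy hyp hv hvp one_le_two h.isContNode ⟨h1, h.lt hN⟩]
      simp
  · refine m.bondDefect_eq_zero hN hy hv hvp one_pos fun k hk hk' => h ⟨k, hk, ?_⟩
    exact floor_eq_of_mem hN hk'.1.le hk'.2

-- At most one continuum node is interior to the bond. A node at the left endpoint yields a zero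
-- defect, so the contributions of the two half-open cells may be added without double counting.
open Classical in
theorem bondDefect_two (hN : 0 < N) (hy : IsP1 m.x y) (hyp : ∀ t, y (t + 1) = y t + F)
    (hv : IsP1 (latt N) v) (hvp : ∀ t, v (t + 1) = v t) (i : ℤ) :
    m.bondDefect phi y v i 2 =
      (if m.CellNode i then nodeDefect (deriv phi) y v (spacing N) 2
        (latt N i) (m.x (m.cellNode i)) (latt N (i + 2)) else 0) +
      (if m.CellNode (i + 1) then nodeDefect (deriv phi) y v (spacing N) 2
        (latt N i) (m.x (m.cellNode (i + 1))) (latt N (i + 2)) else 0) := by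
  have hs := (spacing_pos hN).ne'
  have hzero : m.x (m.cellNode i) = latt N i → nodeDefect (deriv phi) y v (spacing N) 2
      (latt N i) (m.x (m.cellNode i)) (latt N (i + 2)) = 0 := by
    intro h1
    unfold nodeDefect
    rw [h1, latt_add_two, add_sub_cancel_left]
    have : ∀ t : ℝ, 2 * (t / (2 * spacing N)) = t / spacing N := fun t => by field_simp
    rw [this]; ring
  by_cases ha : m.CellNode (i + 1)
  · have h1 : m.x (m.cellNode (i + 1)) ∈ bond N i 2 := by
      refine ⟨((latt_lt_latt hN).2 (by omega)).trans_le (ha.le hN), ?_⟩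
      have := ha.lt hN
      rwa [add_assoc] at this
    rw [if_pos ha, m.bondDefect_eq_nodeDefect hN hy hyp hv hvp le_rfl ha.isContNode h1]
    have h2 : (if m.CellNode i then nodeDefect (deriv phi) y v (spacing N) 2
        (latt N i) (m.x (m.cellNode i)) (latt N (i + 2)) else 0) = 0 := by
      split_ifs with hb
      · rcases (hb.le hN).eq_or_lt with h3 | h3
        · exact hzero h3.symm
        · exfalso
          have h4 : m.x (m.cellNode i) ∈ bond N i 2 :=
            ⟨h3, (hb.lt hN).trans_le ((latt_le_latt hN).2 (by simp))⟩
          have h5 := m.contNode_unique ha.isContNode hb.isContNode h1 h4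
          have h6 := ha.site_eq
          rw [h5, hb.site_eq] at h6
          omega
      · rfl
    rw [h2, zero_add]
    simp
  · rw [if_neg ha, add_zero]
    split_ifs with hb
    · rcases (hb.le hN).eq_or_lt with h3 | h3
      · rw [hzero h3.symm]
        refine m.bondDefect_eq_zero hN hy hv hvp two_pos fun k hk hk' => ?_
        by_cases h4 : m.x k < latt N (i + 1)
        · have hs : m.site k = i := floor_eq_of_mem hN hk'.1.le h4
          rw [← hs, cellNode_site hN hk, hs] at h3
          exact hk'.1.ne h3
        · exact ha ⟨k, hk, floor_eq_of_mem hN (not_lt.1 h4) (by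
            rw [add_assoc]; exact hk'.2)⟩
      · have h4 : m.x (m.cellNode i) ∈ bond N i 2 :=
          ⟨h3, (hb.lt hN).trans_le ((latt_le_latt hN).2 (by simp))⟩
        rw [m.bondDefect_eq_nodeDefect hN hy hyp hv hvp le_rfl hb.isContNode h4]
        simp
    · refine m.bondDefect_eq_zero hN hy hv hvp two_pos fun k hk hk' => ?_
      by_cases h4 : m.x k < latt N (i + 1)
      · exact hb ⟨k, hk, floor_eq_of_mem hN hk'.1.le h4⟩
      · exact ha ⟨k, hk, floor_eq_of_mem hN (not_lt.1 h4) (by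
            rw [add_assoc]; exact hk'.2)⟩

-- The node chosen in a cell determines the cell, so the chosen nodes are distinct members of one
-- period; the remaining terms are nonnegative.
open Classical in
theorem sum_jumpSq_cellNode_le (hN : 0 < N) (hyp : ∀ t, y (t + 1) = y t + F) :
    ∑ i ∈ Finset.range N, (if m.CellNode i then m.jumpSq phi y (m.cellNode i) else 0) ≤
      ∑ k ∈ Finset.Icc (1 : ℤ) m.K, m.jumpSq phi y k := by
  have h0 : (0 : ℝ) < N := by exact_mod_cast hN
  have hx0 : m.x 0 ≤ 0 := by
    have := m.x_add_K 0
    rw [zero_add] at this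
    linarith [m.last_le]
  -- The cells 0, …, N - 1 cover [0, 1), whereas the nodes x_1, …, x_K lie in (0, 1]. The index
  -- window therefore starts at the first nonnegative node, which is x_0 if it is 0 and x_1
  -- otherwise.
  obtain ⟨k₀, hk1, hk2⟩ : ∃ k₀, m.x (k₀ - 1) < 0 ∧ 0 ≤ m.x k₀ := by
    rcases hx0.eq_or_lt with h | h
    · exact ⟨0, h ▸ m.lt_node 0, h.ge⟩
    · exact ⟨1, by simpa using h, m.first_pos.le⟩
  rw [← sum_Ico_window _ m.K (m.jumpSq_add hN hyp) k₀, ← Finset.sum_filter]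
  rw [← Finset.sum_image (f := m.jumpSq phi y) (g := fun i : ℕ => m.cellNode i)]
  · refine Finset.sum_le_sum_of_subset_of_nonneg ?_ fun k _ _ => m.jumpSq_nonneg k
    intro k hk
    obtain ⟨i, hi, rfl⟩ := Finset.mem_image.1 hk
    obtain ⟨hi1, hi2⟩ := Finset.mem_filter.1 hi
    have hi3 : i < N := Finset.mem_range.1 hi1
    have a1 := hi2.le hN
    have a2 := hi2.lt hN
    have a3 : 0 ≤ latt N i := by unfold latt; positivity
    have a4 : latt N ((i : ℤ) + 1) ≤ 1 := by
      unfold latt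
      rw [div_le_one h0]
      exact_mod_cast hi3
    rw [Finset.mem_Ico]
    constructor
    · have := m.strictMono.lt_iff_lt.1 (hk1.trans_le (a3.trans a1))
      omega
    · rw [← m.strictMono.lt_iff_lt, m.x_add_K]
      linarith
  · intro i hi j hj hij
    have h1 := (Finset.mem_filter.1 hi).2.site_eq
    have h2 := (Finset.mem_filter.1 hj).2.site_eq
    simp only at hij
    rw [hij, h2] at h1
    exact_mod_cast h1.symm

open Classical in
/-- The residual of the stored energy is controlled by the jumps at the nodes. -/
theorem stored_residual_le (hN : 0 < N) (hy : IsP1 m.x y) (hyp : ∀ t, y (t + 1) = y t + F)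
    (hv : IsP1 (latt N) v) (hvp : ∀ t, v (t + 1) = v t) {lam : ℝ} (hl : 0 < lam) :
    m.qcDeriv phi y v - atomDeriv phi N y v ≤
      lam / 2 * m.estStore phi y ^ 2 + 3 * gradNormTwo N v ^ 2 / (2 * lam) := by
  have hε := spacing_pos hN
  have hE : m.estStore phi y ^ 2 = ∑ k ∈ Finset.Icc (1 : ℤ) m.K, spacing N * m.jumpSq phi y k := by
    unfold estStore
    rw [m.sum_etaStoreSq hN hyp, Real.sq_sqrt]
    exact Finset.sum_nonneg fun k _ => mul_nonneg hε.le (m.jumpSq_nonneg k)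
  have hG : gradNormTwo N v ^ 2 =
      ∑ l ∈ Finset.Icc (1 : ℤ) N, spacing N * elemGrad (latt N) v l ^ 2 := by
    unfold gradNormTwo
    rw [Real.sq_sqrt]
    exact Finset.sum_nonneg fun k _ => by positivity
  set D₁ : ℤ → ℝ := fun i => if m.CellNode i then nodeDefect (deriv phi) y v (spacing N) 1
    (latt N i) (m.x (m.cellNode i)) (latt N (i + 1)) else 0 with hD₁
  set D₂ : ℤ → ℝ := fun i => if m.CellNode i then nodeDefect (deriv phi) y v (spacing N) 2
    (latt N i) (m.x (m.cellNode i)) (latt N (i + 2)) else 0 with hD₂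
  -- Defects are attributed to the cell of the node rather than to the start of the bond: the bond
  -- starting at i - 1 with its node in cell i is charged to i.
  set D₃ : ℤ → ℝ := fun i => if m.CellNode i then nodeDefect (deriv phi) y v (spacing N) 2
    (latt N (i - 1)) (m.x (m.cellNode i)) (latt N (i + 1)) else 0 with hD₃
  have hD₃p : ∀ i, D₃ (i + N) = D₃ i := by
    intro i
    simp only [hD₃, m.cellNode_add_iff]
    split_ifs with h
    · rw [m.cellNode_add hN h, m.x_add_K, show i + (N : ℤ) - 1 = i - 1 + N by ring,
        show i + (N : ℤ) + 1 = i + 1 + N by ring, (latt_isPartition hN).add,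
        (latt_isPartition hN).add, nodeDefect_add_one hyp hvp]
    · rfl
  have h1 : ∀ i : ℤ, m.bondDefect phi y v i 1 + m.bondDefect phi y v i 2 =
      D₁ i + D₂ i + D₃ (i + 1) := by
    intro i
    rw [m.bondDefect_two hN hy hyp hv hvp]
    have h2 := m.bondDefect_one (phi := phi) hN hy hyp hv hvp i
    have h3 : m.bondDefect phi y v i 1 = D₁ i := by
      simp only [hD₁]
      split_ifs with h
      · exact h2.1 h
      · exact h2.2 h
    rw [h3, add_assoc]
    simp only [hD₂, hD₃, add_sub_cancel_right, add_assoc, one_add_one_eq_two]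
  have h2 : ∑ i ∈ Finset.range N, D₃ ((i : ℤ) + 1) = ∑ i ∈ Finset.range N, D₃ i := by
    rw [sum_range_periodic D₃ N hD₃p, sum_Icc_eq_sum_range D₃]
  have hper : ∀ l, elemGrad (latt N) v (l + N) = elemGrad (latt N) v l :=
    elemGrad_add_period (F := 0) (latt_isPartition hN) (by simpa using hvp)
  -- Each node involves three consecutive lattice gradients. Each shift sums to the full norm over a
  -- period, which is the source of the factor 3.
  have h3 : ∀ j : ℤ, ∑ i ∈ Finset.range N, spacing N * elemGrad (latt N) v (i + j) ^ 2 =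
      gradNormTwo N v ^ 2 := by
    intro j
    rw [hG, ← sum_Icc_shift (fun l => spacing N * elemGrad (latt N) v l ^ 2) N
      (fun k => by simp only [hper]) j,
      sum_range_periodic (fun l => spacing N * elemGrad (latt N) v (l + j) ^ 2) N fun k => by
        simp only [show k + (N : ℤ) + j = k + j + N by ring, hper]]
  rw [m.qcDeriv_sub_atomDeriv hN hy hyp hv hvp, Finset.sum_congr rfl fun (i : ℕ) _ => h1 i,
    Finset.sum_add_distrib, h2, ← Finset.sum_add_distrib]
  calc ∑ i ∈ Finset.range N, (D₁ i + D₂ i + D₃ i)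
      ≤ ∑ i ∈ Finset.range N, (lam / 2 * (spacing N *
          if m.CellNode i then m.jumpSq phi y (m.cellNode i) else 0) +
          (spacing N * elemGrad (latt N) v ((i : ℤ) + 0) ^ 2 +
            spacing N * elemGrad (latt N) v (i + 1) ^ 2 +
            spacing N * elemGrad (latt N) v (i + 2) ^ 2) / (2 * lam)) := by
        refine Finset.sum_le_sum fun i _ => ?_
        simp only [hD₁, hD₂, hD₃]
        split_ifs with h
        · have := m.nodeDefect_le (phi := phi) hN hy hv h.isContNode hl
          rw [h.site_eq] at this
          rw [add_zero]
          refine le_trans (le_of_eq ?_) (this.trans (le_of_eq ?_)) <;> ring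
        · rw [mul_zero, mul_zero, add_zero, add_zero, zero_add]
          positivity
    _ = lam / 2 * (spacing N * ∑ i ∈ Finset.range N,
          if m.CellNode i then m.jumpSq phi y (m.cellNode i) else 0) +
          3 * gradNormTwo N v ^ 2 / (2 * lam) := by
        rw [Finset.sum_add_distrib, ← Finset.sum_div, Finset.sum_add_distrib,
          Finset.sum_add_distrib, h3, h3, h3, ← Finset.mul_sum, ← Finset.mul_sum]
        ring
    _ ≤ _ := by
        rw [hE, ← Finset.mul_sum]
        gcongr
        exact m.sum_jumpSq_cellNode_le hN hyp

end Mesh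

/-! ### The trapezoidal rule on a subdivided interval -/

theorem sum_Icc_integral {H : ℝ → ℝ} (hH : ∀ a b, IntervalIntegrable H volume a b) (p : ℕ → ℝ)
    (L : ℕ) : ∑ i ∈ Finset.Icc 1 L, ∫ t in p (i - 1)..p i, H t = ∫ t in p 0..p L, H t := by
  induction L with
  | zero => simp
  | succ n ih =>
    rw [Finset.sum_Icc_succ_top (by omega), ih, Nat.add_sub_cancel,
      intervalIntegral.integral_add_adjacent_intervals (hH _ _) (hH _ _)]

theorem sum_Icc_telescope (X : ℕ → ℝ) (L : ℕ) :
    ∑ i ∈ Finset.Icc 1 L, (X i - X (i - 1)) = X L - X 0 := by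
  induction L with
  | zero => simp
  | succ n ih => rw [Finset.sum_Icc_succ_top (by omega), ih, Nat.add_sub_cancel]; ring

theorem sum_Icc_by_parts (α Y : ℕ → ℝ) {L : ℕ} (hL : 1 ≤ L) :
    ∑ i ∈ Finset.Icc 1 L, α i * (Y i - Y (i - 1)) =
      α L * Y L - α 1 * Y 0 - ∑ i ∈ Finset.Ico 1 L, Y i * (α (i + 1) - α i) := by
  induction L, hL using Nat.le_induction with
  | base => simp; ring
  | succ n hn ih =>
    rw [Finset.sum_Icc_succ_top (by omega), ih, Finset.sum_Ico_succ_top hn, Nat.add_sub_cancel]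
    ring

/-- The trapezoidal rule for the product of two affine functions. -/
theorem integral_mul_affine {f g : ℝ → ℝ} {a b α β : ℝ} (hab : a ≤ b)
    (hf : ∀ t ∈ Icc a b, f t = f b + α * (t - b)) (hg : ∀ t ∈ Icc a b, g t = g b + β * (t - b)) :
    ∫ t in a..b, f t * g t =
      (b - a) / 2 * (f b * g b + f a * g a) - (b - a) ^ 3 / 6 * (α * β) := by
  have h1 : ∫ t in a..b, f t * g t =
      ∫ t in a..b, (f b + α * (t - b)) * (g b + β * (t - b)) := by
    refine integral_congr_Ioo hab fun t ht => ?_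
    rw [hf t (Ioo_subset_Icc_self ht), hg t (Ioo_subset_Icc_self ht)]
  have h2 : ∀ t ∈ uIcc a b, HasDerivAt (fun t => f b * g b * t +
      (f b * β + g b * α) * ((t - b) ^ 2 / 2) + α * β * ((t - b) ^ 3 / 3))
      ((f b + α * (t - b)) * (g b + β * (t - b))) t := by
    intro t _
    have d : HasDerivAt (fun t => t - b) 1 t := (hasDerivAt_id t).sub_const b
    refine ((((hasDerivAt_id t).const_mul (f b * g b)).add
      (((d.pow 2).div_const 2).const_mul (f b * β + g b * α))).add
      (((d.pow 3).div_const 3).const_mul (α * β))).congr_deriv ?_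
    push_cast; ring
  rw [h1, intervalIntegral.integral_eq_sub_of_hasDerivAt h2
    (by apply Continuous.intervalIntegrable; fun_prop),
    hf a ⟨le_rfl, hab⟩, hg a ⟨le_rfl, hab⟩]
  ring

/-- One cell of the error representation of the trapezoidal rule on `[a, b]`. -/
theorem integral_cell_le {f w : ℝ → ℝ} {a b q s α β κ C lam : ℝ} (hqs : q ≤ s)
    (hf : ∀ t ∈ Icc q s, f t = f s + α * (t - s)) (hw : ∀ t ∈ Icc q s, w t = w s + β * (t - s))
    (hl : 0 < lam)
    (hC : ∀ t ∈ Icc q s, ((κ - (t - a) * (b - t) / 2) * α + ((a + b) / 2 - t) * f t) ^ 2 ≤ C) :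
    ∫ t in q..s, (f t * w t + κ * (α * β)) ≤
      α * ((s - a) * (b - s) / 2 * w s - (q - a) * (b - q) / 2 * w q) -
      (((a + b) / 2 - s) * (f s * w s) - ((a + b) / 2 - q) * (f q * w q)) +
      (lam / 2 * ((s - q) * C) + (s - q) * β ^ 2 / (2 * lam)) := by
  set f₁ : ℝ → ℝ := fun t => f s + α * (t - s) with hf₁
  set w₁ : ℝ → ℝ := fun t => w s + β * (t - s) with hw₁
  -- With ψ(t) = (t-a)(b-t)/2, so that ψ' = (a+b)/2 - t and ψ'' = -1, affine f and w satisfy fw +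
  -- κf'w' = (ψf'w - ψ'fw)' + ((κ - ψ)f' + ψ'f)w'.
  have h1 : ∫ t in q..s, (f t * w t + κ * (α * β)) =
      ∫ t in q..s, ((f₁ t * w₁ t + (t - a) * (b - t) / 2 * α * β - ((a + b) / 2 - t) * f₁ t * β) +
        ((κ - (t - a) * (b - t) / 2) * α + ((a + b) / 2 - t) * f₁ t) * β) := by
    refine integral_congr_Ioo hqs fun t ht => ?_
    rw [hf t (Ioo_subset_Icc_self ht), hw t (Ioo_subset_Icc_self ht)]
    ring
  have h2 : ∀ t ∈ uIcc q s, HasDerivAt (fun t => (t - a) * (b - t) / 2 * α * w₁ t -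
      ((a + b) / 2 - t) * (f₁ t * w₁ t))
      (f₁ t * w₁ t + (t - a) * (b - t) / 2 * α * β - ((a + b) / 2 - t) * f₁ t * β) t := by
    intro t _
    have df : HasDerivAt f₁ α t := by
      exact ((((hasDerivAt_id t).sub_const s).const_mul α).const_add (f s)).congr_deriv (by simp)
    have dw : HasDerivAt w₁ β t := by
      exact ((((hasDerivAt_id t).sub_const s).const_mul β).const_add (w s)).congr_deriv (by simp)
    have d1 : HasDerivAt (fun t => t - a) 1 t := (hasDerivAt_id t).sub_const a
    have d2 : HasDerivAt (fun t => b - t) (-1) t := (hasDerivAt_id t).const_sub b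
    have d3 : HasDerivAt (fun t => (a + b) / 2 - t) (-1) t := (hasDerivAt_id t).const_sub _
    refine (((((d1.mul d2).div_const 2).mul_const α).mul dw).sub
      (d3.mul (df.mul dw))).congr_deriv ?_
    simp only [Pi.mul_apply]
    ring
  have c1 : Continuous f₁ := by fun_prop
  have c2 : Continuous w₁ := by fun_prop
  rw [h1, intervalIntegral.integral_add (by apply Continuous.intervalIntegrable; fun_prop)
    (by apply Continuous.intervalIntegrable; fun_prop),
    intervalIntegral.integral_eq_sub_of_hasDerivAt h2
      (by apply Continuous.intervalIntegrable; fun_prop)]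
  have h3 : ∫ t in q..s, ((κ - (t - a) * (b - t) / 2) * α + ((a + b) / 2 - t) * f₁ t) * β ≤
      ∫ _ in q..s, (lam / 2 * C + β ^ 2 / (2 * lam)) := by
    refine intervalIntegral.integral_mono_on hqs
      (by apply Continuous.intervalIntegrable; fun_prop) intervalIntegrable_const fun t ht => ?_
    have h4 := hC t ht
    rw [hf t ht] at h4
    have h5 := mul_le_amgm (a := (κ - (t - a) * (b - t) / 2) * α + ((a + b) / 2 - t) * f₁ t)
      (b := β) hl
    have h6 := mul_le_mul_of_nonneg_left h4 (half_pos hl).le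
    linarith
  rw [intervalIntegral.integral_const, smul_eq_mul] at h3
  have e1 : f₁ s = f s := by simp [hf₁]
  have e2 : w₁ s = w s := by simp [hw₁]
  have e3 : f₁ q = f q := (hf q ⟨le_rfl, hqs⟩).symm
  have e4 : w₁ q = w q := (hw q ⟨le_rfl, hqs⟩).symm
  simp only [e1, e2, e3, e4]
  have e5 : (s - q) * (lam / 2 * C + β ^ 2 / (2 * lam)) =
    lam / 2 * ((s - q) * C) + (s - q) * β ^ 2 / (2 * lam) := by ring
  linarith

/-- Pointwise bound for the kernel of the error representation. -/
theorem kernel_sq_le {a b t z ε fz α : ℝ} (hat : a ≤ t) (htb : t ≤ b) (hε : 0 ≤ ε)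
    (hT : 2 * ε ≤ b - a) (hz : |t - z| ≤ ε) :
    ((ε ^ 2 / 6 - (t - a) * (b - t) / 2) * α + ((a + b) / 2 - t) * (fz + α * (t - z))) ^ 2 ≤
      5 / 4 * ((b - a) / 2) ^ 2 * fz ^ 2 + 45 / 64 * (b - a) ^ 4 * α ^ 2 := by
  set T := b - a with hTdef
  have b1 : |(a + b) / 2 - t| ≤ T / 2 := by rw [abs_le]; constructor <;> linarith
  -- The extreme case is negative: -T²/8 from ψ and -T²/4 from the product, where ε ≤ T/2 is used.
  have b2 : |ε ^ 2 / 6 - (t - a) * (b - t) / 2 + ((a + b) / 2 - t) * (t - z)| ≤ 3 / 8 * T ^ 2 := by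
    have h1 : |((a + b) / 2 - t) * (t - z)| ≤ T / 2 * (T / 2) := by
      rw [abs_mul]
      exact mul_le_mul b1 (by linarith) (abs_nonneg _) (by linarith)
    have h2 : 0 ≤ (t - a) * (b - t) := mul_nonneg (by linarith) (by linarith)
    have h3 : (t - a) * (b - t) ≤ T ^ 2 / 4 := by
      have := sq_nonneg ((t - a) - (b - t)); rw [hTdef]; nlinarith
    have h4 : ε ^ 2 ≤ T ^ 2 / 4 := by nlinarith
    have h5 := abs_le.1 h1
    have h6 := sq_nonneg ε
    rw [abs_le]
    constructor <;> nlinarith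
  set A := (a + b) / 2 - t
  set B := ε ^ 2 / 6 - (t - a) * (b - t) / 2 + A * (t - z) with hB
  have e : (ε ^ 2 / 6 - (t - a) * (b - t) / 2) * α + A * (fz + α * (t - z)) = A * fz + B * α := by
    rw [hB]; ring
  have hA2 : A ^ 2 ≤ (T / 2) ^ 2 := by rw [← sq_abs]; gcongr
  have hB2 : B ^ 2 ≤ (3 / 8 * T ^ 2) ^ 2 := by rw [← sq_abs]; gcongr
  have h1 : (A * fz) ^ 2 ≤ (T / 2) ^ 2 * fz ^ 2 := by rw [mul_pow]; gcongr
  have h2 : (B * α) ^ 2 ≤ (3 / 8 * T ^ 2) ^ 2 * α ^ 2 := by rw [mul_pow]; gcongr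
  rw [e]
  -- Weighted Young inequality (X + Y)² ≤ (5/4)X² + 5Y²; the second coefficient becomes 5(3/8)² =
  -- 45/64.
  have h3 := sq_nonneg (A * fz - 4 * (B * α))
  nlinarith

/-- The quadrature error on an interval `[p₀, p_L]` subdivided into cells of length at most `ε`. -/
theorem trapezoid_residual_le {f w : ℝ → ℝ} {p α β : ℕ → ℝ} {L : ℕ} {ε lam mu G : ℝ} (hL : 2 ≤ L)
    (hε : 0 ≤ ε) (hlam : 0 < lam) (hmu : 0 < mu)
    (hp : ∀ i, 1 ≤ i → i ≤ L → p (i - 1) < p i) (hp' : ∀ i, 1 ≤ i → i ≤ L → p i - p (i - 1) ≤ ε)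
    (hT : 2 * ε ≤ p L - p 0)
    (hf : ∀ i, 1 ≤ i → i ≤ L → ∀ t ∈ Icc (p (i - 1)) (p i), f t = f (p i) + α i * (t - p i))
    (hw : ∀ i, 1 ≤ i → i ≤ L → ∀ t ∈ Icc (p (i - 1)) (p i), w t = w (p i) + β i * (t - p i))
    (hG : ∀ t, w t ^ 2 ≤ G) :
    (∑ i ∈ Finset.Icc 1 L, ∫ t in p (i - 1)..p i, (f t * w t + ε ^ 2 / 6 * (α i * β i))) -
      (p L - p 0) / 2 * (f (p L) * w (p L) + f (p 0) * w (p 0)) ≤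
    lam / 2 * (5 / 2 * ((p L - p 0) / 2) ^ 2 * ∑ i ∈ Finset.Ico 1 L,
        1 / 2 * (p i - p (i - 1) + (p (i + 1) - p i)) * f (p i) ^ 2 +
      45 / 64 * (p L - p 0) ^ 4 * ∑ i ∈ Finset.Icc 1 L, (p i - p (i - 1)) * α i ^ 2) +
    (∑ i ∈ Finset.Icc 1 L, (p i - p (i - 1)) * β i ^ 2) / (2 * lam) +
    mu / 2 * (1 / 64 * (p L - p 0) ^ 4 * ∑ i ∈ Finset.Ico 1 L,
      1 / 2 * (p i - p (i - 1) + (p (i + 1) - p i)) *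
        ((α (i + 1) - α i) / (1 / 2 * (p i - p (i - 1) + (p (i + 1) - p i)))) ^ 2) +
    (p L - p 0) * G / (2 * mu) := by
  set a := p 0 with ha
  set b := p L with hb
  set T := b - a with hTdef
  have hG0 : 0 ≤ G := (sq_nonneg _).trans (hG 0)
  have hmono : ∀ i j, i ≤ j → j ≤ L → p i ≤ p j := by
    intro i j hij
    induction j, hij using Nat.le_induction with
    | base => intro _; exact le_rfl
    | succ n hn ih =>
      intro hnL
      have := hp (n + 1) (by omega) hnL
      rw [Nat.add_sub_cancel] at this
      exact (ih (by omega)).trans this.le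
  -- Only interior nodes appear in the estimator. Each cell refers f to its right endpoint, except
  -- the last cell, which uses its left one.
  set jj : ℕ → ℕ := fun i => if i < L then i else L - 1 with hjj
  have cell : ∀ i ∈ Finset.Icc 1 L,
      ∫ t in p (i - 1)..p i, (f t * w t + ε ^ 2 / 6 * (α i * β i)) ≤
      α i * ((p i - a) * (b - p i) / 2 * w (p i) -
        (p (i - 1) - a) * (b - p (i - 1)) / 2 * w (p (i - 1))) -
      (((a + b) / 2 - p i) * (f (p i) * w (p i)) -
        ((a + b) / 2 - p (i - 1)) * (f (p (i - 1)) * w (p (i - 1)))) +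
      (lam / 2 * ((p i - p (i - 1)) * (5 / 4 * (T / 2) ^ 2 * f (p (jj i)) ^ 2 +
        45 / 64 * T ^ 4 * α i ^ 2)) + (p i - p (i - 1)) * β i ^ 2 / (2 * lam)) := by
    intro i hi
    obtain ⟨h1, h2⟩ := Finset.mem_Icc.1 hi
    refine integral_cell_le (hp i h1 h2).le (hf i h1 h2) (hw i h1 h2) hlam fun t ht => ?_
    have hle := hp' i h1 h2
    have hat : a ≤ t := (hmono 0 (i - 1) (by omega) (by omega)).trans ht.1
    have htb : t ≤ b := ht.2.trans (hmono i L h2 le_rfl)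
    have hloc : f t = f (p (jj i)) + α i * (t - p (jj i)) ∧ |t - p (jj i)| ≤ ε := by
      simp only [hjj]
      split_ifs with h3
      · refine ⟨hf i h1 h2 t ht, ?_⟩
        rw [abs_le]; constructor <;> linarith [ht.1, ht.2]
      · have h4 : i = L := by omega
        subst h4
        refine ⟨?_, ?_⟩
        · rw [hf i h1 h2 t ht, hf i h1 h2 (p (i - 1)) ⟨le_rfl, (hp i h1 h2).le⟩]; ring
        · rw [abs_le]; constructor <;> linarith [ht.1, ht.2]
    rw [hloc.1]
    exact kernel_sq_le hat htb hε hT hloc.2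
  have hsum := Finset.sum_le_sum cell
  rw [Finset.sum_add_distrib, Finset.sum_sub_distrib, Finset.sum_add_distrib] at hsum
  -- The terms ψ'fw telescope to minus the trapezoidal value on [a, b]. In the terms ψf'w the weight
  -- ψ vanishes at a and b, so summation by parts leaves only jumps of f' at interior nodes.
  rw [sum_Icc_telescope (fun i => ((a + b) / 2 - p i) * (f (p i) * w (p i))),
    sum_Icc_by_parts α (fun i => (p i - a) * (b - p i) / 2 * w (p i)) (by omega),
    ← Finset.mul_sum, ← Finset.sum_div] at hsum
  simp only [← ha, ← hb, sub_self, zero_mul, mul_zero, zero_div] at hsum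
  have hparts : -∑ i ∈ Finset.Ico 1 L, (p i - a) * (b - p i) / 2 * w (p i) * (α (i + 1) - α i) ≤
      mu / 2 * (1 / 64 * T ^ 4 * ∑ i ∈ Finset.Ico 1 L,
      1 / 2 * (p i - p (i - 1) + (p (i + 1) - p i)) *
        ((α (i + 1) - α i) / (1 / 2 * (p i - p (i - 1) + (p (i + 1) - p i)))) ^ 2) +
      T * G / (2 * mu) := by
    have h1 : ∀ i ∈ Finset.Ico 1 L, -((p i - a) * (b - p i) / 2 * w (p i) * (α (i + 1) - α i)) ≤
        mu / 2 * (1 / 64 * T ^ 4 * (1 / 2 * (p i - p (i - 1) + (p (i + 1) - p i)) *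
        ((α (i + 1) - α i) / (1 / 2 * (p i - p (i - 1) + (p (i + 1) - p i)))) ^ 2)) +
        ((p (i + 1) - p (i - 1)) * (G / (4 * mu))) := by
      intro i hi
      obtain ⟨h1, h2⟩ := Finset.mem_Ico.1 hi
      have d1 := hp i h1 h2.le
      have d2 := hp (i + 1) (by omega) h2
      rw [Nat.add_sub_cancel] at d2
      set l := 1 / 2 * (p i - p (i - 1) + (p (i + 1) - p i)) with hl
      have hl0 : 0 < l := by rw [hl]; linarith
      set S := (α (i + 1) - α i) / l with hS
      have hS' : α (i + 1) - α i = l * S := by rw [hS]; field_simp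
      have e1 : 0 ≤ (p i - a) * (b - p i) :=
        mul_nonneg (sub_nonneg.2 (hmono 0 i (by omega) h2.le))
          (sub_nonneg.2 (hmono i L h2.le le_rfl))
      have e2 : (p i - a) * (b - p i) ≤ T ^ 2 / 4 := by
        have := sq_nonneg ((p i - a) - (b - p i)); rw [hTdef]; nlinarith
      set ψ := (p i - a) * (b - p i) / 2 with hψ
      have e3 : ψ ^ 2 ≤ 1 / 64 * T ^ 4 := by
        have : ψ ^ 2 ≤ (T ^ 2 / 8) ^ 2 := by
          apply pow_le_pow_left₀ <;> linarith
        nlinarith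
      have e4 := mul_le_amgm (a := ψ * S) (b := -w (p i)) hmu
      have e5 : (ψ * S) ^ 2 ≤ 1 / 64 * T ^ 4 * S ^ 2 := by
        rw [mul_pow]; gcongr
      have e6 : (-w (p i)) ^ 2 / (2 * mu) ≤ G / (2 * mu) := by
        rw [neg_sq]; gcongr; exact hG _
      have e7 : -(ψ * w (p i) * (α (i + 1) - α i)) = l * (ψ * S * -w (p i)) := by
        rw [hS']; ring
      have e8 : p (i + 1) - p (i - 1) = 2 * l := by rw [hl]; ring
      rw [e7, e8]
      have e9 : ψ * S * -w (p i) ≤ mu / 2 * (1 / 64 * T ^ 4 * S ^ 2) + G / (2 * mu) := by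
        have := mul_le_mul_of_nonneg_left e5 (half_pos hmu).le
        linarith
      refine (mul_le_mul_of_nonneg_left e9 hl0.le).trans (le_of_eq ?_)
      field_simp; ring
    have h2 := Finset.sum_le_sum h1
    rw [Finset.sum_neg_distrib, Finset.sum_add_distrib, ← Finset.mul_sum, ← Finset.mul_sum,
      ← Finset.sum_mul] at h2
    -- The intervals around the interior nodes cover each cell at most twice.
    have h3 : ∑ i ∈ Finset.Ico 1 L, (p (i + 1) - p (i - 1)) ≤ 2 * T := by
      have h4 : ∀ n, 1 ≤ n → n ≤ L → ∑ i ∈ Finset.Ico 1 n, (p (i + 1) - p (i - 1)) =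
          p n + p (n - 1) - p 1 - p 0 := by
        intro n hn
        induction n, hn using Nat.le_induction with
        | base => intro _; simp
        | succ n hn ih =>
          intro hnL
          rw [Finset.sum_Ico_succ_top hn, ih (by omega), Nat.add_sub_cancel]; ring
      rw [h4 L (by omega) le_rfl]
      have := hmono (L - 1) L (by omega) le_rfl
      have := hmono 0 1 (by omega) (by omega)
      linarith
    have h5 : (∑ i ∈ Finset.Ico 1 L, (p (i + 1) - p (i - 1))) * (G / (4 * mu)) ≤
        T * G / (2 * mu) := by
      calc _ ≤ 2 * T * (G / (4 * mu)) := by gcongr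
        _ = _ := by field_simp; ring
    linarith
  have hf2 : ∑ i ∈ Finset.Icc 1 L, (p i - p (i - 1)) * (5 / 4 * (T / 2) ^ 2 * f (p (jj i)) ^ 2 +
      45 / 64 * T ^ 4 * α i ^ 2) ≤ 5 / 2 * (T / 2) ^ 2 * ∑ i ∈ Finset.Ico 1 L,
        1 / 2 * (p i - p (i - 1) + (p (i + 1) - p i)) * f (p i) ^ 2 +
      45 / 64 * T ^ 4 * ∑ i ∈ Finset.Icc 1 L, (p i - p (i - 1)) * α i ^ 2 := by
    have h1 : ∑ i ∈ Finset.Icc 1 L, (p i - p (i - 1)) * (5 / 4 * (T / 2) ^ 2 * f (p (jj i)) ^ 2 +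
        45 / 64 * T ^ 4 * α i ^ 2) =
        5 / 4 * (T / 2) ^ 2 * ∑ i ∈ Finset.Icc 1 L, (p i - p (i - 1)) * f (p (jj i)) ^ 2 +
        45 / 64 * T ^ 4 * ∑ i ∈ Finset.Icc 1 L, (p i - p (i - 1)) * α i ^ 2 := by
      rw [Finset.mul_sum, Finset.mul_sum, ← Finset.sum_add_distrib]
      exact Finset.sum_congr rfl fun i _ => by ring
    -- An interior node receives at most its two adjacent cells, that is, twice the averaged length;
    -- this doubles 5/4 to 5/2.
    have h2 : ∑ i ∈ Finset.Icc 1 L, (p i - p (i - 1)) * f (p (jj i)) ^ 2 ≤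
        2 * ∑ i ∈ Finset.Ico 1 L,
          1 / 2 * (p i - p (i - 1) + (p (i + 1) - p i)) * f (p i) ^ 2 := by
      obtain ⟨n, rfl⟩ : ∃ n, L = n + 1 + 1 := ⟨L - 2, by omega⟩
      rw [Finset.sum_Icc_succ_top (by omega), Finset.sum_Icc_succ_top (by omega),
        Finset.sum_Ico_succ_top (by omega), mul_add, Finset.mul_sum]
      have h3 : ∑ i ∈ Finset.Icc 1 n, (p i - p (i - 1)) * f (p (jj i)) ^ 2 ≤
          ∑ i ∈ Finset.Ico 1 (n + 1),
            2 * (1 / 2 * (p i - p (i - 1) + (p (i + 1) - p i)) * f (p i) ^ 2) := by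
        have : Finset.Icc 1 n = Finset.Ico 1 (n + 1) := by
          ext i; simp only [Finset.mem_Icc, Finset.mem_Ico]; omega
        rw [this]
        refine Finset.sum_le_sum fun i hi => ?_
        obtain ⟨h4, h5⟩ := Finset.mem_Ico.1 hi
        have h6 : jj i = i := by simp only [hjj]; rw [if_pos (by omega)]
        have d2 := hp (i + 1) (by omega) (by omega)
        rw [Nat.add_sub_cancel] at d2
        rw [h6]
        nlinarith [sq_nonneg (f (p i))]
      have h4 : jj (n + 1) = n + 1 := by simp only [hjj]; rw [if_pos (by omega)]
      have h5 : jj (n + 1 + 1) = n + 1 := by simp only [hjj]; rw [if_neg (by omega)]; omega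
      rw [h4, h5]
      simp only [Nat.add_sub_cancel]
      linarith
    rw [h1]
    have := mul_le_mul_of_nonneg_left h2 (show 0 ≤ 5 / 4 * (T / 2) ^ 2 by positivity)
    linarith
  have hfin := mul_le_mul_of_nonneg_left hf2 (half_pos hlam).le
  have etrap : ((a + b) / 2 - b) * (f b * w b) - ((a + b) / 2 - a) * (f a * w a) =
      -(T / 2 * (f b * w b + f a * w a)) := by rw [hTdef]; ring
  linarith

namespace Mesh

variable {N : ℕ} (m : Mesh N) {f w : ℝ → ℝ}

/-! ### The common refinement -/

theorem floor_lt_ceil (hN : 0 < N) (k : ℤ) : ⌊N * m.x (k - 1)⌋ < ⌈N * m.x k⌉ := by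
  have h0 : (0 : ℝ) < N := by exact_mod_cast hN
  have h1 : (N : ℝ) * m.x (k - 1) < N * m.x k := by gcongr; exact m.lt_node k
  have : ((⌊N * m.x (k - 1)⌋ : ℤ) : ℝ) < (⌈N * m.x k⌉ : ℤ) :=
    (Int.floor_le _).trans_lt (h1.trans_le (Int.le_ceil _))
  exact_mod_cast this

theorem site_add_numSub (hN : 0 < N) (k : ℤ) :
    m.site (k - 1) + m.numSub k = ⌈N * m.x k⌉ := by
  have := m.floor_lt_ceil hN k
  unfold numSub site
  omega

theorem numSub_pos (hN : 0 < N) (k : ℤ) : 1 ≤ m.numSub k := by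
  have := m.floor_lt_ceil hN k
  unfold numSub
  omega

theorem le_latt_ceil (hN : 0 < N) (t : ℝ) : t ≤ latt N ⌈N * t⌉ := by
  have h0 : (0 : ℝ) < N := by exact_mod_cast hN
  unfold latt; rw [le_div_iff₀ h0]; linarith [Int.le_ceil (N * t)]

theorem latt_ceil_lt (hN : 0 < N) (t : ℝ) : latt N (⌈N * t⌉ - 1) < t := by
  have h0 : (0 : ℝ) < N := by exact_mod_cast hN
  unfold latt; rw [div_lt_iff₀ h0]; push_cast; linarith [Int.ceil_lt_add_one (N * t)]

theorem subNode_zero (k : ℤ) : m.subNode k 0 = m.x (k - 1) := by simp [subNode]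

theorem subNode_numSub (hN : 0 < N) (k : ℤ) : m.subNode k (m.numSub k) = m.x k := by
  have := m.numSub_pos hN k
  unfold subNode
  rw [if_neg (by omega), if_pos le_rfl]

theorem subNode_mid {k : ℤ} {i : ℕ} (h : 0 < i) (h' : i < m.numSub k) :
    m.subNode k i = latt N (m.site (k - 1) + i) := by
  unfold subNode
  rw [if_neg (by omega), if_neg (by omega)]; rfl

theorem latt_le_subNode (hN : 0 < N) {k : ℤ} {i : ℕ} (h : i < m.numSub k) :
    latt N (m.site (k - 1) + i) ≤ m.subNode k i := by
  rcases Nat.eq_zero_or_pos i with rfl | h0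
  · rw [m.subNode_zero]; simpa using m.latt_site_le hN (k - 1)
  · rw [m.subNode_mid h0 h]

theorem subNode_le_latt (hN : 0 < N) {k : ℤ} {i : ℕ} (h : 0 < i) (h' : i ≤ m.numSub k) :
    m.subNode k i ≤ latt N (m.site (k - 1) + i) := by
  rcases h'.eq_or_lt with rfl | h0
  · rw [m.subNode_numSub hN, m.site_add_numSub hN]; exact le_latt_ceil hN _
  · rw [m.subNode_mid h h0]

theorem subNode_lt (hN : 0 < N) {k : ℤ} {i : ℕ} (h : 1 ≤ i) (h' : i ≤ m.numSub k) :
    m.subNode k (i - 1) < m.subNode k i := by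
  have e : m.site (k - 1) + ((i - 1 : ℕ) : ℤ) = m.site (k - 1) + i - 1 := by
    rw [Nat.cast_sub h]; push_cast; ring
  rcases h'.eq_or_lt with rfl | h0
  · rw [m.subNode_numSub hN]
    rcases h.eq_or_lt with h1 | h1
    · rw [← h1, Nat.sub_self, m.subNode_zero]; exact m.lt_node k
    · rw [m.subNode_mid (by omega) (by omega), e, m.site_add_numSub hN]
      exact latt_ceil_lt hN _
  · rw [m.subNode_mid (by omega) h0]
    rcases h.eq_or_lt with h1 | h1
    · rw [← h1, Nat.sub_self, m.subNode_zero]; simpa using m.lt_latt_site hN (k - 1)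
    · rw [m.subNode_mid (by omega) (by omega), latt_lt_latt hN]; omega

/-- Cells of the refinement do not straddle lattice sites, so functions that are affine on lattice
cells are affine on them too. -/
theorem subNode_Icc (hN : 0 < N) {k : ℤ} {i : ℕ} (h : 1 ≤ i) (h' : i ≤ m.numSub k) :
    Icc (m.subNode k (i - 1)) (m.subNode k i) ⊆
      Icc (latt N (m.site (k - 1) + i - 1)) (latt N (m.site (k - 1) + i)) := by
  have e : m.site (k - 1) + ((i - 1 : ℕ) : ℤ) = m.site (k - 1) + i - 1 := by
    rw [Nat.cast_sub h]; push_cast; ring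
  exact Icc_subset_Icc (e ▸ m.latt_le_subNode hN (by omega)) (m.subNode_le_latt hN h h')

theorem subLen_pos (hN : 0 < N) {k : ℤ} {i : ℕ} (h : 1 ≤ i) (h' : i ≤ m.numSub k) :
    0 < m.subLen k i := sub_pos.2 (m.subNode_lt hN h h')

theorem subLen_le (hN : 0 < N) {k : ℤ} {i : ℕ} (h : 1 ≤ i) (h' : i ≤ m.numSub k) :
    m.subLen k i ≤ spacing N := by
  have h1 := m.subNode_Icc hN h h' ⟨le_rfl, (m.subNode_lt hN h h').le⟩
  have h2 := m.subNode_Icc hN h h' ⟨(m.subNode_lt hN h h').le, le_rfl⟩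
  have := latt_sub_one N (m.site (k - 1) + i)
  unfold subLen
  linarith [h1.1, h2.2]

theorem subGrad_eq (hN : 0 < N) (hf : IsP1 (latt N) f) {k : ℤ} {i : ℕ} (h : 1 ≤ i)
    (h' : i ≤ m.numSub k) : m.subGrad f k i = elemGrad (latt N) f (m.site (k - 1) + i) := by
  have h0 := m.subNode_lt hN h h'
  have h3 := m.subLen_pos hN h h'
  unfold subGrad
  rw [hf.eq_on' (latt_isPartition hN) (m.subNode_Icc hN h h' ⟨h0.le, le_rfl⟩)
    (m.subNode_Icc hN h h' ⟨le_rfl, h0.le⟩)]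
  unfold subLen at *
  field_simp

theorem eq_on_sub (hN : 0 < N) (hf : IsP1 (latt N) f) {k : ℤ} {i : ℕ} (h : 1 ≤ i)
    (h' : i ≤ m.numSub k) {t : ℝ} (ht : t ∈ Icc (m.subNode k (i - 1)) (m.subNode k i)) :
    f t = f (m.subNode k i) + m.subGrad f k i * (t - m.subNode k i) := by
  have h0 := m.subNode_lt hN h h'
  have := hf.eq_on' (latt_isPartition hN) (m.subNode_Icc hN h h' ht)
    (m.subNode_Icc hN h h' ⟨h0.le, le_rfl⟩)
  rw [m.subGrad_eq hN hf h h']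
  linarith

theorem deriv_on_sub (hN : 0 < N) (hf : IsP1 (latt N) f) {k : ℤ} {i : ℕ} (h : 1 ≤ i)
    (h' : i ≤ m.numSub k) {t : ℝ} (ht : t ∈ Ioo (m.subNode k (i - 1)) (m.subNode k i)) :
    deriv f t = m.subGrad f k i := by
  have h0 := m.subNode_lt hN h h'
  have h1 := m.subNode_Icc hN h h' ⟨le_rfl, h0.le⟩
  have h2 := m.subNode_Icc hN h h' ⟨h0.le, le_rfl⟩
  rw [m.subGrad_eq hN hf h h']
  exact hf.deriv_eq (latt_isPartition hN) ⟨h1.1.trans_lt ht.1, ht.2.trans_le h2.2⟩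

theorem length_le (hN : 0 < N) (k : ℤ) : m.x k - m.x (k - 1) ≤ m.numSub k * spacing N := by
  have h1 := le_latt_ceil hN (m.x k)
  have h2 := m.latt_site_le hN (k - 1)
  have h3 := latt_add_nat N (m.site (k - 1)) (m.numSub k)
  rw [m.site_add_numSub hN] at h3
  linarith

theorem two_le_numSub (hN : 0 < N) {k : ℤ} (h : m.IsCont k) : 2 ≤ m.numSub k := by
  have h1 := m.continuum_size k h
  have h2 := h1.trans (m.length_le hN k)
  have := le_of_mul_le_mul_right h2 (spacing_pos hN)
  exact_mod_cast this

/-- The refinement cells cover T_k and have length at most ε, so |T_k| ≤ Lε and the estimator weight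
dominates the true length. -/
theorem sq_le_hHat (hN : 0 < N) (k : ℤ) : (m.x k - m.x (k - 1)) ^ 2 ≤ m.hHat k ^ 2 := by
  have hε := spacing_pos hN
  have h0 : 0 < m.x k - m.x (k - 1) := sub_pos.2 (m.lt_node k)
  have h1 := m.length_le hN k
  have h2 : m.x k - m.x (k - 1) ≤ (m.numSub k + 1) * spacing N := by linarith
  unfold hHat
  rw [Real.sq_sqrt (by positivity), le_div_iff₀ h0, mul_comm]
  gcongr

theorem one_le_numNodes (hN : 0 < N) : 1 ≤ m.numNodes * spacing N := by
  classical
  have h0 : (0 : ℝ) < N := by exact_mod_cast hN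
  have h1 : N ≤ m.numNodes := by
    calc N = ((Finset.Icc (1 : ℤ) N).image (latt N)).card := by
          rw [Finset.card_image_of_injective _ (latt_isPartition hN).mono.injective]; simp
      _ ≤ m.numNodes := by
          unfold numNodes
          refine Finset.card_le_card fun t ht => ?_
          simp only [Finset.mem_union, Finset.mem_image] at ht ⊢
          exact Or.inl ht
  have h2 : (N : ℝ) ≤ m.numNodes := by exact_mod_cast h1
  unfold spacing
  rw [mul_one_div, le_div_iff₀ h0, one_mul]
  exact h2

/-! ### The pairings as integrals -/

variable (N) in
/-- The integrand whose integral over a period is the atomistic pairing. -/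
def pairingDensity (f w : ℝ → ℝ) (t : ℝ) : ℝ :=
  f t * w t + spacing N ^ 2 / 6 * (deriv f t * deriv w t)

theorem pairingDensity_periodic (hf : ∀ t, f (t + 1) = f t) (hw : ∀ t, w (t + 1) = w t) :
    Function.Periodic (pairingDensity N f w) 1 := by
  intro t
  unfold pairingDensity
  rw [hf, hw, deriv_periodic (F := 0) (by simpa using hf) t,
    deriv_periodic (F := 0) (by simpa using hw) t]

theorem pairingDensity_integrable (hN : 0 < N) (hf : IsP1 (latt N) f) (hw : IsP1 (latt N) w)
    (hfp : ∀ t, f (t + 1) = f t) (hwp : ∀ t, w (t + 1) = w t) (a b : ℝ) :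
    IntervalIntegrable (pairingDensity N f w) volume a b := by
  have hx := latt_isPartition hN
  refine hx.intervalIntegrable (pairingDensity_periodic hfp hwp) (fun k => ?_) a b
  refine intervalIntegrable_of_eq_Ioo (hx.lt_node k).le (G := fun t => f t * w t +
    spacing N ^ 2 / 6 * (elemGrad (latt N) f k * elemGrad (latt N) w k)) ?_ fun t ht => ?_
  · exact ((hf.1.mul hw.1).add continuous_const).intervalIntegrable _ _
  · unfold pairingDensity
    rw [hf.deriv_eq hx ht, hw.deriv_eq hx ht]

/-- The term ε²f'w'/6 competes with the trapezoidal error -h³f'w'/6 of the product. On a full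
lattice cell, h = ε, they cancel; on a truncated cell the remaining defect is explicit. -/
theorem integral_pairingDensity_of_affine {a b α β : ℝ} (hab : a ≤ b)
    (hf : ∀ t ∈ Icc a b, f t = f b + α * (t - b)) (hw : ∀ t ∈ Icc a b, w t = w b + β * (t - b))
    (hf' : ∀ t ∈ Ioo a b, deriv f t = α) (hw' : ∀ t ∈ Ioo a b, deriv w t = β)
    (hfc : Continuous f) (hwc : Continuous w) :
    ∫ t in a..b, pairingDensity N f w t = (b - a) / 2 * (f b * w b + f a * w a) +
      (b - a) * ((spacing N ^ 2 - (b - a) ^ 2) / 6) * (α * β) := by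
  have hi : IntervalIntegrable (fun t => f t * w t) volume a b :=
    (hfc.mul hwc).intervalIntegrable _ _
  rw [integral_congr_Ioo hab (G := fun t => f t * w t + spacing N ^ 2 / 6 * (α * β))
    fun t ht => by unfold pairingDensity; rw [hf' t ht, hw' t ht],
    intervalIntegral.integral_add hi intervalIntegrable_const,
    integral_mul_affine hab hf hw, intervalIntegral.integral_const, smul_eq_mul]
  ring

theorem atomPairing_eq_integral (hN : 0 < N) (hf : IsP1 (latt N) f) (hw : IsP1 (latt N) w)
    (hfp : ∀ t, f (t + 1) = f t) (hwp : ∀ t, w (t + 1) = w t) :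
    atomPairing N f w = ∫ t in (0 : ℝ)..1, pairingDensity N f w t := by
  have hx := latt_isPartition hN
  rw [hx.integral_eq_sum (pairingDensity_periodic hfp hwp)
    fun k => pairingDensity_integrable hN hf hw hfp hwp _ _]
  have h1 : ∀ k, ∫ t in latt N (k - 1)..latt N k, pairingDensity N f w t =
      spacing N / 2 * (f (latt N k) * w (latt N k)) +
        spacing N / 2 * (f (latt N (k + -1)) * w (latt N (k + -1))) := by
    intro k
    rw [integral_pairingDensity_of_affine (hx.lt_node k).le (fun t ht => hf.eq_on hx ht)
      (fun t ht => hw.eq_on hx ht) (fun t ht => hf.deriv_eq hx ht) (fun t ht => hw.deriv_eq hx ht)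
      hf.1 hw.1, latt_sub_one, sub_sub_cancel, ← sub_eq_add_neg k 1, latt_sub_one]
    ring
  rw [Finset.sum_congr rfl fun k _ => h1 k, Finset.sum_add_distrib,
    sum_Icc_shift (fun k => spacing N / 2 * (f (latt N k) * w (latt N k))) N (fun k => by
      simp only [hx.add, hfp, hwp]) (-1), ← Finset.sum_add_distrib]
  unfold atomPairing
  exact Finset.sum_congr rfl fun k _ => by ring

theorem qcPairing_eq_sum (hfp : ∀ t, f (t + 1) = f t) (hwp : ∀ t, w (t + 1) = w t) :
    m.qcPairing f w = ∑ k ∈ Finset.Icc (1 : ℤ) m.K, (m.x k - m.x (k - 1)) / 2 *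
      (f (m.x k) * w (m.x k) + f (m.x (k - 1)) * w (m.x (k - 1))) := by
  have h1 := sum_Icc_shift (fun k => (m.x (k + 1) - m.x k) / 2 * (f (m.x k) * w (m.x k))) m.K
    (fun k => by
      simp only [show k + (m.K : ℤ) + 1 = k + 1 + m.K by ring, m.x_add_K, hfp, hwp,
        add_sub_add_right_eq_sub]) (-1)
  simp only [← sub_eq_add_neg, sub_add_cancel] at h1
  simp only [mul_add]
  rw [Finset.sum_add_distrib, h1, ← Finset.sum_add_distrib]
  unfold qcPairing
  exact Finset.sum_congr rfl fun k _ => by ring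

/-! ### The residual of the external forces -/

/-- The part of the external force indicator that involves first differences. -/
def gradTerm (f : ℝ → ℝ) (k : ℤ) : ℝ :=
  m.hHat k ^ 4 * ∑ i ∈ Finset.Icc 1 (m.numSub k), m.subLen k i * m.subGrad f k i ^ 2

theorem gradTerm_nonneg (hN : 0 < N) (f : ℝ → ℝ) (k : ℤ) : 0 ≤ m.gradTerm f k := by
  refine mul_nonneg (by positivity) (Finset.sum_nonneg fun i hi => ?_)
  obtain ⟨h1, h2⟩ := Finset.mem_Icc.1 hi
  exact mul_nonneg (m.subLen_pos hN h1 h2).le (sq_nonneg _)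

/-- A single refinement cell already contributes to the sum, and its weight dominates ε⁴ because
|T_k| ≥ 2ε on a continuum element. -/
theorem gradTerm_ge (hN : 0 < N) (f : ℝ → ℝ) {k : ℤ} (hc : m.IsCont k) {i : ℕ} (h : 1 ≤ i)
    (h' : i ≤ m.numSub k) :
    spacing N ^ 4 * (m.subLen k i * m.subGrad f k i ^ 2) ≤ m.gradTerm f k := by
  have hε := spacing_pos hN
  have h1 : spacing N ^ 2 ≤ m.hHat k ^ 2 := by
    refine le_trans ?_ (m.sq_le_hHat hN k)
    have := m.continuum_size k hc
    gcongr; linarith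
  have h2 : spacing N ^ 4 ≤ m.hHat k ^ 4 := by
    have := pow_le_pow_left₀ (by positivity) h1 2
    nlinarith
  have hpos : ∀ j ∈ Finset.Icc 1 (m.numSub k), 0 ≤ m.subLen k j * m.subGrad f k j ^ 2 := by
    intro j hj
    obtain ⟨h1, h2⟩ := Finset.mem_Icc.1 hj
    exact mul_nonneg (m.subLen_pos hN h1 h2).le (sq_nonneg _)
  unfold gradTerm
  exact mul_le_mul h2 (Finset.single_le_sum hpos (Finset.mem_Icc.2 ⟨h, h'⟩))
    (hpos i (Finset.mem_Icc.2 ⟨h, h'⟩)) (by positivity)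

theorem numSub_add (k : ℤ) : m.numSub (k + m.K) = m.numSub k := by
  unfold numSub
  rw [show k + (m.K : ℤ) - 1 = k - 1 + m.K by ring, m.x_add_K, m.x_add_K, mul_add, mul_add, mul_one,
    ← Int.cast_natCast (R := ℝ) N, Int.floor_add_intCast, Int.ceil_add_intCast]
  congr 1; ring

theorem subNode_add (hN : 0 < N) (k : ℤ) (i : ℕ) :
    m.subNode (k + m.K) i = m.subNode k i + 1 := by
  have e : ⌊N * m.x (k + m.K - 1)⌋ = ⌊N * m.x (k - 1)⌋ + N := by
    have := m.site_add (k - 1)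
    unfold site at this
    rwa [show k - 1 + (m.K : ℤ) = k + m.K - 1 by ring] at this
  unfold subNode
  rw [m.numSub_add, e, show k + (m.K : ℤ) - 1 = k - 1 + m.K by ring, m.x_add_K, m.x_add_K]
  split_ifs
  · rfl
  · rfl
  · rw [show ⌊N * m.x (k - 1)⌋ + (N : ℤ) + i = ⌊N * m.x (k - 1)⌋ + i + N by ring,
      (latt_isPartition hN).add]

theorem gradTerm_add (hN : 0 < N) (hfp : ∀ t, f (t + 1) = f t) (k : ℤ) :
    m.gradTerm f (k + m.K) = m.gradTerm f k := by
  have h1 : m.hHat (k + m.K) = m.hHat k := by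
    unfold hHat
    rw [m.numSub_add, show k + (m.K : ℤ) - 1 = k - 1 + m.K by ring, m.x_add_K, m.x_add_K,
      add_sub_add_right_eq_sub]
  have h2 : ∀ i, m.subLen (k + m.K) i = m.subLen k i := by
    intro i
    unfold subLen
    rw [m.subNode_add hN, m.subNode_add hN, add_sub_add_right_eq_sub]
  have h3 : ∀ i, m.subGrad f (k + m.K) i = m.subGrad f k i := by
    intro i
    unfold subGrad
    rw [h2, m.subNode_add hN, m.subNode_add hN, hfp, hfp]
  unfold gradTerm
  simp only [h1, h2, h3, m.numSub_add]

/-- The factorization ε² - T² = s(ε + T) ≤ 2sε shows that the defect is small with the missing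
length s; the bound keeps one factor s, to be matched with the length of the neighbouring refinement
cell. -/
theorem sq_defect_le {T s ε : ℝ} (hT : 0 ≤ T) (hs : 0 ≤ s) (h : T + s = ε) :
    T * ((ε ^ 2 - T ^ 2) / 6) ^ 2 ≤ 1 / 9 * (ε ^ 4 * s) := by
  have h1 : ε ^ 2 - T ^ 2 = s * (ε + T) := by rw [← h]; ring
  have h2 : s * (ε + T) ≤ 2 * (s * ε) := by nlinarith
  have h3 : 0 ≤ s * (ε + T) := mul_nonneg hs (by linarith)
  have h4 : ((ε ^ 2 - T ^ 2) / 6) ^ 2 ≤ (2 * (s * ε) / 6) ^ 2 := by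
    rw [h1]; gcongr
  have h5 : T ≤ ε := by linarith
  have h6 : s ≤ ε := by linarith
  have hε : 0 ≤ ε := by linarith
  calc T * ((ε ^ 2 - T ^ 2) / 6) ^ 2 ≤ ε * (2 * (s * ε) / 6) ^ 2 := by gcongr
    _ = 1 / 9 * (ε ^ 3 * s * s) := by ring
    _ ≤ 1 / 9 * (ε ^ 3 * s * ε) := by gcongr
    _ = _ := by ring

theorem node_mem_Oa_of_not_isContNode {k : ℤ} (h : ¬ m.IsContNode k) : m.x k ∈ m.Oa := by
  have h' := h
  unfold IsContNode at h'
  rw [not_or] at h'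
  by_contra hc
  have hf : m.x k ∈ frontier m.Oaᶜ := by
    rw [m.mem_frontier]
    refine ⟨hc, fun hi => ?_⟩
    have h1 := m.Ioo_subset_of_not_isCont h'.1
    have h2 : m.x k ∈ closure (Ioo (m.x (k - 1)) (m.x k)) := by
      rw [closure_Ioo (m.lt_node k).ne]; exact ⟨(m.lt_node k).le, le_rfl⟩
    obtain ⟨t, ht, ht'⟩ := mem_closure_iff.1 h2 _ isOpen_interior hi
    exact interior_subset ht (h1 ht')
  obtain ⟨j, hj, hj'⟩ := m.exists_contNode_of_frontier hf
  rw [m.strictMono.injective hj] at hj'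
  exact h hj'

theorem theta_eq_zero_of_eq (hN : 0 < N) {k l : ℤ} (h : m.x k = latt N l) : m.theta k = 0 := by
  have h0 : (0 : ℝ) < N := by exact_mod_cast hN
  unfold theta
  rw [h]
  unfold latt
  rw [mul_div_cancel₀ _ h0.ne', Int.fract_intCast]

open Classical in
/-- The quadrature error on an element of the atomistic region is controlled by the indicators of
the adjacent continuum elements. -/
theorem atom_defect_le (hN : 0 < N) (hf : IsP1 (latt N) f) {k : ℤ} (h : ¬ m.IsCont k) :
    (m.x k - m.x (k - 1)) * ((spacing N ^ 2 - (m.x k - m.x (k - 1)) ^ 2) / 6) ^ 2 *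
      elemGrad (latt N) f (m.site (k - 1) + 1) ^ 2 ≤
    1 / 9 * ((if m.IsCont (k - 1) then m.gradTerm f (k - 1) else 0) +
      if m.IsCont (k + 1) then m.gradTerm f (k + 1) else 0) := by
  have hε := spacing_pos hN
  have hR : 0 ≤ (if m.IsCont (k - 1) then m.gradTerm f (k - 1) else 0) ∧
      0 ≤ (if m.IsCont (k + 1) then m.gradTerm f (k + 1) else 0) := by
    constructor <;> split_ifs <;> first | exact m.gradTerm_nonneg hN f _ | exact le_rfl
  have hT : 0 < m.x k - m.x (k - 1) := sub_pos.2 (m.lt_node k)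
  have hle := m.le_latt_of_not_isCont hN h
  have hnode := m.node_eq hN (k - 1)
  have hθ := m.theta_nonneg (k - 1)
  have hθ1 := m.theta_lt_one (k - 1)
  set α := elemGrad (latt N) f (m.site (k - 1) + 1) with hα
  have hsucc : k - 1 + 1 = k := by ring
  -- If the left neighbour is continuum, x_k is the next lattice site. The missing part of the
  -- lattice cell is then the last refinement cell of T_{k-1}, where f has the same slope.
  by_cases hl : m.IsCont (k - 1)
  · have h1 := m.left_next hN hl (by rwa [hsucc])
    rw [hsucc] at h1
    have h2 := latt_add_one N (m.site (k - 1))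
    have h3 : (m.x k - m.x (k - 1)) + m.theta (k - 1) * spacing N = spacing N := by
      rw [hnode, h1, h2]; ring
    have h4 := mul_le_mul_of_nonneg_right (sq_defect_le hT.le (by positivity) h3) (sq_nonneg α)
    have h5 : spacing N ^ 4 * (m.theta (k - 1) * spacing N * α ^ 2) ≤ m.gradTerm f (k - 1) := by
      by_cases h0 : m.theta (k - 1) = 0
      · rw [h0]; simpa using m.gradTerm_nonneg hN f (k - 1)
      have hL := m.two_le_numSub hN hl
      have hs := m.site_add_numSub hN (k - 1)
      have hceil : ⌈N * m.x (k - 1)⌉ = m.site (k - 1) + 1 := by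
        unfold site
        rw [Int.ceil_eq_iff]
        have := Int.lt_floor_add_one (N * m.x (k - 1))
        push_cast
        refine ⟨?_, this.le⟩
        have h6 : 0 < Int.fract (N * m.x (k - 1)) := hθ.lt_of_ne' h0
        rw [Int.fract] at h6
        linarith
      have h6 := m.gradTerm_ge hN f hl (i := m.numSub (k - 1)) (by omega) le_rfl
      rw [m.subGrad_eq hN hf (by omega) le_rfl, hs, hceil, ← hα] at h6
      have h7 : m.subLen (k - 1) (m.numSub (k - 1)) = m.theta (k - 1) * spacing N := by
        unfold subLen
        rw [m.subNode_numSub hN, m.subNode_mid (by omega) (by omega)]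
        have : m.site (k - 1 - 1) + ((m.numSub (k - 1) - 1 : ℕ) : ℤ) = m.site (k - 1) := by omega
        rw [this, hnode]; ring
      rwa [h7] at h6
    rw [if_pos hl]
    linarith [hR.2]
  · have hlat : m.theta (k - 1) = 0 := by
      obtain ⟨l, hl'⟩ := m.atom_of_node (k - 1) (m.node_mem_Oa_of_not_isContNode (by
        unfold IsContNode; rw [hsucc]; tauto))
      exact m.theta_eq_zero_of_eq hN hl'
    rw [hlat, zero_mul, add_zero] at hnode
    -- Now x_{k-1} is a lattice site. If x_k is one too, the element is a full cell and the defect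
    -- is zero; otherwise x_k must be an interface and the missing part is the first refinement cell
    -- of T_{k+1}.
    by_cases hr : m.theta k = 0
    · have h1 := m.node_eq hN k
      rw [hr, zero_mul, add_zero] at h1
      have h2 : m.site k = m.site (k - 1) + 1 := by
        have h3 := m.lt_node k
        rw [h1] at hle h3
        rw [hnode] at h3
        have := (latt_le_latt hN).1 hle
        have := (latt_lt_latt hN).1 h3
        omega
      have h3 : m.x k - m.x (k - 1) = spacing N := by
        rw [h1, h2, hnode, latt_add_one]; ring
      rw [h3, sub_self]
      linarith [hR.1, hR.2]
    · have hc : m.IsCont (k + 1) := by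
        by_contra hc
        obtain ⟨l, hl'⟩ := m.atom_of_node k (m.node_mem_Oa_of_not_isContNode (by
          unfold IsContNode; tauto))
        exact hr (m.theta_eq_zero_of_eq hN hl')
      have h1 := m.right_prev hN h hc hr
      have hs : m.site (k - 1) = m.site k :=
        (latt_isPartition hN).mono.injective (hnode.symm.trans h1)
      have h2 := m.node_eq hN k
      have hk1 := m.theta_lt_one k
      have h3 : (m.x k - m.x (k - 1)) + (1 - m.theta k) * spacing N = spacing N := by
        rw [h1, h2]; ring
      have h4 := mul_le_mul_of_nonneg_right (sq_defect_le hT.le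
        (mul_nonneg (by linarith) hε.le) h3) (sq_nonneg α)
      have hL := m.two_le_numSub hN hc
      have h6 := m.gradTerm_ge hN f hc (i := 1) le_rfl (by omega)
      rw [m.subGrad_eq hN hf le_rfl (by omega), add_sub_cancel_right] at h6
      have h7 : m.subLen (k + 1) 1 = (1 - m.theta k) * spacing N := by
        unfold subLen
        rw [m.subNode_mid one_pos (by omega), Nat.sub_self, m.subNode_zero, add_sub_cancel_right,
          Nat.cast_one, latt_add_one, h2]
        ring
      rw [h7, Nat.cast_one, ← hs, ← hα] at h6
      rw [if_pos hc]
      linarith [hR.1]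

theorem cont_residual_le (hN : 0 < N) (hf : IsP1 (latt N) f) (hw : IsP1 (latt N) w)
    (hfp : ∀ t, f (t + 1) = f t) (hwp : ∀ t, w (t + 1) = w t) {G : ℝ} (hG : ∀ t, w t ^ 2 ≤ G)
    {lam mu : ℝ} (hl : 0 < lam) (hmu : 0 < mu) {k : ℤ} (h : m.IsCont k) :
    (∫ t in m.x (k - 1)..m.x k, pairingDensity N f w t) - (m.x k - m.x (k - 1)) / 2 *
      (f (m.x k) * w (m.x k) + f (m.x (k - 1)) * w (m.x (k - 1))) ≤
    lam / 2 * (5 / 2 * (m.hTilde k ^ 2 *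
        ∑ i ∈ Finset.Ico 1 (m.numSub k), m.subLenAvg k i * f (m.subNode k i) ^ 2) +
      m.gradTerm f k) +
    (∫ t in m.x (k - 1)..m.x k, deriv w t ^ 2) / (2 * lam) +
    mu / 2 * (1 / 64 * (m.numNodes * spacing N) ^ 4 * m.hHat k ^ 4 *
      ∑ i ∈ Finset.Ico 1 (m.numSub k), m.subLenAvg k i * m.subGradTwo f k i ^ 2) +
    (m.x k - m.x (k - 1)) * G / (2 * mu) := by
  have hε := spacing_pos hN
  have hwp' : ∀ t, w (t + 1) = w t + 0 := by simpa using hwp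
  have hL := m.two_le_numSub hN h
  have hT : 0 < m.x k - m.x (k - 1) := sub_pos.2 (m.lt_node k)
  have key := trapezoid_residual_le (f := f) (w := w) (p := m.subNode k) (α := m.subGrad f k)
    (β := m.subGrad w k) (ε := spacing N) (lam := lam) (mu := mu) (G := G) hL hε.le hl hmu
    (fun i h1 h2 => m.subNode_lt hN h1 h2) (fun i h1 h2 => m.subLen_le hN h1 h2)
    (by rw [m.subNode_numSub hN, m.subNode_zero]; exact m.continuum_size k h)
    (fun i h1 h2 t ht => m.eq_on_sub hN hf h1 h2 ht)
    (fun i h1 h2 t ht => m.eq_on_sub hN hw h1 h2 ht) hG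
  rw [m.subNode_numSub hN, m.subNode_zero] at key
  have e1 : ∑ i ∈ Finset.Icc 1 (m.numSub k), ∫ t in m.subNode k (i - 1)..m.subNode k i,
      (f t * w t + spacing N ^ 2 / 6 * (m.subGrad f k i * m.subGrad w k i)) =
      ∫ t in m.x (k - 1)..m.x k, pairingDensity N f w t := by
    have := sum_Icc_integral (fun a b => pairingDensity_integrable hN hf hw hfp hwp a b)
      (m.subNode k) (m.numSub k)
    rw [m.subNode_numSub hN, m.subNode_zero] at this
    rw [← this]
    refine Finset.sum_congr rfl fun i hi => ?_
    obtain ⟨h1, h2⟩ := Finset.mem_Icc.1 hi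
    refine integral_congr_Ioo (m.subNode_lt hN h1 h2).le fun t ht => ?_
    unfold pairingDensity
    rw [m.deriv_on_sub hN hf h1 h2 ht, m.deriv_on_sub hN hw h1 h2 ht]
  have e2 : ∑ i ∈ Finset.Icc 1 (m.numSub k), (m.subNode k i - m.subNode k (i - 1)) *
      m.subGrad w k i ^ 2 = ∫ t in m.x (k - 1)..m.x k, deriv w t ^ 2 := by
    have hint : ∀ a b, IntervalIntegrable (fun t => deriv w t ^ 2) volume a b :=
      (latt_isPartition hN).intervalIntegrable (fun t => by simp only [deriv_periodic hwp' t])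
        fun k => intervalIntegrable_of_eq_Ioo ((latt_isPartition hN).lt_node k).le
          (intervalIntegrable_const (c := elemGrad (latt N) w k ^ 2)) fun t ht => by
            rw [hw.deriv_eq (latt_isPartition hN) ht]
    have := sum_Icc_integral hint (m.subNode k) (m.numSub k)
    rw [m.subNode_numSub hN, m.subNode_zero] at this
    rw [← this]
    refine Finset.sum_congr rfl fun i hi => ?_
    obtain ⟨h1, h2⟩ := Finset.mem_Icc.1 hi
    exact (integral_eq_const (m.subNode_lt hN h1 h2).le fun t ht => by
      rw [m.deriv_on_sub hN hw h1 h2 ht]).symm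
  rw [e1, e2] at key
  have pos1 : ∀ g : ℕ → ℝ, 0 ≤ ∑ i ∈ Finset.Ico 1 (m.numSub k), m.subLenAvg k i * g i ^ 2 := by
    refine fun g => Finset.sum_nonneg fun i hi => mul_nonneg ?_ (sq_nonneg _)
    obtain ⟨h1, h2⟩ := Finset.mem_Ico.1 hi
    have := m.subLen_pos hN h1 h2.le
    have := m.subLen_pos hN (k := k) (i := i + 1) (by omega) h2
    unfold subLenAvg; positivity
  have hh2 := m.sq_le_hHat hN k
  have hh4 : (m.x k - m.x (k - 1)) ^ 4 ≤ m.hHat k ^ 4 := by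
    have := pow_le_pow_left₀ (by positivity) hh2 2
    linarith [pow_mul (m.x k - m.x (k - 1)) 2 2, pow_mul (m.hHat k) 2 2]
  have ht2 : ((m.x k - m.x (k - 1)) / 2) ^ 2 ≤ m.hTilde k ^ 2 := by
    have := m.length_le hN k
    unfold hTilde
    gcongr
    linarith
  -- The bound holds without this factor; it is at least one and is inserted only to reach the form
  -- of the indicator.
  have hn4 : 1 ≤ (m.numNodes * spacing N) ^ 4 := one_le_pow₀ (m.one_le_numNodes hN)
  have b1 : 5 / 2 * ((m.x k - m.x (k - 1)) / 2) ^ 2 *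
      ∑ i ∈ Finset.Ico 1 (m.numSub k), m.subLenAvg k i * f (m.subNode k i) ^ 2 ≤
      5 / 2 * (m.hTilde k ^ 2 *
        ∑ i ∈ Finset.Ico 1 (m.numSub k), m.subLenAvg k i * f (m.subNode k i) ^ 2) := by
    rw [mul_assoc]
    have := mul_le_mul_of_nonneg_right ht2 (pos1 fun i => f (m.subNode k i))
    linarith
  have b2 : 45 / 64 * (m.x k - m.x (k - 1)) ^ 4 *
      ∑ i ∈ Finset.Icc 1 (m.numSub k), m.subLen k i * m.subGrad f k i ^ 2 ≤ m.gradTerm f k := by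
    unfold gradTerm
    refine mul_le_mul_of_nonneg_right ?_ (Finset.sum_nonneg fun i hi => ?_)
    · have : 0 ≤ (m.x k - m.x (k - 1)) ^ 4 := by positivity
      linarith
    · obtain ⟨h1, h2⟩ := Finset.mem_Icc.1 hi
      exact mul_nonneg (m.subLen_pos hN h1 h2).le (sq_nonneg _)
  have b3 : 1 / 64 * (m.x k - m.x (k - 1)) ^ 4 *
      ∑ i ∈ Finset.Ico 1 (m.numSub k), m.subLenAvg k i * m.subGradTwo f k i ^ 2 ≤
      1 / 64 * (m.numNodes * spacing N) ^ 4 * m.hHat k ^ 4 *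
      ∑ i ∈ Finset.Ico 1 (m.numSub k), m.subLenAvg k i * m.subGradTwo f k i ^ 2 := by
    refine mul_le_mul_of_nonneg_right ?_ (pos1 fun i => m.subGradTwo f k i)
    have : 0 ≤ m.hHat k ^ 4 := by positivity
    have := mul_le_mul_of_nonneg_right hn4 this
    linarith
  have c1 := mul_le_mul_of_nonneg_left (add_le_add b1 b2) (half_pos hl).le
  have c3 := mul_le_mul_of_nonneg_left b3 (half_pos hmu).le
  unfold subGradTwo subLenAvg subLen at *
  simp only [Nat.add_sub_cancel] at *
  linarith

open Classical in
/-- The residual of the external forces is controlled by the external force estimator. -/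
theorem ext_residual_le (hN : 0 < N) (hf : IsP1 (latt N) f) (hw : IsP1 (latt N) w)
    (hfp : ∀ t, f (t + 1) = f t) (hwp : ∀ t, w (t + 1) = w t)
    (hG : ∀ t, w t ^ 2 ≤ gradNormTwo N w ^ 2) {lam : ℝ} (hl : 0 < lam) :
    atomPairing N f w - m.qcPairing f w ≤
      lam / 2 * (7 / 2 * m.estExt f ^ 2) + gradNormTwo N w ^ 2 / (2 * lam) := by
  have hε := spacing_pos hN
  have hwp' : ∀ t, w (t + 1) = w t + 0 := by simpa using hwp
  set G := gradNormTwo N w ^ 2 with hGdef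
  have hGsum : ∑ k ∈ Finset.Icc (1 : ℤ) m.K, ∫ t in m.x (k - 1)..m.x k, deriv w t ^ 2 = G := by
    have hint : ∀ a b, IntervalIntegrable (fun t => deriv w t ^ 2) volume a b :=
      (latt_isPartition hN).intervalIntegrable (fun t => by simp only [deriv_periodic hwp' t])
        fun k => intervalIntegrable_of_eq_Ioo ((latt_isPartition hN).lt_node k).le
          (intervalIntegrable_const (c := elemGrad (latt N) w k ^ 2)) fun t ht => by
            rw [hw.deriv_eq (latt_isPartition hN) ht]
    rw [← m.isPartition.integral_eq_sum (fun t => by simp only [deriv_periodic hwp' t])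
      fun k => hint _ _, hw.integral_deriv_sq (latt_isPartition hN) hwp', hGdef]
    unfold gradNormTwo
    rw [Real.sq_sqrt (Finset.sum_nonneg fun k _ => by positivity)]
    exact Finset.sum_congr rfl fun k _ => by rw [latt_sub_one, sub_sub_cancel]
  -- The weights satisfy 5/7 + 2/7 = 1, so the two gradient terms add up to G/(2λ). Both the value
  -- term, (7/5)(5/2), and the second-difference term, 7/2, then carry the coefficient 7/2, and the
  -- first-difference term, (7/5)(11/9), is smaller.
  set lam₁ := 7 / 5 * lam with hlam₁
  set mu := 7 / 2 * lam with hmu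
  have hl₁ : 0 < lam₁ := by positivity
  have hmu0 : 0 < mu := by positivity
  set D : ℤ → ℝ := fun k => ∫ t in m.x (k - 1)..m.x k, deriv w t ^ 2 with hD
  set R : ℤ → ℝ := fun k => if m.IsCont k then m.gradTerm f k else 0 with hR
  set A : ℤ → ℝ := fun k => if m.IsCont k then m.hTilde k ^ 2 *
    ∑ i ∈ Finset.Ico 1 (m.numSub k), m.subLenAvg k i * f (m.subNode k i) ^ 2 else 0 with hA
  set B : ℤ → ℝ := fun k => if m.IsCont k then
    1 / 64 * (m.numNodes * spacing N) ^ 4 * m.hHat k ^ 4 *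
      ∑ i ∈ Finset.Ico 1 (m.numSub k), m.subLenAvg k i * m.subGradTwo f k i ^ 2 else 0 with hB
  have elem : ∀ k, (∫ t in m.x (k - 1)..m.x k, pairingDensity N f w t) -
      (m.x k - m.x (k - 1)) / 2 * (f (m.x k) * w (m.x k) + f (m.x (k - 1)) * w (m.x (k - 1))) ≤
      lam₁ / 2 * (5 / 2 * A k + R k + 1 / 9 * (R (k + -1) + R (k + 1))) + D k / (2 * lam₁) +
        mu / 2 * B k + (m.x k - m.x (k - 1)) * G / (2 * mu) := by
    intro k
    have hR0 : ∀ j, 0 ≤ R j := fun j => by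
      simp only [hR]; split_ifs
      · exact m.gradTerm_nonneg hN f j
      · exact le_rfl
    have hT : 0 < m.x k - m.x (k - 1) := sub_pos.2 (m.lt_node k)
    by_cases hc : m.IsCont k
    · have h1 := m.cont_residual_le hN hf hw hfp hwp hG hl₁ hmu0 hc
      have e1 : A k = _ := if_pos hc
      have e2 : R k = _ := if_pos hc
      have e3 : B k = _ := if_pos hc
      rw [e1, e2, e3]
      have := mul_nonneg (half_pos hl₁).le (add_nonneg (hR0 (k + -1)) (hR0 (k + 1)))
      linarith
    · have e1 : A k = 0 := if_neg hc
      have e2 : R k = 0 := if_neg hc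
      have e3 : B k = 0 := if_neg hc
      have hx := latt_isPartition hN
      have hle := m.le_latt_of_not_isCont hN hc
      have hge := m.latt_site_le hN (k - 1)
      have hsub : Icc (m.x (k - 1)) (m.x k) ⊆
          Icc (latt N (m.site (k - 1) + 1 - 1)) (latt N (m.site (k - 1) + 1)) := by
        rw [add_sub_cancel_right]; exact Icc_subset_Icc hge hle
      have hsub' : Ioo (m.x (k - 1)) (m.x k) ⊆
          Ioo (latt N (m.site (k - 1) + 1 - 1)) (latt N (m.site (k - 1) + 1)) := by
        rw [add_sub_cancel_right]; exact Ioo_subset_Ioo hge hle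
      set α := elemGrad (latt N) f (m.site (k - 1) + 1) with hα
      set β := elemGrad (latt N) w (m.site (k - 1) + 1) with hβ
      have haff : ∀ g : ℝ → ℝ, IsP1 (latt N) g → ∀ t ∈ Icc (m.x (k - 1)) (m.x k),
          g t = g (m.x k) + elemGrad (latt N) g (m.site (k - 1) + 1) * (t - m.x k) := by
        intro g hg t ht
        have := hg.eq_on' hx (hsub ht) (hsub ⟨(m.lt_node k).le, le_rfl⟩)
        linarith
      have h1 := integral_pairingDensity_of_affine (N := N) (m.lt_node k).le (haff f hf) (haff w hw)
        (fun t ht => hf.deriv_eq hx (hsub' ht)) (fun t ht => hw.deriv_eq hx (hsub' ht)) hf.1 hw.1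
      have h2 : D k = (m.x k - m.x (k - 1)) * β ^ 2 :=
        integral_eq_const (m.lt_node k).le fun t ht => by rw [hw.deriv_eq hx (hsub' ht)]
      have h3 := m.atom_defect_le hN hf hc
      rw [← hα] at h3
      set T := m.x k - m.x (k - 1) with hTdef
      have h4 := mul_le_mul_of_nonneg_left
        (mul_le_amgm (a := (spacing N ^ 2 - T ^ 2) / 6 * α) (b := β) hl₁) hT.le
      have h5 := mul_le_mul_of_nonneg_left h3 (half_pos hl₁).le
      have h6 : 0 ≤ T * G / (2 * mu) := by positivity
      rw [h1, e1, e2, e3, h2]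
      simp only [hR, ← sub_eq_add_neg]
      have h7 : T * ((spacing N ^ 2 - T ^ 2) / 6) * (α * β) =
        T * ((spacing N ^ 2 - T ^ 2) / 6 * α * β) := by ring
      have h8 : T * (lam₁ / 2 * ((spacing N ^ 2 - T ^ 2) / 6 * α) ^ 2 + β ^ 2 / (2 * lam₁)) =
        lam₁ / 2 * (T * ((spacing N ^ 2 - T ^ 2) / 6) ^ 2 * α ^ 2) + T * β ^ 2 / (2 * lam₁) := by
        ring
      rw [← hα, ← hβ, h7]
      rw [h8] at h4
      linarith
  have hRper : ∀ k, R (k + m.K) = R k := fun k => by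
    simp only [hR, m.isCont_add, m.gradTerm_add hN hfp]
  have hsum := Finset.sum_le_sum fun k (_ : k ∈ Finset.Icc (1 : ℤ) m.K) => elem k
  rw [Finset.sum_sub_distrib, ← m.isPartition.integral_eq_sum (pairingDensity_periodic hfp hwp)
    (fun k => pairingDensity_integrable hN hf hw hfp hwp _ _),
    ← atomPairing_eq_integral hN hf hw hfp hwp, ← m.qcPairing_eq_sum hfp hwp,
    Finset.sum_add_distrib, Finset.sum_add_distrib, Finset.sum_add_distrib, ← Finset.mul_sum,
    Finset.sum_add_distrib, Finset.sum_add_distrib, ← Finset.mul_sum, ← Finset.mul_sum,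
    Finset.sum_add_distrib, sum_Icc_shift R m.K hRper, sum_Icc_shift R m.K hRper, ← Finset.sum_div,
    hGsum, ← Finset.mul_sum, ← Finset.sum_div, ← Finset.sum_mul, m.isPartition.sum_length] at hsum
  have hE : ∑ k ∈ Finset.Icc (1 : ℤ) m.K, A k + ∑ k ∈ Finset.Icc (1 : ℤ) m.K, R k +
      ∑ k ∈ Finset.Icc (1 : ℤ) m.K, B k ≤ m.estExt f ^ 2 := by
    have hnn : ∀ k ∈ Finset.Icc (1 : ℤ) m.K, A k + R k + B k ≤
        if m.IsCont k then m.etaExtSq f k else 0 := by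
      intro k _
      simp only [hA, hR, hB]
      split_ifs
      · unfold etaExtSq gradTerm
        -- This part of the indicator is nonnegative and is simply dropped.
        have : 0 ≤ 1 / 128 * (spacing N ^ 3 * elemGrad (latt N) f (m.site (k - 1) + 1) ^ 2 +
          spacing N ^ 3 * elemGrad (latt N) f (m.site k + 1) ^ 2) ^ 2 := by positivity
        linarith
      · simp
    have hABR : ∀ k, 0 ≤ A k ∧ 0 ≤ R k ∧ 0 ≤ B k := by
      intro k
      have pos1 : ∀ g : ℕ → ℝ,
          0 ≤ ∑ i ∈ Finset.Ico 1 (m.numSub k), m.subLenAvg k i * g i ^ 2 := by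
        refine fun g => Finset.sum_nonneg fun i hi => mul_nonneg ?_ (sq_nonneg _)
        obtain ⟨h1, h2⟩ := Finset.mem_Ico.1 hi
        have := m.subLen_pos hN h1 h2.le
        have := m.subLen_pos hN (k := k) (i := i + 1) (by omega) h2
        unfold subLenAvg; positivity
      simp only [hA, hR, hB]
      refine ⟨?_, ?_, ?_⟩ <;> split_ifs
      · exact mul_nonneg (sq_nonneg _) (pos1 _)
      · exact le_rfl
      · exact m.gradTerm_nonneg hN f k
      · exact le_rfl
      · exact mul_nonneg (by positivity) (pos1 _)
      · exact le_rfl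
    unfold estExt
    rw [Real.sq_sqrt, ← Finset.sum_add_distrib, ← Finset.sum_add_distrib]
    · exact Finset.sum_le_sum hnn
    · refine Finset.sum_nonneg fun k hk => le_trans ?_ (hnn k hk)
      obtain ⟨h1, h2, h3⟩ := hABR k
      positivity
  have hR0 : 0 ≤ ∑ k ∈ Finset.Icc (1 : ℤ) m.K, R k := Finset.sum_nonneg fun k _ => by
    simp only [hR]; split_ifs
    · exact m.gradTerm_nonneg hN f k
    · exact le_rfl
  have e1 : G / (2 * lam₁) + 1 * G / (2 * mu) = G / (2 * lam) := by
    rw [hlam₁, hmu]; field_simp; norm_num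
  set a := ∑ k ∈ Finset.Icc (1 : ℤ) m.K, A k
  set r := ∑ k ∈ Finset.Icc (1 : ℤ) m.K, R k
  set b := ∑ k ∈ Finset.Icc (1 : ℤ) m.K, B k
  have e2 : lam₁ / 2 * (5 / 2 * a + r + 1 / 9 * (r + r)) + mu / 2 * b ≤
      lam / 2 * (7 / 2 * m.estExt f ^ 2) := by
    have h1 := mul_le_mul_of_nonneg_left hE (half_pos hl).le
    have h2 := mul_nonneg hl.le hR0
    rw [hlam₁, hmu]
    nlinarith
  linarith

end Mesh

/-! ### The projection to the lattice -/

section Projection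

variable {N : ℕ} {g W : ℝ → ℝ}

theorem lattInterp_eq (hN : 0 < N) (hW : IsP1 (latt N) W) (h : ∀ l, W (latt N l) = g (latt N l)) :
    lattInterp N g = W := by
  have hx := latt_isPartition hN
  have h0 : (N : ℝ) ≠ 0 := by exact_mod_cast hN.ne'
  funext t
  obtain ⟨k, hk1, hk2⟩ := hx.exists_index t
  have hfl : ⌊N * t⌋ = k - 1 := floor_eq_of_mem hN hk1 (by rwa [sub_add_cancel])
  unfold lattInterp
  rw [Int.fract, hfl, sub_add_cancel, hW.eq_on hx ⟨hk1, hk2.le⟩, elemGrad_latt, h, h]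
  unfold spacing latt
  push_cast
  field_simp
  ring

theorem lattInterp_isP1 (hN : 0 < N) (hg : ∀ t, g (t + 1) = g t) :
    IsP1 (latt N) (lattInterp N g) ∧ (∀ t, lattInterp N g (t + 1) = lattInterp N g t) ∧
      ∀ l, lattInterp N g (latt N l) = g (latt N l) := by
  obtain ⟨W, hW, hWp, hWx⟩ := (latt_isPartition hN).exists_interp hg
  rw [lattInterp_eq hN hW hWx]
  exact ⟨hW, hWp, hWx⟩

variable {F : ℝ} {y : ℝ → ℝ}

theorem proj_eq (N : ℕ) (F : ℝ) (y : ℝ → ℝ) : ∃ c : ℝ,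
    proj N F y = fun t => F * t + lattInterp N (displ F y) t + c :=
  ⟨-(spacing N * ∑ l ∈ Finset.Icc (1 : ℤ) N, displ F y (latt N l)), rfl⟩

theorem displ_periodic (hy : ∀ t, y (t + 1) = y t + F) (t : ℝ) :
    displ F y (t + 1) = displ F y t := by
  unfold displ; rw [hy]; ring

theorem proj_isP1 (hN : 0 < N) (hy : ∀ t, y (t + 1) = y t + F) : IsP1 (latt N) (proj N F y) := by
  obtain ⟨c, hc⟩ := proj_eq N F y
  rw [hc]
  exact ((isP1_linear _ F).add (lattInterp_isP1 hN (displ_periodic hy)).1).const_add c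

theorem proj_periodic (hN : 0 < N) (hy : ∀ t, y (t + 1) = y t + F) (t : ℝ) :
    proj N F y (t + 1) = proj N F y t + F := by
  obtain ⟨c, hc⟩ := proj_eq N F y
  simp only [hc, (lattInterp_isP1 hN (displ_periodic hy)).2.1]
  ring

/-- J alters y only between sites and by a constant, so lattice stresses of J y_qc and of y_qc
agree. -/
theorem elemGrad_proj (hN : 0 < N) (hy : ∀ t, y (t + 1) = y t + F) (l : ℤ) :
    elemGrad (latt N) (proj N F y) l = elemGrad (latt N) y l := by
  obtain ⟨c, hc⟩ := proj_eq N F y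
  rw [elemGrad_latt, elemGrad_latt]
  simp only [hc, (lattInterp_isP1 hN (displ_periodic hy)).2.2]
  unfold displ
  congr 1
  ring

end Projection

/-! ### Norms of gradients -/

section Norms

variable {N : ℕ} {g : ℝ → ℝ}

theorem elemGrad_sub (x : ℤ → ℝ) (g w : ℝ → ℝ) (k : ℤ) :
    elemGrad x (g - w) k = elemGrad x g k - elemGrad x w k := by
  unfold elemGrad
  simp only [Pi.sub_apply]
  ring

theorem elemGrad_add_const (x : ℤ → ℝ) (g : ℝ → ℝ) (c : ℝ) (k : ℤ) :
    elemGrad x (fun t => g t + c) k = elemGrad x g k := by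
  unfold elemGrad
  simp only [add_sub_add_right_eq_sub]

theorem gradNormTwo_add_const (N : ℕ) (g : ℝ → ℝ) (c : ℝ) :
    gradNormTwo N (fun t => g t + c) = gradNormTwo N g := by
  unfold gradNormTwo
  simp only [elemGrad_add_const]

theorem gradNormTwo_nonneg (N : ℕ) (g : ℝ → ℝ) : 0 ≤ gradNormTwo N g := Real.sqrt_nonneg _

theorem gradNormTwo_sq (hN : 0 < N) (g : ℝ → ℝ) : gradNormTwo N g ^ 2 =
    spacing N * ∑ l ∈ Finset.Icc (1 : ℤ) N, elemGrad (latt N) g l ^ 2 := by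
  have := (spacing_pos hN).le
  unfold gradNormTwo
  rw [Real.sq_sqrt (Finset.sum_nonneg fun _ _ => by positivity), Finset.mul_sum]

theorem latt_sub_pred (N : ℕ) (l : ℤ) : latt N l - latt N (l - 1) = spacing N := by
  rw [latt_sub_one, sub_sub_cancel]

theorem sq_sub_le_gradNormTwo (hN : 0 < N) (hg : IsP1 (latt N) g) (hp : ∀ t, g (t + 1) = g t)
    (s t : ℝ) : (g s - g t) ^ 2 ≤ gradNormTwo N g ^ 2 := by
  rw [gradNormTwo_sq hN, Finset.mul_sum]
  simpa only [latt_sub_pred] using hg.osc_sq_le (latt_isPartition hN) hp s t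

theorem eLpNorm_deriv_two (hN : 0 < N) (hg : IsP1 (latt N) g) (hp : ∀ t, g (t + 1) = g t) :
    eLpNorm (deriv g) 2 (volume.restrict (Icc (0 : ℝ) 1)) = ENNReal.ofReal (gradNormTwo N g) := by
  have hx := latt_isPartition hN
  have hp' : ∀ t, g (t + 1) = g t + 0 := by simpa using hp
  have h1 := hg.integral_deriv_sq hx hp'
  simp only [latt_sub_pred] at h1
  have hint : IntervalIntegrable (fun t => deriv g t ^ 2) volume 0 1 :=
    hx.intervalIntegrable (fun t => by simp only [deriv_periodic hp' t])
      (fun k => intervalIntegrable_of_eq_Ioo (hx.lt_node k).le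
        (intervalIntegrable_const (c := elemGrad (latt N) g k ^ 2)) fun t ht => by
          rw [hg.deriv_eq hx ht]) 0 1
  rw [intervalIntegral.integral_of_le zero_le_one] at h1
  rw [intervalIntegrable_iff_integrableOn_Ioc_of_le zero_le_one] at hint
  have h2 : ∫⁻ t in Ioc (0 : ℝ) 1, ‖deriv g t‖ₑ ^ (2 : ℝ) = ENNReal.ofReal
      (∑ l ∈ Finset.Icc (1 : ℤ) N, spacing N * elemGrad (latt N) g l ^ 2) := by
    rw [← h1, ofReal_integral_eq_lintegral_ofReal hint
      (Filter.Eventually.of_forall fun t => sq_nonneg _)]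
    refine lintegral_congr fun t => ?_
    rw [ENNReal.rpow_two, ← ofReal_norm, ← ENNReal.ofReal_pow (norm_nonneg _),
      Real.norm_eq_abs, sq_abs]
  rw [Measure.restrict_congr_set (Ioc_ae_eq_Icc (μ := volume) (a := (0 : ℝ)) (b := 1)).symm,
    eLpNorm_eq_lintegral_rpow_enorm_toReal two_ne_zero ENNReal.ofNat_ne_top]
  simp only [ENNReal.toReal_ofNat]
  rw [h2, gradNormTwo, Real.sqrt_eq_rpow, ENNReal.ofReal_rpow_of_nonneg _ (by norm_num)]
  exact Finset.sum_nonneg fun _ _ => mul_nonneg (spacing_pos hN).le (sq_nonneg _)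

/-- The derivative is constant on each cell and a cell is not a null set, so the essential bound is
attained at some point of it; periodicity extends the bound to all cells. -/
theorem abs_elemGrad_le (hN : 0 < N) (hg : IsP1 (latt N) g) (hp : ∀ t, g (t + 1) = g t) {τ : ℝ}
    (hτ : 0 ≤ τ) (h : eLpNorm (deriv g) ⊤ (volume.restrict (Icc (0 : ℝ) 1)) ≤ ENNReal.ofReal τ)
    (l : ℤ) : |elemGrad (latt N) g l| ≤ τ := by
  have hx := latt_isPartition hN
  have hp' : ∀ t, g (t + 1) = g t + 0 := by simpa using hp
  have hper : Function.Periodic (deriv g) 1 := deriv_periodic hp'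
  rw [eLpNorm_exponent_top] at h
  have hae : ∀ᵐ t ∂volume.restrict (Icc (0 : ℝ) 1), |deriv g t| ≤ τ := by
    filter_upwards [ae_le_eLpNormEssSup (f := deriv g) (μ := volume.restrict (Icc (0 : ℝ) 1))]
      with t ht
    have := ht.trans h
    rwa [← ofReal_norm, ENNReal.ofReal_le_ofReal_iff hτ, Real.norm_eq_abs] at this
  have hN' : (0 : ℤ) < N := by exact_mod_cast hN
  have key : ∀ l : ℤ, 1 ≤ l → l ≤ N → |elemGrad (latt N) g l| ≤ τ := by
    intro l h1 h2
    have hl := hx.lt_node l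
    have hsub : Ioo (latt N (l - 1)) (latt N l) ⊆ Icc 0 1 := by
      have e0 : latt N 0 = 0 := by simp [latt]
      have e1 : latt N N = 1 := by
        have := hx.add 0
        rwa [zero_add, e0, zero_add] at this
      have i0 : latt N 0 ≤ latt N (l - 1) := (latt_le_latt hN).2 (by omega)
      have i1 : latt N l ≤ latt N N := (latt_le_latt hN).2 h2
      exact fun t ht => ⟨by linarith [ht.1], by linarith [ht.2]⟩
    have hae' := ae_restrict_of_ae_restrict_of_subset hsub hae
    have hne : volume.restrict (Ioo (latt N (l - 1)) (latt N l)) ≠ 0 := by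
      rw [Ne, Measure.restrict_eq_zero, Real.volume_Ioo, ENNReal.ofReal_eq_zero]
      linarith
    have : (ae (volume.restrict (Ioo (latt N (l - 1)) (latt N l)))).NeBot := ae_neBot.2 hne
    obtain ⟨t, ht, ht'⟩ := (hae'.and (ae_restrict_mem measurableSet_Ioo)).exists
    rwa [hg.deriv_eq hx ht'] at ht
  have hper' : Function.Periodic (elemGrad (latt N) g) N := elemGrad_add_period hx hp'
  have h3 := hper'.sub_zsmul_eq ((l - 1) / (N : ℤ)) (x := l)
  rw [← h3]
  have h4 := Int.emod_add_mul_ediv (l - 1) N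
  have h5 := Int.emod_nonneg (l - 1) hN'.ne'
  have h6 := Int.emod_lt_of_pos (l - 1) hN'
  have h7 : l - ((l - 1) / (N : ℤ)) • (N : ℤ) = (l - 1) % N + 1 := by
    rw [smul_eq_mul]; linarith [mul_comm ((l - 1) / (N : ℤ)) N]
  rw [h7]
  exact key _ (by omega) (by omega)

end Norms

/-! ### The stability constant -/

section Stability

variable {N : ℕ} {phi y : ℝ → ℝ} {F : ℝ}

theorem stabConst_le (hN : 0 < N) (hy : ∀ t, y (t + 1) = y t + F) (l : ℤ) :
    stabConst phi N y ≤ stabCoeff phi N y l := by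
  have hN' : (0 : ℤ) < N := by exact_mod_cast hN
  have hg : Function.Periodic (elemGrad (latt N) y) N :=
    elemGrad_add_period (latt_isPartition hN) hy
  have hper : Function.Periodic (stabCoeff phi N y) N := by
    intro l
    unfold stabCoeff
    rw [show l + (N : ℤ) - 1 = l - 1 + N by ring, show l + (N : ℤ) + 1 = l + 1 + N by ring,
      hg, hg, hg]
  have h3 := hper.sub_zsmul_eq ((l - 1) / (N : ℤ)) (x := l)
  have h4 := Int.emod_add_mul_ediv (l - 1) N
  have h5 := Int.emod_nonneg (l - 1) hN'.ne'
  have h6 := Int.emod_lt_of_pos (l - 1) hN'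
  have h7 : l - ((l - 1) / (N : ℤ)) • (N : ℤ) = (l - 1) % N + 1 := by
    rw [smul_eq_mul]; linarith [mul_comm ((l - 1) / (N : ℤ)) N]
  rw [← h3, h7]
  exact ciInf_le (Set.finite_range fun l : Finset.Icc (1 : ℤ) N => stabCoeff phi N y l).bddBelow
    (⟨(l - 1) % N + 1, Finset.mem_Icc.2 ⟨by omega, by omega⟩⟩ : Finset.Icc (1 : ℤ) N)

theorem le_stabConst (hN : 0 < N) {A : ℝ} (h : ∀ l, A ≤ stabCoeff phi N y l) :
    A ≤ stabConst phi N y := by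
  have : Nonempty (Finset.Icc (1 : ℤ) N) := ⟨⟨1, Finset.mem_Icc.2 ⟨le_rfl, by exact_mod_cast hN⟩⟩⟩
  exact le_ciInf fun l => h l

/-- All arguments stay above r_*/4, where φ'' is M-Lipschitz. The three terms of A_ℓ change by Mτ,
2M(2τ) and 2M(2τ). -/
theorem abs_stabCoeff_sub_le {rstar : ℝ} (h : IsPotential phi rstar) {M τ : ℝ} {z y : ℝ → ℝ}
    (hM : ∀ r, rstar / 4 ≤ r → |iteratedDeriv 3 phi r| ≤ M)
    (hz : ∀ l, rstar / 2 ≤ elemGrad (latt N) z l)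
    (he : ∀ l, |elemGrad (latt N) y l - elemGrad (latt N) z l| ≤ τ) (hτ : τ ≤ rstar / 4) (l : ℤ) :
    |stabCoeff phi N y l - stabCoeff phi N z l| ≤ 9 * M * τ := by
  have hr := h.rstar_pos
  have hM0 : 0 ≤ M := (abs_nonneg _).trans (hM (rstar / 4) le_rfl)
  have hy : ∀ l, rstar / 4 ≤ elemGrad (latt N) y l := fun l => by
    linarith [(abs_le.1 (he l)).1, hz l]
  have key : ∀ a b s : ℝ, rstar / 4 ≤ a → rstar / 4 ≤ b → |b - a| ≤ s →
      |iteratedDeriv 2 phi b - iteratedDeriv 2 phi a| ≤ M * s := fun a b s ha hb hs =>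
    (h.deriv_two_lipschitz (by linarith) hM ha hb).trans (mul_le_mul_of_nonneg_left hs hM0)
  have e0 := abs_le.1 (he (l - 1))
  have e1 := abs_le.1 (he l)
  have e2 := abs_le.1 (he (l + 1))
  have k1 := abs_le.1 (key _ _ τ (by linarith [hz l]) (hy l) (he l))
  have k2 := abs_le.1 (key (elemGrad (latt N) z (l - 1) + elemGrad (latt N) z l)
    (elemGrad (latt N) y (l - 1) + elemGrad (latt N) y l) (2 * τ)
    (by linarith [hz l, hz (l - 1)]) (by linarith [hy l, hy (l - 1)])
    (abs_le.2 ⟨by linarith, by linarith⟩))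
  have k3 := abs_le.1 (key (elemGrad (latt N) z l + elemGrad (latt N) z (l + 1))
    (elemGrad (latt N) y l + elemGrad (latt N) y (l + 1)) (2 * τ)
    (by linarith [hz l, hz (l + 1)]) (by linarith [hy l, hy (l + 1)])
    (abs_le.2 ⟨by linarith, by linarith⟩))
  unfold stabCoeff
  rw [abs_le]
  constructor <;> linarith

end Stability

/-! ### The error estimate -/

/-- The optimal parameter is λ = CY/X. The shift by δ avoids vanishing X or Y and is removed in the
limit. -/
theorem le_of_forall_amgm {R X Y C : ℝ} (hX : 0 ≤ X) (hY : 0 ≤ Y) (hC : 0 ≤ C)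
    (h : ∀ lam : ℝ, 0 < lam → R ≤ lam / 2 * X ^ 2 + C ^ 2 * Y ^ 2 / (2 * lam)) : R ≤ C * X * Y := by
  have h1 : ∀ δ : ℝ, 0 < δ → R ≤ (X + δ) * (C * Y + δ) := by
    intro δ hδ
    have hX' : 0 < X + δ := by linarith
    have hCY : 0 ≤ C * Y := mul_nonneg hC hY
    have hY' : 0 < C * Y + δ := by linarith
    have h2 := h ((C * Y + δ) / (X + δ)) (by positivity)
    have h3 : (C * Y + δ) / (X + δ) / 2 * X ^ 2 ≤ (C * Y + δ) / (X + δ) / 2 * (X + δ) ^ 2 := by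
      gcongr; linarith
    have h4 : C ^ 2 * Y ^ 2 / (2 * ((C * Y + δ) / (X + δ))) ≤
        (C * Y + δ) ^ 2 / (2 * ((C * Y + δ) / (X + δ))) := by
      rw [← mul_pow]; gcongr; linarith
    have h5 : (C * Y + δ) / (X + δ) / 2 * (X + δ) ^ 2 +
        (C * Y + δ) ^ 2 / (2 * ((C * Y + δ) / (X + δ))) = (X + δ) * (C * Y + δ) := by
      field_simp; ring
    linarith
  have h2 : Filter.Tendsto (fun δ : ℝ => (X + δ) * (C * Y + δ)) (nhdsWithin 0 (Ioi 0))
      (nhds (C * X * Y)) := by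
    have : Continuous fun δ : ℝ => (X + δ) * (C * Y + δ) := by fun_prop
    have := (this.tendsto 0).mono_left (nhdsWithin_le_nhds (s := Ioi 0))
    simpa [mul_comm, mul_left_comm, mul_assoc] using this
  exact ge_of_tendsto h2 (Filter.eventually_of_mem self_mem_nhdsWithin fun δ hδ => h1 δ hδ)

variable {N : ℕ} {f w : ℝ → ℝ}

/-- Against w = 1 the pairing density is f itself, so the lattice sum is the integral of f. -/
theorem sum_displacement_eq_zero (hN : 0 < N) (hf : f ∈ Displacement (latt N)) :
    ∑ l ∈ Finset.Icc (1 : ℤ) N, spacing N * f (latt N l) = 0 := by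
  have h1 : IsP1 (latt N) fun _ => (1 : ℝ) := ⟨continuous_const, fun _ => ⟨0, 1, by simp⟩⟩
  have h2 := Mesh.atomPairing_eq_integral hN hf.1 h1 hf.2.1 (fun _ => rfl)
  have h3 : Mesh.pairingDensity N f (fun _ => 1) = f := by
    funext t; simp [Mesh.pairingDensity]
  rw [h3, hf.2.2] at h2
  simpa [atomPairing] using h2

theorem atomPairing_add_const (hN : 0 < N) (hf : f ∈ Displacement (latt N)) (w : ℝ → ℝ) (c : ℝ) :
    atomPairing N f (fun t => w t + c) = atomPairing N f w := by
  have h1 := sum_displacement_eq_zero hN hf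
  have h2 : atomPairing N f (fun t => w t + c) =
      atomPairing N f w + c * ∑ l ∈ Finset.Icc (1 : ℤ) N, spacing N * f (latt N l) := by
    unfold atomPairing
    rw [Finset.mul_sum, ← Finset.sum_add_distrib]
    exact Finset.sum_congr rfl fun l _ => by ring
  rw [h2, h1, mul_zero, add_zero]

theorem atomDeriv_congr (hN : 0 < N) (phi : ℝ → ℝ) {y y' v v' : ℝ → ℝ}
    (hy : ∀ l, elemGrad (latt N) y l = elemGrad (latt N) y' l)
    (hv : ∀ l, elemGrad (latt N) v l = elemGrad (latt N) v' l) :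
    atomDeriv phi N y v = atomDeriv phi N y' v' := by
  simp only [atomDeriv_eq hN, hy, hv]

/-- The residual of a solution of the quasicontinuum problem in the atomistic equations. -/
theorem residual_le (hN : 0 < N) (m : Mesh N) {phi : ℝ → ℝ} {rstar F : ℝ}
    (h : IsPotential phi rstar) (hf : f ∈ Displacement (latt N)) {yqc ya v : ℝ → ℝ}
    (hq : IsSolution (m.qcEnergy phi F f) m.x F yqc)
    (ha : IsSolution (atomEnergy phi N F f) (latt N) F ya) (hv : v ∈ Displacement (latt N)) :
    atomDeriv phi N ya v - atomDeriv phi N yqc v ≤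
      19 / 10 * (m.estStore phi yqc + m.estExt f) * gradNormTwo N v := by
  have hvp := Displacement.periodic hv
  -- The QC pairing need not annihilate constants, so the same c is subtracted from v in both
  -- pairings; the lattice pairing ignores it because f has mean zero.
  obtain ⟨c, W, hW, hWx, hWB⟩ := m.isPartition.exists_displacement hvp
  have hw : IsP1 (latt N) fun t => v t + -c := hv.1.const_add (-c)
  have hwp : ∀ t, v (t + 1) + -c = v t + -c := fun t => by rw [hvp]
  have hG := gradNormTwo_add_const N v (-c)
  have hY := gradNormTwo_nonneg N v
  have hbd : ∀ t, (v t + -c) ^ 2 ≤ gradNormTwo N (fun t => v t + -c) ^ 2 := by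
    intro t
    rw [hG]
    refine sq_le_sq' ?_ ?_ <;>
    have := abs_le.1 (hWB (gradNormTwo N v) (fun s t => abs_le_of_sq_le_sq
      (sq_sub_le_gradNormTwo hN hv.1 hvp s t) hY) t) <;> linarith
  have e1 := atomDeriv_eq_pairing hN h ha hv
  have e2 := m.qcDeriv_eq_pairing hN h hq hW
  rw [m.qcDeriv_congr hN hWx] at e2
  have e3 : m.qcPairing f W = m.qcPairing f fun t => v t + -c := by
    unfold Mesh.qcPairing
    simp only [hWx, sub_eq_add_neg]
  have e4 := atomPairing_add_const hN hf v (-c)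
  have hs := le_of_forall_amgm (R := m.qcDeriv phi yqc v - atomDeriv phi N yqc v)
    (X := m.estStore phi yqc) (Y := gradNormTwo N v) (C := 19 / 10) (Real.sqrt_nonneg _) hY
    (by norm_num) fun lam hl => by
      have h1 := m.stored_residual_le (phi := phi) hN (Deformation.isP1 hq.admissible)
        (Deformation.periodic hq.admissible) hv.1 hvp hl
      -- The stored part needs only √3, and 3 ≤ (19/10)² = 361/100.
      have h2 : 3 * gradNormTwo N v ^ 2 / (2 * lam) ≤
          (19 / 10) ^ 2 * gradNormTwo N v ^ 2 / (2 * lam) := by gcongr; norm_num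
      linarith
  have he := le_of_forall_amgm (R := atomPairing N f (fun t => v t + -c) -
      m.qcPairing f fun t => v t + -c)
    (X := m.estExt f) (Y := gradNormTwo N v) (C := 19 / 10) (Real.sqrt_nonneg _) hY
    (by norm_num) fun lam hl => by
      -- The rescaled parameter moves the constant from the estimator to the gradient norm, where
      -- 7/2 ≤ (19/10)² applies.
      have h1 := m.ext_residual_le hN hf.1 hw hf.2.1 hwp hbd (lam := lam / (19 / 10) ^ 2)
        (by positivity)
      rw [hG] at h1
      have h2 : lam / (19 / 10) ^ 2 / 2 * (7 / 2 * m.estExt f ^ 2) ≤ lam / 2 * m.estExt f ^ 2 := by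
        have h4 : 0 ≤ lam * m.estExt f ^ 2 := by positivity
        have h5 : lam / (19 / 10) ^ 2 / 2 * (7 / 2 * m.estExt f ^ 2) =
            175 / 361 * (lam * m.estExt f ^ 2) := by ring
        linarith
      have h3 : gradNormTwo N v ^ 2 / (2 * (lam / (19 / 10) ^ 2)) =
          (19 / 10) ^ 2 * gradNormTwo N v ^ 2 / (2 * lam) := by field_simp
      linarith
  rw [e3] at e2
  linarith

/-- The error estimate in terms of the stability constant of the projected solution. -/
theorem stability_le (hN : 0 < N) (m : Mesh N) {phi : ℝ → ℝ} {rstar F τ M : ℝ}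
    (h : IsPotential phi rstar) (hM : ∀ r, rstar / 4 ≤ r → |iteratedDeriv 3 phi r| ≤ M)
    (hf : f ∈ Displacement (latt N)) {yqc ya : ℝ → ℝ}
    (hq : IsSolution (m.qcEnergy phi F f) m.x F yqc)
    (hz : ∀ l : ℤ, rstar / 2 ≤ elemGrad (latt N) (proj N F yqc) l)
    (ha : IsSolution (atomEnergy phi N F f) (latt N) F ya) (hτ : τ ≤ rstar / 4)
    (he : ∀ l, |elemGrad (latt N) (ya - proj N F yqc) l| ≤ τ) :
    (stabConst phi N (proj N F yqc) - 9 * M * τ) * gradNormTwo N (ya - proj N F yqc) ≤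
      19 / 10 * (m.estStore phi yqc + m.estExt f) := by
  have hqp := Deformation.periodic hq.admissible
  have hap := Deformation.periodic ha.admissible
  have hzp := proj_periodic hN hqp
  have hx := latt_isPartition hN
  set z := proj N F yqc with hzdef
  set e := ya - z with hedef
  have hsub : e = fun t => ya t + -1 * z t := by
    funext t; simp only [hedef, Pi.sub_apply]; ring
  have heP : IsP1 (latt N) e := by
    rw [hsub]; exact (Deformation.isP1 ha.admissible).add ((proj_isP1 hN hqp).const_mul _)
  have hep : ∀ t, e (t + 1) = e t := fun t => by
    simp only [hedef, Pi.sub_apply, hap, hzp]; ring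
  set c := -(∫ t in (0 : ℝ)..1, e t) with hc
  have hv : (fun t => e t + c) ∈ Displacement (latt N) := by
    refine ⟨heP.const_add c, fun t => by simp only [hep], ?_⟩
    rw [intervalIntegral.integral_add (heP.1.intervalIntegrable _ _) intervalIntegrable_const]
    simp [hc]
  have hR := residual_le hN m h hf hq ha hv
  -- Only lattice gradients enter `atomDeriv`, so the mean-zero shift of e disappears and y_qc may
  -- be replaced by its projection.
  rw [gradNormTwo_add_const, atomDeriv_congr hN phi (fun _ => rfl)
    (fun l => elemGrad_add_const _ e c l), atomDeriv_congr hN phi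
    (fun l => (elemGrad_proj hN hqp l).symm) (fun l => elemGrad_add_const _ e c l)] at hR
  have hge := h.sum_stress_ge (A := stabConst phi N z) (n := N) hM
    (elemGrad_add_period hx hzp) (elemGrad_add_period hx (g := e) (F := 0) (by simpa using hep))
    hz he hτ (fun l => stabConst_le hN hzp l)
  have hya : ∀ l, elemGrad (latt N) ya l = elemGrad (latt N) z l + elemGrad (latt N) e l := by
    intro l; rw [hedef, elemGrad_sub]; ring
  have hε := spacing_pos hN
  have h1 : (stabConst phi N z - 9 * M * τ) * gradNormTwo N e ^ 2 ≤
      atomDeriv phi N ya e - atomDeriv phi N z e := by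
    rw [gradNormTwo_sq hN, atomDeriv_eq hN, atomDeriv_eq hN]
    have h2 := mul_le_mul_of_nonneg_left hge hε.le
    rw [mul_left_comm]
    refine h2.trans_eq ?_
    rw [Finset.mul_sum, ← Finset.sum_sub_distrib]
    refine Finset.sum_congr rfl fun l _ => ?_
    rw [hya, hya]
    ring
  have hY := gradNormTwo_nonneg N e
  rcases hY.eq_or_lt with h0 | h0
  · rw [← h0, mul_zero]
    exact mul_nonneg (by norm_num) (add_nonneg (Real.sqrt_nonneg _) (Real.sqrt_nonneg _))
  · refine le_of_mul_le_mul_right ?_ h0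
    calc _ = (stabConst phi N z - 9 * M * τ) * gradNormTwo N e ^ 2 := by ring
      _ ≤ _ := h1.trans hR

end QC

end

/-- For every `α > 0` there is `τ₀ > 0`, depending only on the potential, `r_*` and `α`, such that
the a posteriori estimate holds whenever `A_* ≥ α` and the `W^{1,∞}` distance is at most `τ ≤ τ₀`. -/
theorem mainTheorem1 (phi : ℝ → ℝ) (rstar : ℝ) (hphi : QC.IsPotential phi rstar)
    (α : ℝ) (hα : 0 < α) :
    ∃ τ₀ : ℝ, 0 < τ₀ ∧
      ∀ (N : ℕ), 0 < N → ∀ (m : QC.Mesh N) (F : ℝ), 0 < F →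
      ∀ f ∈ QC.Displacement (QC.latt N),
      ∀ yqc ya : ℝ → ℝ,
        QC.IsSolution (m.qcEnergy phi F f) m.x F yqc →
        (∀ l : ℤ, rstar / 2 ≤ QC.elemGrad (QC.latt N) (QC.proj N F yqc) l) →
        α ≤ QC.stabConst phi N (QC.proj N F yqc) →
        QC.IsSolution (QC.atomEnergy phi N F f) (QC.latt N) F ya →
        ∀ τ : ℝ, 0 < τ → τ ≤ τ₀ →
        MeasureTheory.eLpNorm (deriv (ya - QC.proj N F yqc)) ⊤
            (MeasureTheory.volume.restrict (Set.Icc (0 : ℝ) 1)) ≤ ENNReal.ofReal τ →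
        MeasureTheory.eLpNorm (deriv (ya - QC.proj N F yqc)) 2
            (MeasureTheory.volume.restrict (Set.Icc (0 : ℝ) 1)) =
          ENNReal.ofReal (QC.gradNormTwo N (ya - QC.proj N F yqc)) ∧
        QC.gradNormTwo N (ya - QC.proj N F yqc) ≤
          2 / QC.stabConst phi N (QC.proj N F yqc) * (m.estStore phi yqc + m.estExt f) ∧
        0 < QC.stabConst phi N ya ∧
        QC.gradNormTwo N (ya - QC.proj N F yqc) ≤
          2 / QC.stabConst phi N ya * (m.estStore phi yqc + m.estExt f) := by
  open QC in
  have hr := hphi.rstar_pos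
  obtain ⟨M₀, hM₀⟩ := hphi.third_bounded (rstar / 4) (by linarith)
  have hM : ∀ r, rstar / 4 ≤ r → |iteratedDeriv 3 phi r| ≤ max M₀ 1 :=
    fun r hr => (hM₀ r hr).trans (le_max_left _ _)
  set M := max M₀ 1
  -- The first bound keeps all stretches above r_*/4, where M bounds φ'''. The second gives 9Mτ ≤
  -- 9α/400 ≤ α/40. The maximum with 1 in M makes the quotient meaningful when φ''' vanishes.
  refine ⟨min (rstar / 4) (α / (400 * M)), lt_min (by linarith) (by positivity), ?_⟩
  intro N hN m F _ f hf yqc ya hq hz hA ha τ hτ0 hτ hτe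
  have hqp := Deformation.periodic hq.admissible
  have hap := Deformation.periodic ha.admissible
  have hzp := proj_periodic hN hqp
  have hep : ∀ t, (ya - proj N F yqc) (t + 1) = (ya - proj N F yqc) t := fun t => by
    simp only [Pi.sub_apply, hap, hzp]; ring
  have heP : IsP1 (latt N) (ya - proj N F yqc) := by
    have : ya - proj N F yqc = fun t => ya t + -1 * proj N F yqc t := by
      funext t; simp only [Pi.sub_apply]; ring
    rw [this]
    exact (Deformation.isP1 ha.admissible).add ((proj_isP1 hN hqp).const_mul _)
  have hτ1 : τ ≤ rstar / 4 := hτ.trans (min_le_left _ _)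
  have hτ2 : 9 * M * τ ≤ α / 40 := by
    have h1 := hτ.trans (min_le_right _ _)
    rw [le_div_iff₀ (by positivity)] at h1
    linarith
  have he := abs_elemGrad_le hN heP hep hτ0.le hτe
  have hmain := stability_le hN m hphi hM hf hq hz ha hτ1 he
  have hY := gradNormTwo_nonneg N (ya - proj N F yqc)
  have hd := abs_stabCoeff_sub_le hphi (y := ya) hM hz
    (fun l => by rw [← elemGrad_sub]; exact he l) hτ1
  have hlow : stabConst phi N (proj N F yqc) - 9 * M * τ ≤ stabConst phi N ya :=
    le_stabConst hN fun l => by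
      linarith [(abs_le.1 (hd l)).1, stabConst_le (phi := phi) hN hzp l]
  have hupp : stabConst phi N ya - 9 * M * τ ≤ stabConst phi N (proj N F yqc) :=
    le_stabConst hN fun l => by
      linarith [(abs_le.1 (hd l)).2, stabConst_le (phi := phi) hN hap l]
  -- The residual constant 19/10 against the loss 19/20 yields the factor 2. For B = A_*(J y_qc) the
  -- condition needs 9Mτ ≤ A_*/20. For B = A_*(y_a) ≤ A_*(J y_qc) + α/40 it reduces to (39/40)α ≤
  -- A_*(J y_qc).
  have key : ∀ B : ℝ, 0 < B → 19 / 20 * B ≤ stabConst phi N (proj N F yqc) - 9 * M * τ →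
      gradNormTwo N (ya - proj N F yqc) ≤ 2 / B * (m.estStore phi yqc + m.estExt f) := by
    intro B hB h1
    rw [div_mul_eq_mul_div, le_div_iff₀ hB]
    linarith [mul_le_mul_of_nonneg_right h1 hY]
  have hpos : 0 < stabConst phi N ya := by linarith
  exact ⟨eLpNorm_deriv_two hN heP hep, key _ (by linarith) (by linarith), hpos,
    key _ hpos (by linarith)⟩
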